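/- **Setting.** On $\mathbb C^{2n}=\{Y=(P,Q):P,Q\in\mathbb C^n\}$ let $\omega((P,Q),(P',Q'))=\sum_j(P_jQ'_j-P'_jQ_j)$, and on $\mathcal S(\mathbb R^n)$ let $\Omega(P,Q)=\sum_j\bigl(P_j\xi_j-Q_j\frac1i\frac{\partial}{\partial\xi_j}\bigr)$. Let $\mathcal L_k\subset\mathbb R^{2n}$ be a $k$-dimensional subspace, isotropic for $\omega$, with a shift-invariant (Haar) measure $\mu$, and let $\mathcal L_k^{\mathbb C}\subset\mathbb C^{2n}$ be its complexification. On $\mathcal S(\mathbb R^n)$ put $$\langle f,g\rangle=\int_{\mathcal L_k}d\mu(X)\,(f,e^{i\Omega(X)}g)_{L^2(\mathbb R^n)},$$ a positive semidefinite Hermitian form. Write $\|f\|=\langle f,f\rangle^{1/2}$, $f\sim g$ iff $\|f-g\|=0$, $[f]$ for the class of $f$, and let $\mathcal H$ be the completion of $\mathcal S(\mathbb R^n)/\!\sim$. Let $\mathcal R=\mathcal L_k^{\perp\omega}/\mathcal L_k$ be the reduced phase space with the induced form $\omega$, and $\mathcal R^{\mathbb C}=(\mathcal L_k^{\mathbb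 C})^{\perp\omega}/\mathcal L_k^{\mathbb C}$ its complexification, with complex conjugation $*$. For $\overline Y\in\mathcal R^{\mathbb C}$ with representative $Y$, $\overline\Omega(\overline Y)[f]=[\Omega(Y)f]$ is a well-defined operator on $\mathcal S(\mathbb R^n)/\!\sim$. For a real symmetric tensor $\overline\Gamma=\frac12\sum_{ij}\Gamma_{ij}\overline Z_i\otimes\overline Z_j\in\mathrm{Sym}\,\mathcal R\otimes\mathcal R$ put $\overline\Omega_2(\overline\Gamma)=\frac12\sum_{ij}\Gamma_{ij}\overline\Omega(\overline Z_i)\overline\Omega(\overline Z_j)$ and $\overline Y\circ\overline\Gamma=\sum_{ij}\Gamma_{ij}\,\omega(\overline Y,\overline Z_i)\overline Z_j$. The reduced Hamiltonian system is $$\frac{d\overline Y}{dt}=\overline Y\circ\overline\Gamma;\tag{1}$$ it is called stable if its zero solution in $\mathcal R$ is Lyapunov stable. A Gaussian function is $\psi_A(\xi)=c\,e^{\frac i2\sum_{jl}\xi_jA_{jl}\xi_l}$ with $c\ne0$ and $A$ a complex symmetric matrix with positive definite imaginary part; its H-germ is $\check r(A)=\{Y\in(\mathcal L_k^{\mathbb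 C})^{\perp\omega}:\ \|\Omega(Y)\psi_A\|=0\}$. **Lemma.** 1. If, for some Gaussian $\psi_A$, $[\psi_A]$ is an eigenvector of $\overline\Omega_2(\overline\Gamma)$, then the system (1) is stable in $\mathcal R$. 2. Let (1) be stable in $\mathcal R$. Then: (a) there exist $\beta_1,\dots,\beta_{n-k}\in\mathbb R$ and $\overline Y^{(1)},\dots,\overline Y^{(n-k)}\in\mathcal R^{\mathbb C}$ such that the $2n-2k$ functions $\overline Y^{(I)}e^{i\beta_It}$ and $\overline Y^{(I)*}e^{-i\beta_It}$, $I=1,\dots,n-k$, are linearly independent solutions of (1) in $\mathcal R^{\mathbb C}$, and $$\tfrac1i\,\omega(\overline Y^{(I)},\overline Y^{(J)*})=\delta_{IJ},\qquad \omega(\overline Y^{(I)},\overline Y^{(J)})=0 .$$ Moreover, for all $\beta_I,\overline Y^{(I)}$ as in (a) and all representatives $Y^{(I)}\in(\mathcal L_k^{\mathbb C})^{\perp\omega}$ of the $\overline Y^{(I)}$: (b) $\check r=\mathrm{span}\{Y^{(1)},\dots,Y^{(n-k)},\mathcal L_k^{\mathbb C}\}$ is an H-germ: $\check r=\check r(A)$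 for some Gaussian $\psi_A$; (c) for every Gaussian $\psi_A$ with $\check r(A)=\check r$ and all $N_1,\dots,N_{n-k}\in\{0,1,2,\dots\}$, the vector $$\overline\Omega(\overline Y^{(1)*})^{N_1}\cdots\overline\Omega(\overline Y^{(n-k)*})^{N_{n-k}}[\psi_A]$$ is an eigenvector (in particular non-zero) of $\overline\Omega_2(\overline\Gamma)$ with eigenvalue $\beta_1(N_1+\tfrac12)+\dots+\beta_{n-k}(N_{n-k}+\tfrac12)$, and the linear span of these vectors is dense in $\mathcal H$. -/

import Mathlib

open MeasureTheory Module Filter Topology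
open scoped SchwartzMap TensorProduct LineDeriv

noncomputable section

namespace ConstrainedQM

/-- Phase space: pairs `(P, Q)` of momenta and coordinates. -/
abbrev Phase (𝕜 : Type) (n : ℕ) : Type := (Fin n → 𝕜) × (Fin n → 𝕜)

/-- The symplectic form `ω((P,Q),(P',Q')) = ∑ⱼ (Pⱼ Q'ⱼ - P'ⱼ Qⱼ)`. -/
def symp (𝕜 : Type) [CommRing 𝕜] (n : ℕ) : Phase 𝕜 n →ₗ[𝕜] Phase 𝕜 n →ₗ[𝕜] 𝕜 :=
  LinearMap.mk₂ 𝕜 (fun X Y => ∑ j, (X.1 j * Y.2 j - Y.1 j * X.2 j))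
    (fun X X' Y => by
      rw [← Finset.sum_add_distrib]
      exact Finset.sum_congr rfl fun j _ => by simp only [Prod.fst_add, Prod.snd_add, Pi.add_apply]; ring)
    (fun c X Y => by
      rw [Finset.smul_sum]
      exact Finset.sum_congr rfl fun j _ => by
        simp only [Prod.smul_fst, Prod.smul_snd, Pi.smul_apply, smul_eq_mul]; ring)
    (fun X Y Y' => by
      rw [← Finset.sum_add_distrib]
      exact Finset.sum_congr rfl fun j _ => by simp only [Prod.fst_add, Prod.snd_add, Pi.add_apply]; ring)
    (fun c X Y => by
      rw [Finset.smul_sum]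
      exact Finset.sum_congr rfl fun j _ => by
        simp only [Prod.smul_fst, Prod.smul_snd, Pi.smul_apply, smul_eq_mul]; ring)

theorem symp_apply {𝕜 : Type} [CommRing 𝕜] {n : ℕ} (X Y : Phase 𝕜 n) :
    symp 𝕜 n X Y = ∑ j, (X.1 j * Y.2 j - Y.1 j * X.2 j) := rfl

theorem symp_swap {𝕜 : Type} [CommRing 𝕜] {n : ℕ} (X Y : Phase 𝕜 n) :
    symp 𝕜 n X Y = - symp 𝕜 n Y X := by
  simp only [symp_apply, ← Finset.sum_neg_distrib]
  exact Finset.sum_congr rfl fun j _ => by ring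

/-- Configuration space `ℝⁿ`. -/
abbrev Conf (n : ℕ) : Type := EuclideanSpace ℝ (Fin n)

/-- Multiplication by the coordinate `ξⱼ`. -/
def posOp {n : ℕ} (j : Fin n) : 𝓢(Conf n, ℂ) →ₗ[ℂ] 𝓢(Conf n, ℂ) :=
  (SchwartzMap.smulLeftCLM ℂ (fun ξ : Conf n => ((ξ j : ℝ) : ℂ))).toLinearMap

/-- The partial derivative `∂/∂ξⱼ`. -/
def partialOp {n : ℕ} (j : Fin n) : 𝓢(Conf n, ℂ) →ₗ[ℂ] 𝓢(Conf n, ℂ) :=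
  (LineDeriv.lineDerivOpCLM ℂ 𝓢(Conf n, ℂ) (EuclideanSpace.single j (1 : ℝ))).toLinearMap

/-- The operator-valued linear form `Ω(P,Q) = ∑ⱼ (Pⱼ ξⱼ - Qⱼ (1/i) ∂/∂ξⱼ)` on Schwartz space, for
`(P,Q)` in the complexified phase space. -/
def Om (n : ℕ) : Phase ℂ n →ₗ[ℂ] Module.End ℂ 𝓢(Conf n, ℂ) :=
  LinearMap.mk₂ ℂ
    (fun Y f => ∑ j, (Y.1 j • posOp j f - Y.2 j • (1 / Complex.I) • partialOp j f))
    (fun X X' f => by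
      rw [← Finset.sum_add_distrib]
      exact Finset.sum_congr rfl fun j _ => by
        simp only [Prod.fst_add, Prod.snd_add, Pi.add_apply]; module)
    (fun c X f => by
      rw [Finset.smul_sum]
      exact Finset.sum_congr rfl fun j _ => by
        simp only [Prod.smul_fst, Prod.smul_snd, Pi.smul_apply, smul_eq_mul]; module)
    (fun X f g => by
      rw [← Finset.sum_add_distrib]
      exact Finset.sum_congr rfl fun j _ => by simp only [map_add]; module)
    (fun c X f => by
      rw [Finset.smul_sum]
      exact Finset.sum_congr rfl fun j _ => by simp only [map_smul]; module)

/-- The inclusion of the real phase space in the complexified one. -/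
def cx (n : ℕ) : Phase ℝ n →ₗ[ℝ] Phase ℂ n :=
  (Complex.ofRealAm.toLinearMap.compLeft (Fin n)).prodMap
    (Complex.ofRealAm.toLinearMap.compLeft (Fin n))

theorem cx_fst {n : ℕ} (X : Phase ℝ n) (j : Fin n) : (cx n X).1 j = (X.1 j : ℂ) := rfl
theorem cx_snd {n : ℕ} (X : Phase ℝ n) (j : Fin n) : (cx n X).2 j = (X.2 j : ℂ) := rfl

theorem symp_cx {n : ℕ} (X Y : Phase ℝ n) : symp ℂ n (cx n X) (cx n Y) = (symp ℝ n X Y : ℂ) := by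
  simp [symp_apply, cx_fst, cx_snd]

theorem posOp_apply {n : ℕ} (j : Fin n) (f : 𝓢(Conf n, ℂ)) (ξ : Conf n) :
    posOp j f ξ = (ξ j : ℂ) * f ξ := by
  have h : Function.HasTemperateGrowth (fun ξ : Conf n => ((ξ j : ℝ) : ℂ)) :=
    (Complex.ofRealCLM.comp (EuclideanSpace.proj j : Conf n →L[ℝ] ℝ)).hasTemperateGrowth
  exact SchwartzMap.smulLeftCLM_apply_apply h f ξ

theorem partialOp_apply {n : ℕ} (j : Fin n) (f : 𝓢(Conf n, ℂ)) (ξ : Conf n) :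
    partialOp j f ξ = fderiv ℝ f ξ (EuclideanSpace.single j (1 : ℝ)) :=
  SchwartzMap.lineDerivOp_apply_eq_fderiv _ f ξ

theorem Om_apply {n : ℕ} (Y : Phase ℂ n) (f : 𝓢(Conf n, ℂ)) (ξ : Conf n) :
    Om n Y f ξ = ∑ j, (Y.1 j * ((ξ j : ℂ) * f ξ) +
      Complex.I * Y.2 j * fderiv ℝ f ξ (EuclideanSpace.single j (1 : ℝ))) := by
  change (∑ j, (Y.1 j • posOp j f - Y.2 j • (1 / Complex.I) • partialOp j f)) ξ = _
  rw [sum_apply]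
  refine Finset.sum_congr rfl fun j _ => ?_
  simp [posOp_apply, partialOp_apply]
  ring

theorem Om_cx_apply {n : ℕ} (Z : Phase ℝ n) (f : 𝓢(Conf n, ℂ)) (ξ : Conf n) :
    Om n (cx n Z) f ξ = ((∑ j, Z.1 j * ξ j : ℝ) : ℂ) * f ξ +
      Complex.I * fderiv ℝ f ξ (WithLp.toLp 2 Z.2) := by
  have hq : (WithLp.toLp 2 Z.2 : Conf n) = ∑ j, Z.2 j • EuclideanSpace.single j (1 : ℝ) := by
    ext i
    simp [Finset.sum_apply, Pi.single_apply]
  rw [Om_apply, hq, map_sum, Finset.sum_add_distrib, Finset.mul_sum]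
  push_cast
  rw [Finset.sum_mul]
  congr 1
  · exact Finset.sum_congr rfl fun j _ => by rw [cx_fst]; ring
  · exact Finset.sum_congr rfl fun j _ => by rw [cx_snd, map_smul, Complex.real_smul]; ring

/-- The unitary operator `e^{iΩ(X)}` for real `X = (P,Q)`, in explicit form
`(e^{iΩ(P,Q)} f)(ξ) = e^{i ∑ⱼ Pⱼ (ξⱼ - Qⱼ/2)} f(ξ - Q)`. -/
def weyl {n : ℕ} (X : Phase ℝ n) (f : Conf n → ℂ) (ξ : Conf n) : ℂ :=
  Complex.exp (Complex.I * ((∑ j, X.1 j * (ξ j - X.2 j / 2) : ℝ) : ℂ)) *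
    f (ξ - WithLp.toLp 2 X.2)

theorem norm_weyl {n : ℕ} (X : Phase ℝ n) (f : Conf n → ℂ) (ξ : Conf n) :
    ‖weyl X f ξ‖ = ‖f (ξ - WithLp.toLp 2 X.2)‖ := by
  rw [weyl, norm_mul, mul_comm Complex.I, Complex.norm_exp_ofReal_mul_I, one_mul]

/-- Along a direction `Z` skew-orthogonal to `X`, the derivative of `e^{iΩ(X+tZ)} f` is
`e^{iΩ(X+tZ)} iΩ(Z) f`; with `X = 0` this says that `iΩ(Z)` generates `e^{itΩ(Z)}`. -/
theorem hasDerivAt_weyl {n : ℕ} (X Z : Phase ℝ n) (h : symp ℝ n X Z = 0) (f : 𝓢(Conf n, ℂ))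
    (ξ : Conf n) (t : ℝ) :
    HasDerivAt (fun s : ℝ => weyl (X + s • Z) f ξ)
      (Complex.I * weyl (X + t • Z) (Om n (cx n Z) f) ξ) t := by
  have h1 : HasDerivAt (fun s : ℝ => ∑ j, (X + s • Z).1 j * (ξ j - (X + s • Z).2 j / 2))
      (∑ j, (Z.1 j * (ξ j - (X + t • Z).2 j / 2) + (X + t • Z).1 j * (- (Z.2 j / 2)))) t := by
    refine HasDerivAt.fun_sum fun j _ => ?_
    have a : HasDerivAt (fun s : ℝ => (X + s • Z).1 j) (Z.1 j) t := by
      simpa using ((hasDerivAt_id t).mul_const (Z.1 j)).const_add (X.1 j)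
    have b : HasDerivAt (fun s : ℝ => (X + s • Z).2 j) (Z.2 j) t := by
      simpa using ((hasDerivAt_id t).mul_const (Z.2 j)).const_add (X.2 j)
    exact a.mul ((b.div_const 2).const_sub (ξ j))
  have h2 : HasDerivAt (fun s : ℝ => ξ - WithLp.toLp 2 (X + s • Z).2)
      (- WithLp.toLp 2 Z.2 : Conf n) t := by
    have : HasDerivAt (fun s : ℝ => (WithLp.toLp 2 X.2 : Conf n) + s • WithLp.toLp 2 Z.2)
        (WithLp.toLp 2 Z.2 : Conf n) t := by
      simpa using ((hasDerivAt_id t).smul_const (WithLp.toLp 2 Z.2 : Conf n)).const_add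
        (WithLp.toLp 2 X.2 : Conf n)
    exact this.const_sub ξ
  have h3 := (f.differentiableAt (x := ξ - WithLp.toLp 2 (X + t • Z).2)).hasFDerivAt.comp_hasDerivAt t h2
  have h4 := ((h1.ofReal_comp.const_mul Complex.I).cexp).mul h3
  refine h4.congr_deriv ?_
  rw [weyl, Om_cx_apply]
  have h5 : (∑ j, (Z.1 j * (ξ j - (X + t • Z).2 j / 2) + (X + t • Z).1 j * (- (Z.2 j / 2))))
      = ∑ j, Z.1 j * (ξ - WithLp.toLp 2 (X + t • Z).2) j := by
    rw [← sub_eq_zero, ← Finset.sum_sub_distrib]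
    have : ∑ j, (X.1 j * Z.2 j - Z.1 j * X.2 j) * (-1 / 2) = 0 := by
      rw [← Finset.sum_mul, ← symp_apply, h, zero_mul]
    rw [← this]
    exact Finset.sum_congr rfl fun j _ => by simp; ring
  rw [h5, map_neg, Function.comp_apply]
  ring_nf
  simp only [Complex.I_sq]
  ring


theorem integral_lineDeriv_eq_zero {E : Type*} [NormedAddCommGroup E] [NormedSpace ℝ E]
    [FiniteDimensional ℝ E] [MeasurableSpace E] [BorelSpace E] (μ : Measure E)
    [μ.IsAddHaarMeasure] {u u' : E → ℂ} {v : E} (hu : Integrable u μ) (hu' : Integrable u' μ)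
    (h : ∀ x, HasLineDerivAt ℝ u (u' x) x v) : ∫ x, u' x ∂μ = 0 := by
  have := integral_bilinear_hasLineDerivAt_right_eq_neg_left_of_integrable (μ := μ)
    (f := u) (f' := u') (g := fun _ : E => (1 : ℂ)) (g' := fun _ => 0) (v := v)
    (B := ContinuousLinearMap.mul ℝ ℂ) (by simpa using hu') (by simp) (by simpa using hu)
    (fun x _ => h x) (fun x _ => by
      simpa [HasLineDerivAt] using hasDerivAt_const (0 : ℝ) (1 : ℂ))
  simpa using this

theorem exists_bound {n : ℕ} (g : 𝓢(Conf n, ℂ)) : ∃ K, 0 ≤ K ∧ ∀ ξ, ‖g ξ‖ ≤ K :=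
  ⟨SchwartzMap.seminorm ℝ 0 0 g, apply_nonneg _ _, fun ξ => SchwartzMap.norm_le_seminorm ℝ g ξ⟩

theorem continuous_weyl {n : ℕ} (g : 𝓢(Conf n, ℂ)) :
    Continuous (fun p : Phase ℝ n × Conf n => weyl p.1 g p.2) := by
  unfold weyl
  have := g.continuous
  fun_prop

theorem continuous_weyl_right {n : ℕ} (g : 𝓢(Conf n, ℂ)) (X : Phase ℝ n) :
    Continuous (fun ξ : Conf n => weyl X g ξ) := by
  unfold weyl
  have := g.continuous
  fun_prop

theorem continuous_weyl_left {n : ℕ} (g : 𝓢(Conf n, ℂ)) (ξ : Conf n) :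
    Continuous (fun X : Phase ℝ n => weyl X g ξ) := by
  unfold weyl
  have := g.continuous
  fun_prop

/-- The matrix element `(f, e^{iΩ(X)} g)` in `L²(ℝⁿ)`. -/
def coef {n : ℕ} (f g : 𝓢(Conf n, ℂ)) (X : Phase ℝ n) : ℂ :=
  ∫ ξ, starRingEnd ℂ (f ξ) * weyl X g ξ

theorem integrable_norm_mul {n : ℕ} (f : 𝓢(Conf n, ℂ)) (K : ℝ) :
    Integrable (fun ξ => ‖f ξ‖ * K) (volume : Measure (Conf n)) := by
  have h : Integrable (fun ξ => f ξ) (volume : Measure (Conf n)) := f.integrable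
  exact h.norm.mul_const K

theorem norm_mul_weyl_le {n : ℕ} (f g : 𝓢(Conf n, ℂ)) {K : ℝ} (hg : ∀ ξ, ‖g ξ‖ ≤ K)
    (X : Phase ℝ n) (ξ : Conf n) : ‖starRingEnd ℂ (f ξ) * weyl X g ξ‖ ≤ ‖f ξ‖ * K := by
  rw [norm_mul, norm_weyl, Complex.norm_conj]
  exact mul_le_mul_of_nonneg_left (hg _) (norm_nonneg _)

theorem integrable_mul_weyl {n : ℕ} (f g : 𝓢(Conf n, ℂ)) (X : Phase ℝ n) :
    Integrable (fun ξ => starRingEnd ℂ (f ξ) * weyl X g ξ) := by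
  obtain ⟨K, hK, hg⟩ := exists_bound g
  have hc := continuous_weyl_right g X
  have hf : Continuous (fun ξ => starRingEnd ℂ (f ξ)) := Complex.continuous_conj.comp f.continuous
  exact Integrable.mono' (integrable_norm_mul f K) (hf.mul hc).aestronglyMeasurable
    (Eventually.of_forall fun ξ => norm_mul_weyl_le f g hg X ξ)

theorem continuous_coef {n : ℕ} (f g : 𝓢(Conf n, ℂ)) : Continuous (coef f g) := by
  obtain ⟨K, hK, hg⟩ := exists_bound g
  refine continuous_of_dominated (bound := fun ξ => ‖f ξ‖ * K)
    (fun X => (integrable_mul_weyl f g X).aestronglyMeasurable) (fun X => ?_)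
    (integrable_norm_mul f K) ?_
  · exact Eventually.of_forall fun ξ => norm_mul_weyl_le f g hg X ξ
  · refine Eventually.of_forall fun ξ => ?_
    exact continuous_const.mul (continuous_weyl_left g ξ)

theorem weyl_Om {n : ℕ} (g : 𝓢(Conf n, ℂ)) (X Z : Phase ℝ n) (ξ : Conf n) :
    weyl X (Om n (cx n Z) g) ξ = ((∑ j, Z.1 j * ξ j : ℝ) : ℂ) * weyl X g ξ -
      ((∑ j, Z.1 j * X.2 j : ℝ) : ℂ) * weyl X g ξ +
      Complex.I * weyl X (fun η => fderiv ℝ g η (WithLp.toLp 2 Z.2)) ξ := by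
  have : (∑ j, Z.1 j * (ξ - WithLp.toLp 2 X.2) j : ℝ) =
      (∑ j, Z.1 j * ξ j : ℝ) - (∑ j, Z.1 j * X.2 j : ℝ) := by
    rw [← Finset.sum_sub_distrib]
    exact Finset.sum_congr rfl fun j _ => by simp; ring
  simp only [weyl, Om_cx_apply, this]
  push_cast
  ring

theorem hasLineDerivAt_weyl {n : ℕ} (g : 𝓢(Conf n, ℂ)) (X : Phase ℝ n) (q : Fin n → ℝ)
    (ξ : Conf n) :
    HasLineDerivAt ℝ (weyl X g) (Complex.I * ((∑ j, X.1 j * q j : ℝ) : ℂ) * weyl X g ξ +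
      weyl X (fun η => fderiv ℝ g η (WithLp.toLp 2 q)) ξ) ξ (WithLp.toLp 2 q) := by
  unfold HasLineDerivAt
  have h1 : HasDerivAt (fun s : ℝ => ∑ j, X.1 j * ((ξ + s • WithLp.toLp 2 q) j - X.2 j / 2))
      (∑ j, X.1 j * q j) 0 := by
    refine HasDerivAt.fun_sum fun j _ => ?_
    have a : HasDerivAt (fun s : ℝ => (ξ + s • WithLp.toLp 2 q) j) (q j) 0 := by
      simpa using ((hasDerivAt_id (0 : ℝ)).mul_const (q j)).const_add (ξ j)
    exact (a.sub_const _).const_mul _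
  have h2 : HasDerivAt (fun s : ℝ => ξ + s • WithLp.toLp 2 q - WithLp.toLp 2 X.2)
      (WithLp.toLp 2 q : Conf n) 0 := by
    simpa using (((hasDerivAt_id (0 : ℝ)).smul_const (WithLp.toLp 2 q : Conf n)).const_add
        ξ).sub_const (WithLp.toLp 2 X.2 : Conf n)
  have h3 := (g.differentiableAt
    (x := ξ + (0 : ℝ) • WithLp.toLp 2 q - WithLp.toLp 2 X.2)).hasFDerivAt.comp_hasDerivAt 0 h2
  refine (((h1.ofReal_comp.const_mul Complex.I).cexp).mul h3).congr_deriv ?_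
  simp [weyl]
  ring

theorem coef_Om_left {n : ℕ} (f g : 𝓢(Conf n, ℂ)) (X Z : Phase ℝ n) :
    coef (Om n (cx n Z) f) g X =
      coef f (Om n (cx n Z) g) X - (symp ℝ n X Z : ℂ) * coef f g X := by
  let u : Conf n → ℂ := fun ξ => starRingEnd ℂ (f ξ) * weyl X g ξ
  let w : Conf n → ℂ := fun ξ => starRingEnd ℂ (Om n (cx n Z) f ξ) * weyl X g ξ -
    (starRingEnd ℂ (f ξ) * weyl X (Om n (cx n Z) g) ξ -
      (symp ℝ n X Z : ℂ) * (starRingEnd ℂ (f ξ) * weyl X g ξ))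
  have i1 := integrable_mul_weyl (Om n (cx n Z) f) g X
  have i2 := integrable_mul_weyl f (Om n (cx n Z) g) X
  have i3 := integrable_mul_weyl f g X
  have i4 := i3.const_mul (symp ℝ n X Z : ℂ)
  have hw : Integrable w := i1.sub (i2.sub i4)
  have hz : ∫ ξ, Complex.I * w ξ = 0 := by
    refine integral_lineDeriv_eq_zero volume (u := u) (v := WithLp.toLp 2 Z.2) i3
      (hw.const_mul _) fun ξ => ?_
    have hf : HasLineDerivAt ℝ (fun η => starRingEnd ℂ (f η))
        (starRingEnd ℂ (fderiv ℝ f ξ (WithLp.toLp 2 Z.2))) ξ (WithLp.toLp 2 Z.2) := by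
      have := (f.differentiableAt (x := ξ)).hasFDerivAt.hasLineDerivAt (WithLp.toLp 2 Z.2)
      exact HasDerivAt.star this
    refine (HasDerivAt.mul hf (hasLineDerivAt_weyl g X Z.2 ξ)).congr_deriv ?_
    simp only [w, weyl_Om, Om_cx_apply, map_add, map_mul, Complex.conj_I, Complex.conj_ofReal,
      symp_apply, Finset.sum_sub_distrib, zero_smul, add_zero]
    push_cast
    ring_nf
    simp only [Complex.I_sq]
    ring
  rw [integral_const_mul] at hz
  have hz' : ∫ ξ, w ξ = 0 := by
    rcases mul_eq_zero.1 hz with h | h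
    · exact absurd h Complex.I_ne_zero
    · exact h
  have e : ∫ ξ, w ξ = coef (Om n (cx n Z) f) g X -
      (coef f (Om n (cx n Z) g) X - (symp ℝ n X Z : ℂ) * coef f g X) := by
    simp only [w]
    rw [integral_sub i1 (by exact i2.sub i4), integral_sub i2 i4, integral_const_mul]
    rfl
  exact sub_eq_zero.1 (e.symm.trans hz')

theorem norm_phase_le {n : ℕ} (X : Phase ℝ n) : ‖X‖ ≤ ∑ j, (‖X.1 j‖ + ‖X.2 j‖) := by
  have h0 : 0 ≤ ∑ j, (‖X.1 j‖ + ‖X.2 j‖) := Finset.sum_nonneg fun j _ => by positivity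
  have h1 : ∀ j, ‖X.1 j‖ + ‖X.2 j‖ ≤ ∑ j, (‖X.1 j‖ + ‖X.2 j‖) := fun j =>
    Finset.single_le_sum (f := fun j => ‖X.1 j‖ + ‖X.2 j‖) (fun j _ => by positivity)
      (Finset.mem_univ j)
  rw [Prod.norm_def]
  refine max_le ((pi_norm_le_iff_of_nonneg h0).2 fun j => ?_)
    ((pi_norm_le_iff_of_nonneg h0).2 fun j => ?_)
  · linarith [h1 j, norm_nonneg (X.2 j)]
  · linarith [h1 j, norm_nonneg (X.1 j)]

theorem coef_decay {n : ℕ} (m : ℕ) : ∀ f g : 𝓢(Conf n, ℂ),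
    ∃ K, ∀ X : Phase ℝ n, ‖X‖ ^ m * ‖coef f g X‖ ≤ K := by
  induction m with
  | zero =>
    intro f g
    obtain ⟨K, hK, hg⟩ := exists_bound g
    refine ⟨∫ ξ, ‖f ξ‖ * K, fun X => ?_⟩
    rw [pow_zero, one_mul]
    refine norm_integral_le_of_norm_le (integrable_norm_mul f K) ?_
    exact Eventually.of_forall fun ξ => norm_mul_weyl_le f g hg X ξ
  | succ m ih =>
    intro f g
    have key : ∀ Z : Phase ℝ n, ∃ K, ∀ X : Phase ℝ n,
        ‖X‖ ^ m * (‖symp ℝ n X Z‖ * ‖coef f g X‖) ≤ K := by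
      intro Z
      obtain ⟨K₁, h₁⟩ := ih (Om n (cx n Z) f) g
      obtain ⟨K₂, h₂⟩ := ih f (Om n (cx n Z) g)
      refine ⟨K₁ + K₂, fun X => ?_⟩
      have e : (symp ℝ n X Z : ℂ) * coef f g X =
          coef f (Om n (cx n Z) g) X - coef (Om n (cx n Z) f) g X := by
        rw [coef_Om_left]; ring
      have e' : ‖symp ℝ n X Z‖ * ‖coef f g X‖ ≤
          ‖coef f (Om n (cx n Z) g) X‖ + ‖coef (Om n (cx n Z) f) g X‖ := by
        rw [← Complex.norm_real, ← norm_mul, e]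
        exact norm_sub_le _ _
      calc _ ≤ ‖X‖ ^ m * (‖coef f (Om n (cx n Z) g) X‖ + ‖coef (Om n (cx n Z) f) g X‖) := by
            gcongr
        _ ≤ _ := by rw [mul_add]; linarith [h₁ X, h₂ X]
    choose K hK using key
    refine ⟨∑ j, (K (0, Pi.single j 1) + K (Pi.single j 1, 0)), fun X => ?_⟩
    calc ‖X‖ ^ (m + 1) * ‖coef f g X‖ = ‖X‖ ^ m * (‖X‖ * ‖coef f g X‖) := by ring
      _ ≤ ‖X‖ ^ m * ((∑ j, (‖X.1 j‖ + ‖X.2 j‖)) * ‖coef f g X‖) := by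
        gcongr
        exact norm_phase_le X
      _ = ∑ j, (‖X‖ ^ m * (‖symp ℝ n X (0, Pi.single j 1)‖ * ‖coef f g X‖) +
            ‖X‖ ^ m * (‖symp ℝ n X (Pi.single j 1, 0)‖ * ‖coef f g X‖)) := by
        rw [Finset.sum_mul, Finset.mul_sum]
        refine Finset.sum_congr rfl fun j _ => ?_
        have a : symp ℝ n X (0, Pi.single j 1) = X.1 j := by
          simp [symp_apply, Pi.single_apply]
        have b : symp ℝ n X (Pi.single j 1, 0) = - X.2 j := by
          simp [symp_apply, Pi.single_apply]
        rw [a, b, norm_neg]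
        ring
      _ ≤ _ := Finset.sum_le_sum fun j _ => add_le_add (hK _ X) (hK _ X)

theorem integrable_of_decay {n : ℕ} (L : Submodule ℝ (Phase ℝ n)) (μ : Measure L)
    [μ.IsAddHaarMeasure] {E : Type*} [NormedAddCommGroup E] {F : L → E} (hF : Continuous F)
    {K₀ K₁ : ℝ} (h₀ : ∀ X, ‖F X‖ ≤ K₀)
    (h₁ : ∀ X : L, ‖X‖ ^ (2 * (finrank ℝ L + 1)) * ‖F X‖ ≤ K₁) : Integrable F μ := by
  set r : ℕ := 2 * (finrank ℝ L + 1)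
  have hi : Integrable (fun X : L => (1 + ‖X‖) ^ (-(r : ℝ))) μ :=
    integrable_one_add_norm (by simp only [r]; push_cast; linarith [Nat.cast_nonneg (α := ℝ) (finrank ℝ L)])
  refine Integrable.mono' (hi.mul_const (2 ^ (r - 1) * (K₀ + K₁))) hF.aestronglyMeasurable ?_
  refine Eventually.of_forall fun X => ?_
  have hp : (0 : ℝ) < (1 + ‖X‖) ^ r := by positivity
  rw [Real.rpow_neg (by positivity), Real.rpow_natCast, inv_mul_eq_div, le_div_iff₀ hp, mul_comm]
  have := add_pow_le (zero_le_one' ℝ) (norm_nonneg X) r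
  calc _ ≤ (2 ^ (r - 1) * (1 ^ r + ‖X‖ ^ r)) * ‖F X‖ := by gcongr
    _ = 2 ^ (r - 1) * (‖F X‖ + ‖X‖ ^ r * ‖F X‖) := by ring
    _ ≤ _ := by gcongr; exacts [h₀ _, h₁ _]

theorem integrable_coef {n : ℕ} (L : Submodule ℝ (Phase ℝ n)) (μ : Measure L)
    [μ.IsAddHaarMeasure] (f g : 𝓢(Conf n, ℂ)) :
    Integrable (fun X : L => coef f g (X : Phase ℝ n)) μ := by
  obtain ⟨K₀, h₀⟩ := coef_decay 0 f g
  obtain ⟨K₁, h₁⟩ := coef_decay (2 * (finrank ℝ L + 1)) f g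
  exact integrable_of_decay L μ ((continuous_coef f g).comp continuous_subtype_val)
    (fun X => by simpa using h₀ X) (fun X => h₁ X)

/-- A Gaussian weight used to average over the constraint plane. -/
def wt {n : ℕ} (ε : ℝ) (X : Phase ℝ n) : ℝ :=
  Real.exp (-(ε * ∑ j, (X.1 j ^ 2 + X.2 j ^ 2)))

theorem sq_norm_phase_le {n : ℕ} (X : Phase ℝ n) : ‖X‖ ^ 2 ≤ ∑ j, (X.1 j ^ 2 + X.2 j ^ 2) := by
  have h1 : ∀ j, X.1 j ^ 2 + X.2 j ^ 2 ≤ ∑ j, (X.1 j ^ 2 + X.2 j ^ 2) := fun j =>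
    Finset.single_le_sum (f := fun j => X.1 j ^ 2 + X.2 j ^ 2) (fun j _ => by positivity)
      (Finset.mem_univ j)
  have h0 : 0 ≤ ∑ j, (X.1 j ^ 2 + X.2 j ^ 2) := Finset.sum_nonneg fun j _ => by positivity
  rw [← Real.le_sqrt (norm_nonneg _) h0, Prod.norm_def]
  refine max_le ((pi_norm_le_iff_of_nonneg (Real.sqrt_nonneg _)).2 fun j => ?_)
    ((pi_norm_le_iff_of_nonneg (Real.sqrt_nonneg _)).2 fun j => ?_)
  · refine Real.le_sqrt_of_sq_le ?_
    rw [Real.norm_eq_abs, sq_abs]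
    linarith [h1 j, sq_nonneg (X.2 j)]
  · refine Real.le_sqrt_of_sq_le ?_
    rw [Real.norm_eq_abs, sq_abs]
    linarith [h1 j, sq_nonneg (X.1 j)]

theorem continuous_wt {n : ℕ} (ε : ℝ) : Continuous (wt ε : Phase ℝ n → ℝ) := by
  unfold wt
  fun_prop

theorem wt_pos {n : ℕ} (ε : ℝ) (X : Phase ℝ n) : 0 < wt ε X := Real.exp_pos _

theorem wt_le_one {n : ℕ} {ε : ℝ} (hε : 0 < ε) (X : Phase ℝ n) : wt ε X ≤ 1 := by
  rw [wt, Real.exp_le_one_iff]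
  have := sq_norm_phase_le X
  nlinarith [sq_nonneg ‖X‖]

theorem integrable_wt {n : ℕ} (L : Submodule ℝ (Phase ℝ n)) (μ : Measure L)
    [μ.IsAddHaarMeasure] {ε : ℝ} (hε : 0 < ε) :
    Integrable (fun X : L => wt ε (X : Phase ℝ n)) μ := by
  set m := finrank ℝ L + 1
  refine integrable_of_decay L μ ((continuous_wt ε).comp continuous_subtype_val) (K₀ := 1)
    (K₁ := m.factorial / ε ^ m) (fun X => ?_) (fun X => ?_)
  · rw [Real.norm_of_nonneg (wt_pos _ _).le]
    exact wt_le_one hε _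
  · rw [Real.norm_of_nonneg (wt_pos _ _).le, wt, Real.exp_neg, ← div_eq_mul_inv,
      div_le_div_iff₀ (Real.exp_pos _) (by positivity)]
    have h1 := sq_norm_phase_le (X : Phase ℝ n)
    set q := ∑ j, ((X : Phase ℝ n).1 j ^ 2 + (X : Phase ℝ n).2 j ^ 2)
    have hq : 0 ≤ q := (sq_nonneg _).trans h1
    have h2 := Real.pow_div_factorial_le_exp (ε * q) (by positivity) m
    rw [div_le_iff₀ (by positivity)] at h2
    calc ‖X‖ ^ (2 * m) * ε ^ m = (ε * ‖(X : Phase ℝ n)‖ ^ 2) ^ m := by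
          rw [mul_pow, pow_mul, Submodule.coe_norm]; ring
      _ ≤ (ε * q) ^ m := by gcongr
      _ ≤ _ := by linarith

theorem wt_mul {n : ℕ} (ε : ℝ) (X Z : Phase ℝ n) :
    wt ε X * wt ε (X + Z) = wt (ε / 2) Z * wt (2 * ε) (X + (1 / 2 : ℝ) • Z) := by
  simp only [wt, ← Real.exp_add]
  congr 1
  simp only [Finset.mul_sum, ← Finset.sum_neg_distrib, ← Finset.sum_add_distrib]
  exact Finset.sum_congr rfl fun j _ => by simp; ring

theorem integral_weyl_mul_weyl {n : ℕ} (f g : 𝓢(Conf n, ℂ)) (X Y : Phase ℝ n)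
    (h : symp ℝ n X Y = 0) :
    ∫ ξ, starRingEnd ℂ (weyl X f ξ) * weyl Y g ξ = coef f g (Y - X) := by
  rw [← integral_add_right_eq_self _ (WithLp.toLp 2 X.2 : Conf n)]
  refine integral_congr_ae (Eventually.of_forall fun η => ?_)
  simp only [weyl, map_mul, ← Complex.exp_conj, Complex.conj_I, Complex.conj_ofReal,
    add_sub_cancel_right]
  have e1 : η + WithLp.toLp 2 X.2 - WithLp.toLp 2 Y.2 = η - WithLp.toLp 2 (Y - X).2 := by
    rw [Prod.snd_sub, WithLp.toLp_sub]; abel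
  have e2 : ∑ j, Y.1 j * ((η + WithLp.toLp 2 X.2) j - Y.2 j / 2) -
      ∑ j, X.1 j * ((η + WithLp.toLp 2 X.2) j - X.2 j / 2) =
      ∑ j, (Y - X).1 j * (η j - (Y - X).2 j / 2) := by
    rw [← Finset.sum_sub_distrib, ← sub_eq_zero, ← Finset.sum_sub_distrib]
    have : ∑ j, (X.1 j * Y.2 j - Y.1 j * X.2 j) * (-1 / 2) = 0 := by
      rw [← Finset.sum_mul, ← symp_apply, h, zero_mul]
    rw [← this]
    exact Finset.sum_congr rfl fun j _ => by simp; ring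
  rw [e1, ← e2, Complex.ofReal_sub, mul_sub, Complex.exp_sub, neg_mul, Complex.exp_neg]
  ring

theorem weyl_zero {n : ℕ} (f : Conf n → ℂ) (ξ : Conf n) : weyl 0 f ξ = f ξ := by
  simp [weyl]

theorem conj_coef {n : ℕ} (f g : 𝓢(Conf n, ℂ)) (X : Phase ℝ n) :
    starRingEnd ℂ (coef f g X) = coef g f (-X) := by
  have h := integral_weyl_mul_weyl g f X 0 (by simp)
  rw [zero_sub] at h
  rw [← h, coef, ← integral_conj]
  refine integral_congr_ae (Eventually.of_forall fun ξ => ?_)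
  simp only [weyl_zero, map_mul, Complex.conj_conj]
  ring

theorem coef_add_left {n : ℕ} (f f' g : 𝓢(Conf n, ℂ)) (X : Phase ℝ n) :
    coef (f + f') g X = coef f g X + coef f' g X := by
  simp only [coef]
  rw [← integral_add (integrable_mul_weyl f g X) (integrable_mul_weyl f' g X)]
  refine integral_congr_ae (Eventually.of_forall fun ξ => ?_)
  simp [add_mul]

theorem coef_smul_left {n : ℕ} (c : ℂ) (f g : 𝓢(Conf n, ℂ)) (X : Phase ℝ n) :
    coef (c • f) g X = starRingEnd ℂ c * coef f g X := by
  simp only [coef]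
  rw [← integral_const_mul]
  refine integral_congr_ae (Eventually.of_forall fun ξ => ?_)
  simp [mul_assoc]

theorem coef_smul_right {n : ℕ} (c : ℂ) (f g : 𝓢(Conf n, ℂ)) (X : Phase ℝ n) :
    coef f (c • g) X = c * coef f g X := by
  simp only [coef]
  rw [← integral_const_mul]
  refine integral_congr_ae (Eventually.of_forall fun ξ => ?_)
  simp [weyl]
  ring

/-- Linear constraints: an isotropic plane in phase space, with a shift-invariant measure on it
(Haar measure of the additive group of the plane). -/
structure ConstraintPlane (n : ℕ) where
  plane : Submodule ℝ (Phase ℝ n)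
  isotropic : ∀ X ∈ plane, ∀ Y ∈ plane, symp ℝ n X Y = 0
  μ : Measure plane
  haar : μ.IsAddHaarMeasure

attribute [instance] ConstraintPlane.haar

/-- The inner product `⟨f, g⟩ = ∫_L dμ(X) (f, e^{iΩ(X)} g)` of the algebraic approach. -/
def form {n : ℕ} (C : ConstraintPlane n) (f g : 𝓢(Conf n, ℂ)) : ℂ :=
  ∫ X : C.plane, coef f g (X : Phase ℝ n) ∂C.μ

/-- The weighted average of `e^{iΩ(X)} f` over the plane. -/
def avg {n : ℕ} (C : ConstraintPlane n) (ε : ℝ) (f : 𝓢(Conf n, ℂ)) (ξ : Conf n) : ℂ :=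
  ∫ Y : C.plane, (wt ε (Y : Phase ℝ n) : ℂ) * weyl (Y : Phase ℝ n) f ξ ∂C.μ

theorem norm_wt_mul_weyl_le {n : ℕ} (f : 𝓢(Conf n, ℂ)) {K : ℝ} (hf : ∀ ξ, ‖f ξ‖ ≤ K) (ε : ℝ)
    (X : Phase ℝ n) (ξ : Conf n) : ‖(wt ε X : ℂ) * weyl X f ξ‖ ≤ wt ε X * K := by
  rw [norm_mul, norm_weyl, Complex.norm_real, Real.norm_of_nonneg (wt_pos _ _).le]
  exact mul_le_mul_of_nonneg_left (hf _) (wt_pos _ _).le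

theorem continuous_wt_mul_weyl {n : ℕ} (L : Submodule ℝ (Phase ℝ n)) (f : 𝓢(Conf n, ℂ)) (ε : ℝ) :
    Continuous (fun p : L × Conf n => (wt ε (p.1 : Phase ℝ n) : ℂ) * weyl (p.1 : Phase ℝ n) f p.2) := by
  have h1 : Continuous (fun p : L × Conf n => (wt ε (p.1 : Phase ℝ n) : ℂ)) := by
    have := continuous_wt (n := n) ε
    fun_prop
  have h2 : Continuous (fun p : L × Conf n => weyl (p.1 : Phase ℝ n) f p.2) := by
    unfold weyl
    have := f.continuous
    fun_prop
  exact h1.mul h2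

theorem continuous_avg {n : ℕ} (C : ConstraintPlane n) {ε : ℝ} (hε : 0 < ε) (f : 𝓢(Conf n, ℂ)) :
    Continuous (avg C ε f) := by
  obtain ⟨K, hK, hf⟩ := exists_bound f
  refine continuous_of_dominated (bound := fun Y : C.plane => wt ε (Y : Phase ℝ n) * K)
    (fun ξ => ?_) (fun ξ => ?_) ((integrable_wt C.plane C.μ hε).mul_const K) ?_
  · have : Continuous (fun Y : C.plane => (wt ε (Y : Phase ℝ n) : ℂ) * weyl (Y : Phase ℝ n) f ξ) :=
      (Complex.continuous_ofReal.comp ((continuous_wt ε).comp continuous_subtype_val)).mul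
        ((continuous_weyl_left f ξ).comp continuous_subtype_val)
    exact this.aestronglyMeasurable
  · exact Eventually.of_forall fun Y => norm_wt_mul_weyl_le f hf ε _ ξ
  · exact Eventually.of_forall fun Y => continuous_const.mul (continuous_weyl_right f _)

theorem norm_avg_le {n : ℕ} (C : ConstraintPlane n) {ε : ℝ} (hε : 0 < ε) (f : 𝓢(Conf n, ℂ)) :
    ∃ K, ∀ ξ, ‖avg C ε f ξ‖ ≤ K := by
  obtain ⟨K, hK, hf⟩ := exists_bound f
  exact ⟨_, fun ξ => norm_integral_le_of_norm_le ((integrable_wt C.plane C.μ hε).mul_const K)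
    (Eventually.of_forall fun Y => norm_wt_mul_weyl_le f hf ε _ ξ)⟩

theorem integrable_weyl {n : ℕ} (f : 𝓢(Conf n, ℂ)) (X : Phase ℝ n) :
    Integrable (fun ξ => weyl X f ξ) (volume : Measure (Conf n)) := by
  have h : Integrable (fun ξ => f ξ) (volume : Measure (Conf n)) := f.integrable
  refine Integrable.mono (h.comp_sub_right (WithLp.toLp 2 X.2))
    (continuous_weyl_right f X).aestronglyMeasurable
    (Eventually.of_forall fun ξ => (norm_weyl X f ξ).le)

theorem integral_wt_coef {n : ℕ} (C : ConstraintPlane n) {ε : ℝ} (hε : 0 < ε) (f : 𝓢(Conf n, ℂ))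
    (X : C.plane) :
    ∫ Y : C.plane, (wt ε (Y : Phase ℝ n) : ℂ) * coef f f ((Y : Phase ℝ n) - (X : Phase ℝ n)) ∂C.μ =
      ∫ ξ, starRingEnd ℂ (weyl (X : Phase ℝ n) f ξ) * avg C ε f ξ := by
  obtain ⟨K, hK, hf⟩ := exists_bound f
  have hc := continuous_wt_mul_weyl C.plane f ε
  have hX := integrable_weyl f (X : Phase ℝ n)
  have hXc := continuous_weyl_right f (X : Phase ℝ n)
  have e1 : ∀ Y : C.plane, (wt ε (Y : Phase ℝ n) : ℂ) * coef f f ((Y : Phase ℝ n) - (X : Phase ℝ n)) =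
      ∫ ξ, starRingEnd ℂ (weyl (X : Phase ℝ n) f ξ) *
        ((wt ε (Y : Phase ℝ n) : ℂ) * weyl (Y : Phase ℝ n) f ξ) := by
    intro Y
    rw [← integral_weyl_mul_weyl f f X Y (C.isotropic _ X.2 _ Y.2), ← integral_const_mul]
    refine integral_congr_ae (Eventually.of_forall fun ξ => ?_)
    simp only
    ring
  simp_rw [e1]
  rw [integral_integral_swap]
  · refine integral_congr_ae (Eventually.of_forall fun ξ => ?_)
    simp only [avg]
    rw [integral_const_mul]
  · have hb : Integrable (fun p : C.plane × Conf n =>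
        (wt ε (p.1 : Phase ℝ n) * K) * ‖weyl (X : Phase ℝ n) f p.2‖) (C.μ.prod volume) :=
      ((integrable_wt C.plane C.μ hε).mul_const K).mul_prod hX.norm
    refine Integrable.mono' hb ?_ (Eventually.of_forall fun p => ?_)
    · have : Continuous (fun p : C.plane × Conf n => starRingEnd ℂ (weyl (X : Phase ℝ n) f p.2) *
          ((wt ε (p.1 : Phase ℝ n) : ℂ) * weyl (p.1 : Phase ℝ n) f p.2)) :=
        (Complex.continuous_conj.comp (hXc.comp continuous_snd)).mul hc
      exact this.aestronglyMeasurable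
    · simp only [Function.uncurry]
      rw [norm_mul, Complex.norm_conj, mul_comm]
      exact mul_le_mul_of_nonneg_right (norm_wt_mul_weyl_le f hf ε _ _) (norm_nonneg _)

theorem integral_avg {n : ℕ} (C : ConstraintPlane n) {ε : ℝ} (hε : 0 < ε) (f : 𝓢(Conf n, ℂ)) :
    ∫ X : C.plane, (wt ε (X : Phase ℝ n) : ℂ) *
      (∫ ξ, starRingEnd ℂ (weyl (X : Phase ℝ n) f ξ) * avg C ε f ξ) ∂C.μ =
    ∫ ξ, starRingEnd ℂ (avg C ε f ξ) * avg C ε f ξ := by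
  obtain ⟨K, hK⟩ := norm_avg_le C hε f
  have hc := continuous_wt_mul_weyl C.plane f ε
  have ha := continuous_avg C hε f
  have hf : Integrable (fun ξ => f ξ) (volume : Measure (Conf n)) := f.integrable
  have hm : Continuous (fun p : C.plane × Conf n =>
      starRingEnd ℂ ((wt ε (p.1 : Phase ℝ n) : ℂ) * weyl (p.1 : Phase ℝ n) f p.2) *
        avg C ε f p.2) :=
    (Complex.continuous_conj.comp hc).mul (ha.comp continuous_snd)
  simp_rw [← integral_const_mul]
  have e1 : ∀ (X : C.plane) (ξ : Conf n), (wt ε (X : Phase ℝ n) : ℂ) *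
      (starRingEnd ℂ (weyl (X : Phase ℝ n) f ξ) * avg C ε f ξ) =
      starRingEnd ℂ ((wt ε (X : Phase ℝ n) : ℂ) * weyl (X : Phase ℝ n) f ξ) * avg C ε f ξ := by
    intro X ξ
    rw [map_mul, Complex.conj_ofReal]
    ring
  simp_rw [e1]
  rw [integral_integral_swap]
  · refine integral_congr_ae (Eventually.of_forall fun ξ => ?_)
    simp only
    rw [integral_mul_const, integral_conj]
    rfl
  · have hi : Integrable (fun p : C.plane × Conf n =>
        (wt ε (p.1 : Phase ℝ n) : ℂ) * weyl (p.1 : Phase ℝ n) f p.2) (C.μ.prod volume) := by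
      rw [integrable_prod_iff hc.aestronglyMeasurable]
      refine ⟨Eventually.of_forall fun X =>
        (integrable_weyl f (X : Phase ℝ n)).const_mul (wt ε (X : Phase ℝ n) : ℂ), ?_⟩
      have : ∀ X : C.plane, ∫ ξ, ‖(wt ε (X : Phase ℝ n) : ℂ) * weyl (X : Phase ℝ n) f ξ‖ =
          wt ε (X : Phase ℝ n) * ∫ ξ, ‖f ξ‖ := by
        intro X
        simp_rw [norm_mul, norm_weyl, Complex.norm_real, Real.norm_of_nonneg (wt_pos _ _).le]
        rw [integral_const_mul, integral_sub_right_eq_self (fun ξ => ‖f ξ‖)]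
      simp_rw [this]
      exact (integrable_wt C.plane C.μ hε).mul_const _
    refine Integrable.mono' (hi.norm.mul_const K) hm.aestronglyMeasurable
      (Eventually.of_forall fun p => ?_)
    simp only [Function.uncurry]
    rw [norm_mul, Complex.norm_conj]
    exact mul_le_mul_of_nonneg_left (hK _) (norm_nonneg _)

theorem re_weighted_nonneg {n : ℕ} (C : ConstraintPlane n) {ε : ℝ} (hε : 0 < ε)
    (f : 𝓢(Conf n, ℂ)) :
    0 ≤ (∫ Z : C.plane, (wt (ε / 2) (Z : Phase ℝ n) : ℂ) * coef f f (Z : Phase ℝ n) ∂C.μ).re := by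
  have hF := integrable_coef C.plane C.μ f f
  have hFc := continuous_coef f f
  have hw := integrable_wt C.plane C.μ hε
  have hwc := continuous_wt (n := n) ε
  set c : ℝ := ∫ X : C.plane, wt (2 * ε) (X : Phase ℝ n) ∂C.μ with hc
  have hw2 := integrable_wt C.plane C.μ (ε := 2 * ε) (by positivity)
  have hcpos : 0 < c := by
    rw [hc, integral_pos_iff_support_of_nonneg (fun X => (wt_pos _ _).le) hw2]
    have : Function.support (fun X : C.plane => wt (2 * ε) (X : Phase ℝ n)) = Set.univ := by
      ext X
      simp [(wt_pos (2 * ε) (X : Phase ℝ n)).ne']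
    rw [this]
    exact isOpen_univ.measure_pos C.μ ⟨0, trivial⟩
  have e : ∫ ξ, starRingEnd ℂ (avg C ε f ξ) * avg C ε f ξ =
      (c : ℂ) * ∫ Z : C.plane, (wt (ε / 2) (Z : Phase ℝ n) : ℂ) * coef f f (Z : Phase ℝ n) ∂C.μ := by
    rw [← integral_avg C hε f]
    simp_rw [← integral_wt_coef C hε f]
    have e1 : ∀ X : C.plane, (wt ε (X : Phase ℝ n) : ℂ) *
        ∫ Y : C.plane, (wt ε (Y : Phase ℝ n) : ℂ) * coef f f ((Y : Phase ℝ n) - (X : Phase ℝ n)) ∂C.μ =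
        ∫ Z : C.plane, ((wt ε (X : Phase ℝ n) * wt ε ((X : Phase ℝ n) + (Z : Phase ℝ n)) : ℝ) : ℂ) *
          coef f f (Z : Phase ℝ n) ∂C.μ := by
      intro X
      rw [← integral_add_right_eq_self _ X, ← integral_const_mul]
      refine integral_congr_ae (Eventually.of_forall fun Z => ?_)
      simp only [Submodule.coe_add, add_sub_cancel_right]
      push_cast
      rw [add_comm (Z : Phase ℝ n)]
      ring
    simp_rw [e1]
    rw [integral_integral_swap, ← integral_const_mul]
    · refine integral_congr_ae (Eventually.of_forall fun Z => ?_)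
      simp only
      rw [integral_mul_const, integral_complex_ofReal]
      simp_rw [wt_mul]
      rw [integral_const_mul]
      have := integral_add_right_eq_self (μ := C.μ)
        (fun X : C.plane => wt (2 * ε) (X : Phase ℝ n)) ((1 / 2 : ℝ) • Z)
      simp only [Submodule.coe_add, Submodule.coe_smul] at this
      rw [this, ← hc]
      push_cast
      ring
    · have hb : Integrable (fun p : C.plane × C.plane =>
          wt ε (p.1 : Phase ℝ n) * ‖coef f f (p.2 : Phase ℝ n)‖) (C.μ.prod C.μ) :=
        hw.mul_prod hF.norm
      refine Integrable.mono' hb ?_ (Eventually.of_forall fun p => ?_)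
      · have : Continuous (fun p : C.plane × C.plane =>
            ((wt ε (p.1 : Phase ℝ n) * wt ε ((p.1 : Phase ℝ n) + (p.2 : Phase ℝ n)) : ℝ) : ℂ) *
              coef f f (p.2 : Phase ℝ n)) := by fun_prop
        exact this.aestronglyMeasurable
      · simp only [Function.uncurry]
        rw [norm_mul, Complex.norm_real, norm_mul, Real.norm_of_nonneg (wt_pos _ _).le,
          Real.norm_of_nonneg (wt_pos _ _).le]
        refine mul_le_mul_of_nonneg_right ?_ (norm_nonneg _)
        exact mul_le_of_le_one_right (wt_pos _ _).le (wt_le_one hε _)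
  have h0 : 0 ≤ (∫ ξ, starRingEnd ℂ (avg C ε f ξ) * avg C ε f ξ).re := by
    have : ∀ ξ, starRingEnd ℂ (avg C ε f ξ) * avg C ε f ξ = ((‖avg C ε f ξ‖ ^ 2 : ℝ) : ℂ) := by
      intro ξ
      rw [mul_comm, Complex.mul_conj, Complex.normSq_eq_norm_sq]
    simp_rw [this]
    rw [integral_complex_ofReal, Complex.ofReal_re]
    exact integral_nonneg fun ξ => by positivity
  rw [e, Complex.re_ofReal_mul] at h0
  exact nonneg_of_mul_nonneg_right h0 hcpos

theorem re_form_nonneg {n : ℕ} (C : ConstraintPlane n) (f : 𝓢(Conf n, ℂ)) :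
    0 ≤ (form C f f).re := by
  have hF := integrable_coef C.plane C.μ f f
  have hFc := continuous_coef f f
  have hlim : Tendsto (fun m : ℕ => ∫ Z : C.plane,
      (wt ((1 / ((m : ℝ) + 1)) / 2) (Z : Phase ℝ n) : ℂ) * coef f f (Z : Phase ℝ n) ∂C.μ)
      atTop (𝓝 (form C f f)) := by
    refine tendsto_integral_of_dominated_convergence (fun Z : C.plane => ‖coef f f (Z : Phase ℝ n)‖)
      (fun m => ?_) hF.norm (fun m => Eventually.of_forall fun Z => ?_)
      (Eventually.of_forall fun Z => ?_)
    · have := continuous_wt (n := n) ((1 / ((m : ℝ) + 1)) / 2)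
      have : Continuous (fun Z : C.plane => (wt ((1 / ((m : ℝ) + 1)) / 2) (Z : Phase ℝ n) : ℂ) *
          coef f f (Z : Phase ℝ n)) := by fun_prop
      exact this.aestronglyMeasurable
    · rw [norm_mul, Complex.norm_real, Real.norm_of_nonneg (wt_pos _ _).le]
      exact mul_le_of_le_one_left (norm_nonneg _) (wt_le_one (by positivity) _)
    · have h1 : Tendsto (fun m : ℕ => (1 / ((m : ℝ) + 1)) / 2) atTop (𝓝 0) := by
        simpa using (tendsto_one_div_add_atTop_nhds_zero_nat (𝕜 := ℝ)).div_const 2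
      have h2 : Continuous (fun ε : ℝ => (wt ε (Z : Phase ℝ n) : ℂ) * coef f f (Z : Phase ℝ n)) := by
        unfold wt
        fun_prop
      have h3 := (h2.tendsto 0).comp h1
      have h4 : (wt 0 (Z : Phase ℝ n) : ℂ) * coef f f (Z : Phase ℝ n) =
          coef f f (Z : Phase ℝ n) := by simp [wt]
      rw [h4] at h3
      exact h3
  refine ge_of_tendsto ((Complex.continuous_re.tendsto _).comp hlim)
    (Eventually.of_forall fun m => ?_)
  exact re_weighted_nonneg C (by positivity) f

theorem coef_hasDerivAt {n : ℕ} (f g : 𝓢(Conf n, ℂ)) (X Z : Phase ℝ n) (h : symp ℝ n X Z = 0) :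
    HasDerivAt (fun t : ℝ => coef f g (X + t • Z))
      (Complex.I * coef f (Om n (cx n Z) g) X) 0 := by
  obtain ⟨K, hK, hg⟩ := exists_bound (Om n (cx n Z) g)
  have := (hasDerivAt_integral_of_dominated_loc_of_deriv_le (μ := (volume : Measure (Conf n)))
    (x₀ := (0 : ℝ)) (s := Set.univ) (bound := fun ξ => ‖f ξ‖ * K)
    (F := fun t ξ => starRingEnd ℂ (f ξ) * weyl (X + t • Z) g ξ)
    (F' := fun t ξ => starRingEnd ℂ (f ξ) *
      (Complex.I * weyl (X + t • Z) (Om n (cx n Z) g) ξ)) univ_mem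
    (Eventually.of_forall fun t => (integrable_mul_weyl f g _).aestronglyMeasurable)
    (integrable_mul_weyl f g _) ?_ (Eventually.of_forall fun ξ t _ => ?_)
    (integrable_norm_mul f K) (Eventually.of_forall fun ξ t _ => ?_)).2
  · refine this.congr_deriv ?_
    rw [coef, ← integral_const_mul]
    refine integral_congr_ae (Eventually.of_forall fun ξ => ?_)
    simp only [zero_smul, add_zero]
    ring
  · have := ((integrable_mul_weyl f (Om n (cx n Z) g) (X + (0 : ℝ) • Z)).const_mul
      Complex.I).aestronglyMeasurable
    refine this.congr (Eventually.of_forall fun ξ => ?_)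
    simp only
    ring
  · have := norm_mul_weyl_le f (Om n (cx n Z) g) hg (X + t • Z) ξ
    rwa [mul_left_comm, norm_mul, Complex.norm_I, one_mul]
  · exact (hasDerivAt_weyl X Z h g ξ t).const_mul _

theorem form_Om_eq_zero {n : ℕ} (C : ConstraintPlane n) (f g : 𝓢(Conf n, ℂ)) {Z : Phase ℝ n}
    (hZ : Z ∈ C.plane) : form C f (Om n (cx n Z) g) = 0 := by
  have h1 := integrable_coef C.plane C.μ f (Om n (cx n Z) g)
  have h := integral_lineDeriv_eq_zero C.μ (v := (⟨Z, hZ⟩ : C.plane))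
    (integrable_coef C.plane C.μ f g) (h1.const_mul Complex.I)
    (fun X => coef_hasDerivAt f g X Z (C.isotropic _ X.2 _ hZ))
  rw [integral_const_mul] at h
  exact (mul_eq_zero.1 h).resolve_left Complex.I_ne_zero

/-- Skew-orthogonal complement of a plane in phase space. -/
def perp {𝕜 : Type} [CommRing 𝕜] {n : ℕ} (L : Submodule 𝕜 (Phase 𝕜 n)) :
    Submodule 𝕜 (Phase 𝕜 n) :=
  L.orthogonalBilin (symp 𝕜 n)

theorem form_Om_symm {n : ℕ} (C : ConstraintPlane n) (f g : 𝓢(Conf n, ℂ)) {Z : Phase ℝ n}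
    (hZ : Z ∈ perp C.plane) : form C (Om n (cx n Z) f) g = form C f (Om n (cx n Z) g) := by
  refine integral_congr_ae (Eventually.of_forall fun X => ?_)
  simp only
  rw [coef_Om_left, hZ _ X.2]
  simp

theorem conj_form {n : ℕ} (C : ConstraintPlane n) (f g : 𝓢(Conf n, ℂ)) :
    starRingEnd ℂ (form C g f) = form C f g := by
  have : C.μ.IsNegInvariant := Measure.IsAddHaarMeasure.isNegInvariant_of_regular C.μ
  rw [form, ← integral_conj, form, ← integral_neg_eq_self _ C.μ]
  refine integral_congr_ae (Eventually.of_forall fun X => ?_)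
  simp only [conj_coef, Submodule.coe_neg, neg_neg]

theorem form_add_left {n : ℕ} (C : ConstraintPlane n) (f f' g : 𝓢(Conf n, ℂ)) :
    form C (f + f') g = form C f g + form C f' g := by
  simp only [form, coef_add_left]
  exact integral_add (integrable_coef C.plane C.μ f g) (integrable_coef C.plane C.μ f' g)

theorem form_smul_left {n : ℕ} (C : ConstraintPlane n) (f g : 𝓢(Conf n, ℂ)) (c : ℂ) :
    form C (c • f) g = starRingEnd ℂ c * form C f g := by
  simp only [form, coef_smul_left]
  exact integral_const_mul _ _

/-- Schwartz space with the (degenerate) inner product `form C`. -/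
def PreHilbert {n : ℕ} (_C : ConstraintPlane n) : Type := 𝓢(Conf n, ℂ)

instance {n : ℕ} (C : ConstraintPlane n) : AddCommGroup (PreHilbert C) :=
  inferInstanceAs (AddCommGroup 𝓢(Conf n, ℂ))

instance {n : ℕ} (C : ConstraintPlane n) : Module ℂ (PreHilbert C) :=
  inferInstanceAs (Module ℂ 𝓢(Conf n, ℂ))

@[reducible]
def preHilbertCore {n : ℕ} (C : ConstraintPlane n) :
    PreInnerProductSpace.Core ℂ (PreHilbert C) where
  inner := form C
  conj_inner_symm := conj_form C
  re_inner_nonneg := re_form_nonneg C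
  add_left := form_add_left C
  smul_left := form_smul_left C

instance {n : ℕ} (C : ConstraintPlane n) : SeminormedAddCommGroup (PreHilbert C) :=
  @InnerProductSpace.Core.toSeminormedAddCommGroup ℂ (PreHilbert C) _ _ _ (preHilbertCore C)

instance {n : ℕ} (C : ConstraintPlane n) : InnerProductSpace ℂ (PreHilbert C) :=
  InnerProductSpace.ofCore (preHilbertCore C)

/-- The pre-Hilbert space `S(ℝⁿ, L)/∼`, where `f ∼ g` means `⟨f - g, f - g⟩ = 0`. -/
abbrev States {n : ℕ} (C : ConstraintPlane n) : Type := SeparationQuotient (PreHilbert C)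

/-- The Hilbert state space: the completion of `S(ℝⁿ, L)/∼`. -/
abbrev Hilb {n : ℕ} (C : ConstraintPlane n) : Type := UniformSpace.Completion (States C)

/-- The equivalence class `[f]` of a wave function. -/
def cls {n : ℕ} (C : ConstraintPlane n) (f : 𝓢(Conf n, ℂ)) : States C :=
  SeparationQuotient.mk (show PreHilbert C from f)

/-- The operators `Ω(Y)` on Schwartz space with the inner product `form C`. -/
def preOm {n : ℕ} (C : ConstraintPlane n) : Phase ℂ n →ₗ[ℂ] Module.End ℂ (PreHilbert C) := Om n

/-- The complexified plane. -/
def cxPlane {n : ℕ} (L : Submodule ℝ (Phase ℝ n)) : Submodule ℂ (Phase ℂ n) :=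
  Submodule.span ℂ (cx n '' L)

theorem norm_eq_zero_iff {n : ℕ} (C : ConstraintPlane n) (f : PreHilbert C) :
    ‖f‖ = 0 ↔ ∀ g : PreHilbert C, inner ℂ g f = 0 := by
  constructor
  · intro h g
    have := norm_inner_le_norm (𝕜 := ℂ) g f
    rw [h, mul_zero] at this
    exact norm_le_zero_iff.1 this
  · intro h
    have := norm_sq_eq_re_inner (𝕜 := ℂ) f
    rw [h f] at this
    simpa using this

theorem norm_preOm_real {n : ℕ} (C : ConstraintPlane n) {Z : Phase ℝ n} (hZ : Z ∈ perp C.plane)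
    {f : PreHilbert C} (hf : ‖f‖ = 0) : ‖preOm C (cx n Z) f‖ = 0 := by
  rw [norm_eq_zero_iff] at hf ⊢
  intro g
  have := hf (preOm C (cx n Z) g)
  exact (form_Om_symm C g f hZ).symm.trans this

theorem cx_re_im {n : ℕ} (Y : Phase ℂ n) :
    Y = cx n (fun j => (Y.1 j).re, fun j => (Y.2 j).re) +
      Complex.I • cx n (fun j => (Y.1 j).im, fun j => (Y.2 j).im) := by
  ext j <;> simp [cx_fst, cx_snd, Complex.ext_iff]

theorem re_im_mem_perp {n : ℕ} {L : Submodule ℝ (Phase ℝ n)} {Y : Phase ℂ n}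
    (hY : Y ∈ perp (cxPlane L)) :
    ((fun j => (Y.1 j).re, fun j => (Y.2 j).re) : Phase ℝ n) ∈ perp L ∧
    ((fun j => (Y.1 j).im, fun j => (Y.2 j).im) : Phase ℝ n) ∈ perp L := by
  have h : ∀ X ∈ L, symp ℂ n (cx n X) Y = 0 := fun X hX =>
    hY _ (Submodule.subset_span ⟨X, hX, rfl⟩)
  rw [cx_re_im Y] at h
  simp only [map_add, map_smul, symp_cx, smul_eq_mul] at h
  constructor
  · intro X hX
    simpa using congrArg Complex.re (h X hX)
  · intro X hX
    simpa using congrArg Complex.im (h X hX)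

theorem cx_mem_perp {n : ℕ} {L : Submodule ℝ (Phase ℝ n)} {Y : Phase ℝ n} (hY : Y ∈ perp L) :
    cx n Y ∈ perp (cxPlane L) := by
  intro X hX
  induction hX using Submodule.span_induction with
  | mem x h =>
    obtain ⟨x, hx, rfl⟩ := h
    rw [symp_cx, hY x hx, Complex.ofReal_zero]
  | zero => simp
  | add x y _ _ hx hy => rw [map_add, LinearMap.add_apply, hx, hy, add_zero]
  | smul a x _ hx => rw [map_smul, LinearMap.smul_apply, hx, smul_zero]

theorem norm_add_smul_zero {n : ℕ} {C : ConstraintPlane n} {f g : PreHilbert C} (c : ℂ)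
    (hf : ‖f‖ = 0) (hg : ‖g‖ = 0) : ‖f + c • g‖ = 0 := by
  have := norm_add_le f (c • g)
  rw [norm_smul, hf, hg, mul_zero, add_zero] at this
  exact le_antisymm this (norm_nonneg _)

theorem norm_preOm {n : ℕ} (C : ConstraintPlane n) {Y : Phase ℂ n}
    (hY : Y ∈ perp (cxPlane C.plane)) {f : PreHilbert C} (hf : ‖f‖ = 0) : ‖preOm C Y f‖ = 0 := by
  obtain ⟨h1, h2⟩ := re_im_mem_perp hY
  rw [cx_re_im Y, map_add, map_smul]
  exact norm_add_smul_zero _ (norm_preOm_real C h1 hf) (norm_preOm_real C h2 hf)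

theorem norm_preOm_plane {n : ℕ} (C : ConstraintPlane n) {Y : Phase ℂ n}
    (hY : Y ∈ cxPlane C.plane) (f : PreHilbert C) : ‖preOm C Y f‖ = 0 := by
  induction hY using Submodule.span_induction with
  | mem x h =>
    obtain ⟨x, hx, rfl⟩ := h
    rw [norm_eq_zero_iff]
    exact fun g => form_Om_eq_zero C g f hx
  | zero => simp
  | add x y _ _ hx hy =>
    have := norm_add_smul_zero 1 hx hy
    rw [one_smul] at this
    rw [map_add]
    exact this
  | smul a x _ hx =>
    rw [map_smul, LinearMap.smul_apply, norm_smul, hx, mul_zero]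

theorem mk_eq_mk_of_norm {n : ℕ} {C : ConstraintPlane n} {f g : PreHilbert C}
    (h : ‖f - g‖ = 0) : (SeparationQuotient.mk f : States C) = SeparationQuotient.mk g :=
  SeparationQuotient.mk_eq_mk.2 (Metric.inseparable_iff.2 (by rw [dist_eq_norm, h]))

/-- A linear operator on Schwartz space that preserves the null vectors, on equivalence classes. -/
def descend {n : ℕ} {C : ConstraintPlane n} (T : Module.End ℂ (PreHilbert C))
    (hT : ∀ f, ‖f‖ = 0 → ‖T f‖ = 0) : Module.End ℂ (States C) where
  toFun := SeparationQuotient.lift (fun f => (SeparationQuotient.mk (T f) : States C))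
    fun f g h => mk_eq_mk_of_norm (by
      rw [← map_sub]
      exact hT _ (by rw [← dist_eq_norm]; exact Metric.inseparable_iff.1 h))
  map_add' a b := by
    obtain ⟨f, rfl⟩ := SeparationQuotient.surjective_mk a
    obtain ⟨g, rfl⟩ := SeparationQuotient.surjective_mk b
    simp only [← SeparationQuotient.mk_add, SeparationQuotient.lift_mk, map_add]
  map_smul' c a := by
    obtain ⟨f, rfl⟩ := SeparationQuotient.surjective_mk a
    simp only [← SeparationQuotient.mk_smul, SeparationQuotient.lift_mk, map_smul, RingHom.id_apply]

/-- `Ω(Y)` on equivalence classes, for `Y` in the complexification of `L^{⊥ω}`. -/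
def perpOm {n : ℕ} (C : ConstraintPlane n) :
    perp (cxPlane C.plane) →ₗ[ℂ] Module.End ℂ (States C) where
  toFun Y := descend (preOm C Y) fun _ => norm_preOm C Y.2
  map_add' Y Y' := by
    ext a
    obtain ⟨f, rfl⟩ := SeparationQuotient.surjective_mk a
    change (SeparationQuotient.mk (preOm C (Y + Y') f) : States C) = _
    rw [map_add]
    rfl
  map_smul' c Y := by
    ext a
    obtain ⟨f, rfl⟩ := SeparationQuotient.surjective_mk a
    change (SeparationQuotient.mk (preOm C (c • Y) f) : States C) = _
    rw [map_smul]
    rfl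

/-- The reduced phase space `L^{⊥ω}/L` of an isotropic plane `L`. -/
abbrev Reduced {𝕜 : Type} [CommRing 𝕜] {n : ℕ} (L : Submodule 𝕜 (Phase 𝕜 n)) : Type :=
  perp L ⧸ L.submoduleOf (perp L)

/-- The symplectic form on the reduced phase space. -/
def redSymp {𝕜 : Type} [CommRing 𝕜] {n : ℕ} (L : Submodule 𝕜 (Phase 𝕜 n)) :
    Reduced L →ₗ[𝕜] Reduced L →ₗ[𝕜] 𝕜 :=
  (L.submoduleOf (perp L)).liftQ
    { toFun := fun Y => (L.submoduleOf (perp L)).liftQ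
        ((symp 𝕜 n (Y : Phase 𝕜 n)).comp (perp L).subtype) (fun X hX => by
          rw [LinearMap.mem_ker, LinearMap.comp_apply, symp_swap, Submodule.subtype_apply,
            neg_eq_zero]
          exact Y.2 _ hX)
      map_add' := fun Y Y' => by
        ext X
        simp
      map_smul' := fun c Y => by
        ext X
        simp }
    (fun Y hY => by
      rw [LinearMap.mem_ker]
      ext X
      exact X.2 _ hY)

/-- The operators `Ω̄(Ȳ)`, for `Ȳ` in the complexified reduced phase space. -/
def redOm {n : ℕ} (C : ConstraintPlane n) :
    Reduced (cxPlane C.plane) →ₗ[ℂ] Module.End ℂ (States C) :=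
  ((cxPlane C.plane).submoduleOf (perp (cxPlane C.plane))).liftQ (perpOm C) (fun Y hY => by
    rw [LinearMap.mem_ker]
    ext a
    obtain ⟨f, rfl⟩ := SeparationQuotient.surjective_mk a
    exact mk_eq_mk_of_norm (g := 0) (by rw [sub_zero]; exact norm_preOm_plane C hY f))

/-- The inclusion of the real reduced phase space in the complexified one. -/
def cxRed {n : ℕ} (L : Submodule ℝ (Phase ℝ n)) : Reduced L →ₗ[ℝ] Reduced (cxPlane L) :=
  (L.submoduleOf (perp L)).liftQ
    ((((cxPlane L).submoduleOf (perp (cxPlane L))).mkQ.restrictScalars ℝ).comp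
      (LinearMap.codRestrict ((perp (cxPlane L)).restrictScalars ℝ) ((cx n).comp (perp L).subtype)
        (fun Y => cx_mem_perp Y.2)))
    (fun Y hY => by
      rw [LinearMap.mem_ker]
      exact (Submodule.Quotient.mk_eq_zero _).2 (Submodule.subset_span ⟨Y, hY, rfl⟩))

/-- Complex conjugation on the complexified phase space. -/
def conjPhase (n : ℕ) : Phase ℂ n →ₛₗ[starRingEnd ℂ] Phase ℂ n where
  toFun Y := (fun j => starRingEnd ℂ (Y.1 j), fun j => starRingEnd ℂ (Y.2 j))
  map_add' Y Y' := by ext j <;> simp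
  map_smul' c Y := by ext j <;> simp

theorem conjPhase_cx {n : ℕ} (X : Phase ℝ n) : conjPhase n (cx n X) = cx n X := by
  ext j <;> simp [conjPhase, cx_fst, cx_snd]

theorem conj_mem_cxPlane {n : ℕ} {L : Submodule ℝ (Phase ℝ n)} {Y : Phase ℂ n}
    (hY : Y ∈ cxPlane L) : conjPhase n Y ∈ cxPlane L := by
  induction hY using Submodule.span_induction with
  | mem x h =>
    obtain ⟨x, hx, rfl⟩ := h
    rw [conjPhase_cx]
    exact Submodule.subset_span ⟨x, hx, rfl⟩
  | zero => rw [map_zero]; exact zero_mem _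
  | add x y _ _ hx hy => rw [map_add]; exact add_mem hx hy
  | smul a x _ hx => rw [map_smulₛₗ]; exact Submodule.smul_mem _ _ hx

theorem conj_mem_perp {n : ℕ} {L : Submodule ℝ (Phase ℝ n)} {Y : Phase ℂ n}
    (hY : Y ∈ perp (cxPlane L)) : conjPhase n Y ∈ perp (cxPlane L) := by
  intro X hX
  have h := hY _ (conj_mem_cxPlane hX)
  have h2 := congrArg (starRingEnd ℂ) h
  simpa [symp_apply, conjPhase] using h2

/-- Complex conjugation `Ȳ ↦ Ȳ*` on the complexified reduced phase space. -/
def conjRed {n : ℕ} (L : Submodule ℝ (Phase ℝ n)) :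
    Reduced (cxPlane L) →ₛₗ[starRingEnd ℂ] Reduced (cxPlane L) :=
  ((cxPlane L).submoduleOf (perp (cxPlane L))).mapQ
    ((cxPlane L).submoduleOf (perp (cxPlane L)))
    (LinearMap.codRestrict (perp (cxPlane L)) ((conjPhase n).comp (perp (cxPlane L)).subtype)
      (fun Y => conj_mem_perp Y.2))
    (fun _ hY => conj_mem_cxPlane hY)

/-- The product `Y ∘ Γ`: for `Γ = ½ ∑ Γᵢⱼ Zᵢ ⊗ Zⱼ` with symmetric coefficients,
`Y ∘ Γ = ∑ Γᵢⱼ ω(Y, Zᵢ) Zⱼ`; that is, `Z ⊗ W` contributes `2 ω(Y, Z) W`. -/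
def circ {𝕜 V : Type} [CommRing 𝕜] [AddCommGroup V] [Module 𝕜 V] (ω : V →ₗ[𝕜] V →ₗ[𝕜] 𝕜) :
    V ⊗[𝕜] V →ₗ[𝕜] Module.End 𝕜 V :=
  TensorProduct.lift (LinearMap.mk₂ 𝕜 (fun Z W => ((2 : 𝕜) • ω.flip Z).smulRight W)
    (fun Z Z' W => by ext Y; simp [add_smul])
    (fun c Z W => by ext Y; simp [mul_left_comm, mul_smul])
    (fun Z W W' => by ext Y; simp)
    (fun c Z W => by ext Y; simp [smul_comm c]))

/-- The inclusion of real tensors in complex tensors. -/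
def cxTensor {n : ℕ} (L : Submodule ℝ (Phase ℝ n)) :
    Reduced L ⊗[ℝ] Reduced L →ₗ[ℝ] Reduced (cxPlane L) ⊗[ℂ] Reduced (cxPlane L) :=
  TensorProduct.lift (LinearMap.mk₂ ℝ (fun Z W => cxRed L Z ⊗ₜ[ℂ] cxRed L W)
    (fun Z Z' W => by rw [map_add, TensorProduct.add_tmul])
    (fun c Z W => by rw [map_smul, TensorProduct.smul_tmul'])
    (fun Z W W' => by rw [map_add, TensorProduct.tmul_add])
    (fun c Z W => by rw [map_smul, TensorProduct.tmul_smul]))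

/-- The quadratic Hamiltonian `Ω̄₂(Γ̄) = ½ ∑ Γᵢⱼ Ω̄(Z̄ᵢ) Ω̄(Z̄ⱼ)` for `Γ̄ = ½ ∑ Γᵢⱼ Z̄ᵢ ⊗ Z̄ⱼ`. -/
def redOm2 {n : ℕ} (C : ConstraintPlane n) (Γ : Reduced C.plane ⊗[ℝ] Reduced C.plane) :
    Module.End ℂ (States C) :=
  TensorProduct.lift ((LinearMap.mul ℂ (Module.End ℂ (States C))).compl₁₂ (redOm C) (redOm C))
    (cxTensor C.plane Γ)

instance {n : ℕ} (L : Submodule ℂ (Phase ℂ n)) : ContinuousSMul ℝ (Reduced L) :=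
  IsScalarTower.continuousSMul ℂ

/-- Solutions of the linear system `dY/dt = T Y`. -/
def IsSolution {V : Type} [AddCommGroup V] [Module ℝ V] [TopologicalSpace V] [ContinuousSMul ℝ V]
    (T : V → V) (Y : ℝ → V) : Prop :=
  ∀ t, HasDerivAt Y (T (Y t)) t

/-- Lyapunov stability (of the zero solution) of the linear system `dY/dt = T Y`. -/
def IsStable {V : Type} [AddCommGroup V] [Module ℝ V] [TopologicalSpace V] [ContinuousSMul ℝ V]
    (T : V → V) : Prop :=
  ∀ U ∈ 𝓝 (0 : V), ∃ W ∈ 𝓝 (0 : V), ∀ Y : ℝ → V, IsSolution T Y → Y 0 ∈ W →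
    ∀ t, 0 ≤ t → Y t ∈ U

/-- Stability of the reduced Hamiltonian system `dȲ/dt = Ȳ ∘ Γ̄` in the real space `L^{⊥ω}/L`. -/
def ReducedStable {n : ℕ} (C : ConstraintPlane n)
    (Γ : Reduced C.plane ⊗[ℝ] Reduced C.plane) : Prop :=
  IsStable (circ (redSymp C.plane) Γ)

/-- The solution condition for the complexified reduced system. -/
def IsComplexSolution {n : ℕ} (C : ConstraintPlane n)
    (Γ : Reduced C.plane ⊗[ℝ] Reduced C.plane) (Y : ℝ → Reduced (cxPlane C.plane)) : Prop :=
  IsSolution (circ (redSymp (cxPlane C.plane)) (cxTensor C.plane Γ)) Y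

/-- `Y₁, …, Y_d` with frequencies `β₁, …, β_d` are normalized normal modes of the reduced system:
`Y_I e^{iβ_I t}` and `Y_I* e^{-iβ_I t}` are `2d` linearly independent solutions, with
`(1/i) ω(Y_I, Y_J*) = δ_{IJ}` and `ω(Y_I, Y_J) = 0`. -/
structure IsNormalModes {n : ℕ} (C : ConstraintPlane n)
    (Γ : Reduced C.plane ⊗[ℝ] Reduced C.plane) {d : ℕ} (β : Fin d → ℝ)
    (Y : Fin d → Reduced (cxPlane C.plane)) : Prop where
  solution : ∀ I, IsComplexSolution C Γ fun t => Complex.exp (Complex.I * β I * t) • Y I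
  solution_conj : ∀ I, IsComplexSolution C Γ fun t =>
    Complex.exp (-(Complex.I * β I * t)) • conjRed C.plane (Y I)
  independent : LinearIndependent ℂ
    (Sum.elim (fun I (t : ℝ) => Complex.exp (Complex.I * β I * t) • Y I)
      (fun I (t : ℝ) => Complex.exp (-(Complex.I * β I * t)) • conjRed C.plane (Y I)) :
        Fin d ⊕ Fin d → ℝ → Reduced (cxPlane C.plane))
  normalized : ∀ I J, 1 / Complex.I * redSymp (cxPlane C.plane) (Y I) (conjRed C.plane (Y J)) =
    if I = J then 1 else 0
  isotropic : ∀ I J, redSymp (cxPlane C.plane) (Y I) (Y J) = 0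

/-- `ψ` is the Gaussian wave function `c exp((i/2) ∑ ξⱼ Aⱼₖ ξₖ)`, `c ≠ 0`, with symmetric complex
matrix `A` whose imaginary part is positive definite (which expresses that `ψ` is a Schwartz
function). -/
def IsGaussian {n : ℕ} (A : Matrix (Fin n) (Fin n) ℂ) (ψ : 𝓢(Conf n, ℂ)) : Prop :=
  A.IsSymm ∧ (A.map Complex.im).PosDef ∧ ∃ c : ℂ, c ≠ 0 ∧ ∀ ξ : Conf n,
    ψ ξ = c * Complex.exp (Complex.I / 2 * ∑ j, ∑ k, (ξ j : ℂ) * A j k * (ξ k : ℂ))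

/-- The H-germ of `ψ`: those `Y` in the complexified phase space, skew-orthogonal to the constraint
plane (so that `Ω(Y)` acts on equivalence classes), with `‖Ω(Y) ψ‖ = 0`. -/
def hGerm {n : ℕ} (C : ConstraintPlane n) (ψ : 𝓢(Conf n, ℂ)) : Set (Phase ℂ n) :=
  {Y | Y ∈ perp (cxPlane C.plane) ∧ ‖(show PreHilbert C from Om n Y ψ)‖ = 0}

/-- The class `Ω̄(Y₁*)^{N₁} ⋯ Ω̄(Y_d*)^{N_d} [ψ]`. -/
def excited {n : ℕ} (C : ConstraintPlane n) {d : ℕ} (Y : Fin d → Reduced (cxPlane C.plane))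
    (ψ : 𝓢(Conf n, ℂ)) (N : Fin d → ℕ) : States C :=
  (List.ofFn fun I => redOm C (conjRed C.plane (Y I)) ^ N I).prod (cls C ψ)

end ConstrainedQM

end

noncomputable section

namespace ConstrainedQM

/-! ### Commutation relations and adjoints -/

/-! The argument is the algebra of ladder operators, carried out on classes modulo null vectors.
Three facts drive it: $[\bar\Omega(X),\bar\Omega(Y)]=-i\,\omega(X,Y)$ (`redOm_commutator`);
$\bar\Omega(Y)$ and $\bar\Omega(Y^*)$ are adjoint (`inner_redOm_left`); and for symmetric
$\bar\Gamma$, $[\bar\Omega_2(\bar\Gamma),\bar\Omega(Y)]=i\,\bar\Omega(Y\circ\bar\Gamma)$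
(`redOm2_commutator`). The first two give
$\|\bar\Omega(Y^*)u\|^2=\|\bar\Omega(Y)u\|^2+\frac1i\omega(Y,Y^*)\|u\|^2$.

Gaussians. $\Omega(P,Q)$ multiplies $\psi_A$ by the linear function $(P-AQ)\cdot\xi$, so it
annihilates $\psi_A$ exactly on the plane $P=AQ$. This plane is Lagrangian, and
$\frac1i\omega(Y,Y^*)>0$ on its non-zero vectors because $\operatorname{Im}A>0$. The class
$[\psi_A]$ is non-zero since every matrix element $(\psi_A,e^{i\Omega(X)}\psi_A)$ is a positive
number (`IsGaussian.coef_pos`). Hence the annihilators of $[\psi_A]$ in the reduced space are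
exactly the image `redLagr` of that plane, and the reduced space is the direct sum of `redLagr` and
its conjugate (`redOm_cls_eq_zero_iff`, `isCompl_redLagr`).

Part 1. If $[\psi_A]$ is an eigenvector, the third identity shows that the annihilator plane is
invariant under the flow, so the projection $\pi$ onto it along its conjugate commutes with the
flow. Then $\operatorname{Im}\omega(\pi X,(\pi X)^*)$ is a positive definite invariant on real
vectors, that is, a Lyapunov function.

Part 2(a). Stability bounds every complexified solution forward in time. This excludes eigenvalues
with positive real part, and also those with negative real part, because the spectrum of a
symplectically skew operator is symmetric under $\lambda\mapsto-\lambda$. It excludes Jordan blocks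
as well, through their secular solutions. Normal modes are then split off one at a time
(`exists_mode_extension`).

Part 2(b). The preimage of the span of the modes is a Lagrangian plane containing $\mathcal
L_k^{\mathbb C}$ and positive modulo it. Trading $\mathcal L_k^{\mathbb C}$ for the positive plane
$\{X-iJX\}$, with $J$ the standard complex structure, gives a strictly positive Lagrangian plane,
which is the graph of some $A$ (`exists_lagr_inf_perp_sup`, `exists_lagr_eq`).

Part 2(c). Expanding $\bar\Gamma$ in the modes makes $\bar\Omega_2(\bar\Gamma)$ a sum of
oscillators, which yields the ground energy; each creation operator adds $\beta_I$ and is injective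
by the norm identity. For density, all words in the $\Omega(W)$ applied to $\psi_A$ have class in
the span (`IsGaussian.wordSpan_le`), hence plane waves times $\psi_A$ lie in its closure, by
convergence of the exponential series in Schwartz space. A vector orthogonal to all of these is
orthogonal, by Fourier superposition, to every $\hat\varphi\,\psi_A$; this includes all compactly
supported Schwartz functions, as $\psi_A$ has no zeros, and truncation reaches the rest. -/

theorem posOp_comm {n : ℕ} (i j : Fin n) (f : 𝓢(Conf n, ℂ)) :
    posOp i (posOp j f) = posOp j (posOp i f) := by
  ext ξ
  simp only [posOp_apply]
  ring

theorem partialOp_comm {n : ℕ} (i j : Fin n) (f : 𝓢(Conf n, ℂ)) :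
    partialOp i (partialOp j f) = partialOp j (partialOp i f) := by
  have key : ∀ (i j : Fin n) (ξ : Conf n), partialOp i (partialOp j f) ξ =
      fderiv ℝ (fderiv ℝ f) ξ (EuclideanSpace.single i 1) (EuclideanSpace.single j 1) := by
    intro i j ξ
    have h : (partialOp j f : Conf n → ℂ) =
        fun η => fderiv ℝ f η (EuclideanSpace.single j 1) := funext (partialOp_apply j f)
    have hd : DifferentiableAt ℝ (fderiv ℝ f) ξ :=
      ((f.smooth 2).fderiv_right (m := 1) (by norm_num)).differentiable (by norm_num) ξ
    rw [partialOp_apply, h, fderiv_clm_apply hd (by fun_prop)]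
    simp
  ext ξ
  rw [key, key]
  exact ((f.smooth 2).contDiffAt.isSymmSndFDerivAt (by simp)).eq _ _

theorem partialOp_posOp {n : ℕ} (i j : Fin n) (f : 𝓢(Conf n, ℂ)) :
    partialOp i (posOp j f) = posOp j (partialOp i f) + (if i = j then (1 : ℂ) else 0) • f := by
  ext ξ
  have h : (posOp j f : Conf n → ℂ) =
      fun η => Complex.ofRealCLM.comp (EuclideanSpace.proj j : Conf n →L[ℝ] ℝ) η * f η :=
    funext (posOp_apply j f)
  rw [partialOp_apply, h, fderiv_fun_mul (ContinuousLinearMap.differentiableAt _)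
    f.differentiableAt, ContinuousLinearMap.fderiv]
  simp only [add_apply, smul_apply, posOp_apply, partialOp_apply,
    ContinuousLinearMap.comp_apply, smul_eq_mul]
  rcases eq_or_ne i j with rfl | hij
  · simp
  · simp [hij, Ne.symm hij]

theorem Om_eq_sum {n : ℕ} (Y : Phase ℂ n) (f : 𝓢(Conf n, ℂ)) :
    Om n Y f = ∑ j, (Y.1 j • posOp j f + (Complex.I * Y.2 j) • partialOp j f) := by
  change ∑ j, (Y.1 j • posOp j f - Y.2 j • (1 / Complex.I) • partialOp j f) = _
  refine Finset.sum_congr rfl fun j _ => ?_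
  rw [smul_smul, sub_eq_add_neg, ← neg_smul]
  congr 2
  simp
  ring

/-- The canonical commutation relations `[Ω(X), Ω(Y)] = -i ω(X, Y)`. -/
theorem Om_commutator {n : ℕ} (X Y : Phase ℂ n) (f : 𝓢(Conf n, ℂ)) :
    Om n X (Om n Y f) = Om n Y (Om n X f) + (-Complex.I * symp ℂ n X Y) • f := by
  -- The commutator is computed one pair of coordinates at a time; only $i=j$ contributes a scalar.
  have key : ∀ i j, (X.1 i • posOp i (Y.1 j • posOp j f + (Complex.I * Y.2 j) • partialOp j f) +
      (Complex.I * X.2 i) • partialOp i (Y.1 j • posOp j f + (Complex.I * Y.2 j) • partialOp j f)) =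
      (Y.1 j • posOp j (X.1 i • posOp i f + (Complex.I * X.2 i) • partialOp i f) +
      (Complex.I * Y.2 j) • partialOp j (X.1 i • posOp i f + (Complex.I * X.2 i) • partialOp i f)) +
      (if i = j then (-Complex.I * (X.1 i * Y.2 j - Y.1 j * X.2 i)) else 0) • f := by
    intro i j
    simp only [map_add, map_smul, partialOp_posOp]
    rw [posOp_comm i j, partialOp_comm i j]
    rcases eq_or_ne i j with rfl | hij
    · simp only [if_true]
      module
    · simp only [hij, hij.symm, if_false]
      module
  rw [Om_eq_sum X (Om n Y f), Om_eq_sum Y (Om n X f), Om_eq_sum Y f, Om_eq_sum X f]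
  simp only [map_sum, Finset.smul_sum, ← Finset.sum_add_distrib]
  rw [Finset.sum_congr rfl fun i _ => Finset.sum_congr rfl fun j _ => key i j]
  simp only [Finset.sum_add_distrib]
  rw [Finset.sum_comm, Finset.sum_comm (f := fun i j => (Complex.I * Y.2 j) • _)]
  congr 1
  simp only [ite_smul, zero_smul, Finset.sum_ite_eq, Finset.mem_univ, if_true]
  rw [← Finset.sum_smul, symp_apply, Finset.mul_sum]

/-! ### Linear algebra of the symplectic form -/

section Symplectic

variable {𝕜 : Type} [Field 𝕜] {n : ℕ}

theorem symp_single_left (Y : Phase 𝕜 n) (j : Fin n) :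
    symp 𝕜 n (Pi.single j 1, 0) Y = Y.2 j := by
  simp [symp_apply, Pi.single_apply]

theorem symp_single_right (Y : Phase 𝕜 n) (j : Fin n) :
    symp 𝕜 n (0, Pi.single j 1) Y = -Y.1 j := by
  simp [symp_apply, Pi.single_apply]

theorem eq_zero_of_symp (Y : Phase 𝕜 n) (h : ∀ X, symp 𝕜 n X Y = 0) : Y = 0 := by
  ext j
  · simpa [symp_single_right] using h (0, Pi.single j 1)
  · simpa [symp_single_left] using h (Pi.single j 1, 0)

theorem symp_isRefl : (symp 𝕜 n).IsRefl := fun X Y h => by rw [symp_swap, h, neg_zero]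

theorem symp_nondegenerate : (symp 𝕜 n).Nondegenerate :=
  ⟨fun X h => eq_zero_of_symp X fun Y => by rw [symp_swap, h, neg_zero],
    fun Y h => eq_zero_of_symp Y h⟩

theorem perp_perp (L : Submodule 𝕜 (Phase 𝕜 n)) : perp (perp L) = L :=
  LinearMap.BilinForm.orthogonal_orthogonal (B := symp 𝕜 n) symp_nondegenerate
    symp_isRefl L

theorem finrank_phase : finrank 𝕜 (Phase 𝕜 n) = 2 * n := by
  simp [finrank_prod, two_mul]

theorem finrank_perp (L : Submodule 𝕜 (Phase 𝕜 n)) :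
    finrank 𝕜 (perp L) = 2 * n - finrank 𝕜 L := by
  rw [← finrank_phase (𝕜 := 𝕜)]
  exact LinearMap.BilinForm.finrank_orthogonal symp_nondegenerate L

theorem perp_antitone {L L' : Submodule 𝕜 (Phase 𝕜 n)} (h : L ≤ L') : perp L' ≤ perp L :=
  fun _ hY X hX => hY X (h hX)

theorem eq_top_of_perp_eq_bot {L : Submodule 𝕜 (Phase 𝕜 n)} (h : perp L = ⊥) : L = ⊤ := by
  rw [← perp_perp L, h, eq_top_iff]
  rintro Y - X rfl
  simp

theorem finrank_reduced {L : Submodule 𝕜 (Phase 𝕜 n)} (h : L ≤ perp L) :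
    finrank 𝕜 (Reduced L) = 2 * n - 2 * finrank 𝕜 L := by
  have h1 : finrank 𝕜 (Reduced L) + finrank 𝕜 (L.submoduleOf (perp L)) = finrank 𝕜 (perp L) :=
    Submodule.finrank_quotient_add_finrank (L.submoduleOf (perp L))
  rw [finrank_perp, (Submodule.submoduleOfEquivOfLe h).finrank_eq] at h1
  omega

theorem redSymp_mk (L : Submodule 𝕜 (Phase 𝕜 n)) (X Y : perp L) :
    redSymp L (Submodule.Quotient.mk X) (Submodule.Quotient.mk Y) = symp 𝕜 n X Y := rfl

theorem redSymp_swap (L : Submodule 𝕜 (Phase 𝕜 n)) (X Y : Reduced L) :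
    redSymp L X Y = -redSymp L Y X := by
  obtain ⟨X, rfl⟩ := Submodule.Quotient.mk_surjective _ X
  obtain ⟨Y, rfl⟩ := Submodule.Quotient.mk_surjective _ Y
  exact symp_swap _ _

/-- Nondegeneracy of the reduced form is the double-complement identity $L^{\perp\perp}=L$: a vector
orthogonal to all of $L^{\perp}$ lies in $L$, which is zero in the quotient. -/
theorem eq_zero_of_redSymp (L : Submodule 𝕜 (Phase 𝕜 n)) (Y : Reduced L)
    (h : ∀ X, redSymp L X Y = 0) : Y = 0 := by
  obtain ⟨Y, rfl⟩ := Submodule.Quotient.mk_surjective _ Y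
  rw [Submodule.Quotient.mk_eq_zero]
  exact (perp_perp L).le fun X hX => h (Submodule.Quotient.mk ⟨X, hX⟩)

end Symplectic

/-! ### Conjugation and the real structure of the reduced phase space. -/

section Conjugation

variable {n : ℕ}

theorem conjPhase_conjPhase (Y : Phase ℂ n) : conjPhase n (conjPhase n Y) = Y := by
  ext j <;> simp [conjPhase]

theorem symp_conjPhase (X Y : Phase ℂ n) :
    symp ℂ n (conjPhase n X) (conjPhase n Y) = starRingEnd ℂ (symp ℂ n X Y) := by
  simp [symp_apply, conjPhase]

variable (L : Submodule ℝ (Phase ℝ n))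

theorem conjRed_mk (Y : perp (cxPlane L)) :
    conjRed L (Submodule.Quotient.mk Y) =
      Submodule.Quotient.mk ⟨conjPhase n Y, conj_mem_perp Y.2⟩ := rfl

theorem conjRed_conjRed (Y : Reduced (cxPlane L)) : conjRed L (conjRed L Y) = Y := by
  obtain ⟨Y, rfl⟩ := Submodule.Quotient.mk_surjective _ Y
  rw [conjRed_mk, conjRed_mk]
  congr 1
  exact Subtype.ext (conjPhase_conjPhase _)

theorem redSymp_conjRed (X Y : Reduced (cxPlane L)) :
    redSymp (cxPlane L) (conjRed L X) (conjRed L Y) =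
      starRingEnd ℂ (redSymp (cxPlane L) X Y) := by
  obtain ⟨X, rfl⟩ := Submodule.Quotient.mk_surjective _ X
  obtain ⟨Y, rfl⟩ := Submodule.Quotient.mk_surjective _ Y
  exact symp_conjPhase _ _

theorem cxRed_mk (Y : perp L) :
    cxRed L (Submodule.Quotient.mk Y) = Submodule.Quotient.mk ⟨cx n Y, cx_mem_perp Y.2⟩ := rfl

theorem conjRed_cxRed (X : Reduced L) : conjRed L (cxRed L X) = cxRed L X := by
  obtain ⟨X, rfl⟩ := Submodule.Quotient.mk_surjective _ X
  rw [cxRed_mk, conjRed_mk]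
  congr 1
  exact Subtype.ext (conjPhase_cx _)

theorem redSymp_cxRed (X Y : Reduced L) :
    redSymp (cxPlane L) (cxRed L X) (cxRed L Y) = (redSymp L X Y : ℂ) := by
  obtain ⟨X, rfl⟩ := Submodule.Quotient.mk_surjective _ X
  obtain ⟨Y, rfl⟩ := Submodule.Quotient.mk_surjective _ Y
  exact symp_cx _ _

/-- Real part of a vector of the complexified phase space. -/
def rePhase (n : ℕ) : Phase ℂ n →ₗ[ℝ] Phase ℝ n :=
  (Complex.reLm.compLeft (Fin n)).prodMap (Complex.reLm.compLeft (Fin n))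

theorem rePhase_smul_cx (c : ℂ) (X : Phase ℝ n) : rePhase n (c • cx n X) = c.re • X := by
  ext j <;> simp [rePhase, cx_fst, cx_snd]

theorem rePhase_mem {L : Submodule ℝ (Phase ℝ n)} {Y : Phase ℂ n} (hY : Y ∈ cxPlane L) :
    rePhase n Y ∈ L := by
  -- Real parts do not commute with complex scalars, so the induction on the span carries all
  -- complex multiples.
  suffices ∀ c : ℂ, rePhase n (c • Y) ∈ L by simpa using this 1
  induction hY using Submodule.span_induction with
  | mem x h =>
    obtain ⟨x, hx, rfl⟩ := h
    intro c
    rw [rePhase_smul_cx]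
    exact L.smul_mem _ hx
  | zero => simp
  | add x y _ _ hx hy => intro c; rw [smul_add, map_add]; exact add_mem (hx c) (hy c)
  | smul a x _ hx => intro c; rw [smul_smul]; exact hx _

theorem rePhase_mem_perp {L : Submodule ℝ (Phase ℝ n)} {Y : Phase ℂ n}
    (hY : Y ∈ perp (cxPlane L)) : rePhase n Y ∈ perp L := (re_im_mem_perp hY).1

/-- Real part of a vector of the complexified reduced phase space. -/
def reRed : Reduced (cxPlane L) →ₗ[ℝ] Reduced L :=
  (((cxPlane L).submoduleOf (perp (cxPlane L))).restrictScalars ℝ).liftQ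
    ((L.submoduleOf (perp L)).mkQ.comp
      (LinearMap.codRestrict (perp L) ((rePhase n).comp
        ((perp (cxPlane L)).restrictScalars ℝ).subtype) fun Y => rePhase_mem_perp Y.2))
    (fun _ hY => (Submodule.Quotient.mk_eq_zero _).2 (rePhase_mem hY))

theorem reRed_mk (Y : perp (cxPlane L)) :
    reRed L (Submodule.Quotient.mk Y) =
      Submodule.Quotient.mk ⟨rePhase n Y, rePhase_mem_perp Y.2⟩ := rfl

theorem reRed_smul_cxRed (c : ℂ) (X : Reduced L) : reRed L (c • cxRed L X) = c.re • X := by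
  obtain ⟨X, rfl⟩ := Submodule.Quotient.mk_surjective _ X
  rw [cxRed_mk, ← Submodule.Quotient.mk_smul, reRed_mk, ← Submodule.Quotient.mk_smul]
  congr 1
  exact Subtype.ext (rePhase_smul_cx c _)

/-- The imaginary part is expressed as the real part of $-iY$, so that a single map `reRed` suffices
to control complex vectors by real ones. -/
theorem cxRed_reRed (Y : Reduced (cxPlane L)) :
    Y = cxRed L (reRed L Y) + Complex.I • cxRed L (reRed L (-Complex.I • Y)) := by
  obtain ⟨Y, rfl⟩ := Submodule.Quotient.mk_surjective _ Y
  rw [reRed_mk, cxRed_mk, ← Submodule.Quotient.mk_smul, reRed_mk, cxRed_mk,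
    ← Submodule.Quotient.mk_smul, ← Submodule.Quotient.mk_add]
  congr 1
  refine Subtype.ext ((cx_re_im (Y : Phase ℂ n)).trans ?_)
  have : ((fun j => ((Y : Phase ℂ n).1 j).im, fun j => ((Y : Phase ℂ n).2 j).im) : Phase ℝ n) =
      rePhase n (-Complex.I • (Y : Phase ℂ n)) := by
    ext j <;> simp [rePhase]
  rw [this]
  rfl

theorem cxPlane_le_perp {L : Submodule ℝ (Phase ℝ n)}
    (h : ∀ X ∈ L, ∀ Y ∈ L, symp ℝ n X Y = 0) : cxPlane L ≤ perp (cxPlane L) :=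
  Submodule.span_le.2 fun _ ⟨_, hx, hX⟩ => hX ▸ cx_mem_perp fun Y hY => h Y hY _ hx

theorem finrank_cxPlane : finrank ℂ (cxPlane L) = finrank ℝ L := by
  let b := finBasis ℝ L
  have hs : cxPlane L = Submodule.span ℂ (Set.range fun i => cx n (b i)) := by
    apply le_antisymm
    · refine Submodule.span_le.2 ?_
      rintro _ ⟨x, hx, rfl⟩
      have := congrArg (fun y : L => cx n y) (b.sum_repr ⟨x, hx⟩)
      simp only [Submodule.coe_sum, Submodule.coe_smul, map_sum, map_smul] at this
      rw [← this]
      refine sum_mem fun i _ => ?_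
      rw [← Complex.coe_smul]
      exact Submodule.smul_mem _ _ (Submodule.subset_span ⟨i, rfl⟩)
    · refine Submodule.span_mono ?_
      rintro _ ⟨i, rfl⟩
      exact ⟨_, (b i).2, rfl⟩
  have hli : LinearIndependent ℂ (fun i => cx n (b i)) := by
    rw [Fintype.linearIndependent_iff]
    intro g hg
    -- Real parts of the multiples of the relation by $1$ and $i$ give real relations among the `b
    -- i`, killing both the real and the imaginary parts of the coefficients.
    have key : ∀ c : ℂ, ∀ i, (c * g i).re = 0 := by
      intro c
      have h1 : rePhase n (c • ∑ i, g i • cx n (b i)) = 0 := by rw [hg]; simp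
      simp only [Finset.smul_sum, map_sum, smul_smul, rePhase_smul_cx] at h1
      have h2 : ∑ i, (c * g i).re • b i = 0 := by
        apply Subtype.ext
        simpa using h1
      exact Fintype.linearIndependent_iff.1 b.linearIndependent _ h2
    intro i
    apply Complex.ext
    · simpa using key 1 i
    · simpa using key Complex.I i
  rw [hs, finrank_span_eq_card hli, Fintype.card_fin]

end Conjugation

/-! ### Operators on equivalence classes -/

section Operators

variable {n : ℕ} (C : ConstraintPlane n)

theorem redOm_mk_cls (Y : perp (cxPlane C.plane)) (f : 𝓢(Conf n, ℂ)) :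
    redOm C (Submodule.Quotient.mk Y) (cls C f) = cls C (Om n Y f) := rfl

theorem cls_surjective : Function.Surjective (cls C) := fun u => by
  obtain ⟨f, hf⟩ := SeparationQuotient.surjective_mk u
  exact ⟨f, hf⟩

theorem cls_add (f g : 𝓢(Conf n, ℂ)) : cls C (f + g) = cls C f + cls C g := rfl

theorem cls_smul (c : ℂ) (f : 𝓢(Conf n, ℂ)) : cls C (c • f) = c • cls C f := rfl

theorem cls_eq_zero_iff (f : 𝓢(Conf n, ℂ)) :
    cls C f = 0 ↔ ‖(show PreHilbert C from f)‖ = 0 := by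
  rw [← norm_eq_zero, cls, SeparationQuotient.norm_mk]

theorem inner_cls (f g : 𝓢(Conf n, ℂ)) : inner ℂ (cls C f) (cls C g) = form C f g := rfl

theorem cls_Om_cxPlane {Y : Phase ℂ n} (hY : Y ∈ cxPlane C.plane) (f : 𝓢(Conf n, ℂ)) :
    cls C (Om n Y f) = 0 := (cls_eq_zero_iff C _).2 (norm_preOm_plane C hY f)

theorem form_smul_right (f g : 𝓢(Conf n, ℂ)) (c : ℂ) : form C f (c • g) = c * form C f g := by
  simp only [form, coef_smul_right]
  exact integral_const_mul _ _

theorem form_add_right (f g g' : 𝓢(Conf n, ℂ)) :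
    form C f (g + g') = form C f g + form C f g' := by
  rw [← conj_form, form_add_left, map_add, conj_form, conj_form]

/-- Real and imaginary parts of $Y$ are skew-orthogonal to the constraint plane, so each acts
symmetrically for the form; conjugate linearity in the first slot turns $Y$ into $Y^*$. -/
theorem form_Om_adjoint (f g : 𝓢(Conf n, ℂ)) {Y : Phase ℂ n}
    (hY : Y ∈ perp (cxPlane C.plane)) :
    form C (Om n Y f) g = form C f (Om n (conjPhase n Y) g) := by
  obtain ⟨h1, h2⟩ := re_im_mem_perp hY
  have e : conjPhase n Y = cx n (fun j => (Y.1 j).re, fun j => (Y.2 j).re) +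
      (-Complex.I) • cx n (fun j => (Y.1 j).im, fun j => (Y.2 j).im) := by
    conv_lhs => rw [cx_re_im Y, map_add, map_smulₛₗ, conjPhase_cx, conjPhase_cx, Complex.conj_I]
  rw [e]
  conv_lhs => rw [cx_re_im Y]
  simp only [map_add, map_smul, LinearMap.add_apply, LinearMap.smul_apply]
  rw [form_add_left, form_smul_left, form_add_right, form_smul_right, form_Om_symm C f g h1,
    form_Om_symm C f g h2, Complex.conj_I]

theorem redOm_commutator (X Y : Reduced (cxPlane C.plane)) (u : States C) :
    redOm C X (redOm C Y u) =
      redOm C Y (redOm C X u) + (-Complex.I * redSymp (cxPlane C.plane) X Y) • u := by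
  obtain ⟨X, rfl⟩ := Submodule.Quotient.mk_surjective _ X
  obtain ⟨Y, rfl⟩ := Submodule.Quotient.mk_surjective _ Y
  obtain ⟨f, rfl⟩ := cls_surjective C u
  simp only [redOm_mk_cls, redSymp_mk]
  rw [Om_commutator, cls_add, cls_smul]

theorem inner_redOm_left (Y : Reduced (cxPlane C.plane)) (u v : States C) :
    inner ℂ (redOm C Y u) v = inner ℂ u (redOm C (conjRed C.plane Y) v) := by
  obtain ⟨Y, rfl⟩ := Submodule.Quotient.mk_surjective _ Y
  obtain ⟨f, rfl⟩ := cls_surjective C u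
  obtain ⟨g, rfl⟩ := cls_surjective C v
  simp only [redOm_mk_cls, conjRed_mk, inner_cls]
  exact form_Om_adjoint C f g Y.2

/-- `‖Ω̄(Y*) u‖² = ‖Ω̄(Y) u‖² + (1/i) ω(Y, Y*) ‖u‖²`. -/
theorem norm_sq_redOm_conj (Y : Reduced (cxPlane C.plane)) (u : States C) :
    ((‖redOm C (conjRed C.plane Y) u‖ ^ 2 : ℝ) : ℂ) = ((‖redOm C Y u‖ ^ 2 : ℝ) : ℂ) +
      1 / Complex.I * redSymp (cxPlane C.plane) Y (conjRed C.plane Y) * ((‖u‖ ^ 2 : ℝ) : ℂ) := by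
  have e : ∀ v : States C, ((‖v‖ ^ 2 : ℝ) : ℂ) = inner ℂ v v := fun v => by
    rw [inner_self_eq_norm_sq_to_K]; push_cast; rfl
  rw [e, e, e, inner_redOm_left, conjRed_conjRed, redOm_commutator, inner_add_right,
    inner_smul_right, inner_redOm_left C Y u]
  simp

end Operators

/-! ### Quadratic tensors: the linear flow and the Hamiltonian they generate. -/

section Tensor

variable {𝕜 V : Type} [CommRing 𝕜] [AddCommGroup V] [Module 𝕜 V]

theorem circ_tmul (ω : V →ₗ[𝕜] V →ₗ[𝕜] 𝕜) (Z W Y : V) :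
    circ ω (Z ⊗ₜ W) Y = (2 * ω Y Z) • W := rfl

/-- The adjoint of $Z\otimes W$ for the form comes from the flipped tensor; thus a symmetric tensor
generates an infinitesimally symplectic flow. -/
theorem circ_skew {ω : V →ₗ[𝕜] V →ₗ[𝕜] 𝕜} (hω : ∀ X Y, ω X Y = -ω Y X) (Γ : V ⊗[𝕜] V) (X Y : V) :
    ω (circ ω Γ X) Y = -ω X (circ ω (TensorProduct.comm 𝕜 V V Γ) Y) := by
  induction Γ with
  | zero => simp
  | add a b ha hb => simp only [map_add, LinearMap.add_apply, ha, hb]; ring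
  | tmul Z W =>
    simp only [TensorProduct.comm_tmul, circ_tmul, map_smul, LinearMap.smul_apply, smul_eq_mul]
    rw [hω W Y]
    ring

variable {n : ℕ} (C : ConstraintPlane n)

/-- The quadratic Hamiltonian of a complex tensor. -/
def quadOm : Reduced (cxPlane C.plane) ⊗[ℂ] Reduced (cxPlane C.plane) →ₗ[ℂ]
    Module.End ℂ (States C) :=
  TensorProduct.lift ((LinearMap.mul ℂ (Module.End ℂ (States C))).compl₁₂ (redOm C) (redOm C))

theorem quadOm_tmul (Z W : Reduced (cxPlane C.plane)) (u : States C) :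
    quadOm C (Z ⊗ₜ W) u = redOm C Z (redOm C W u) := rfl

theorem redOm2_eq (Γ : Reduced C.plane ⊗[ℝ] Reduced C.plane) :
    redOm2 C Γ = quadOm C (cxTensor C.plane Γ) := rfl

/-- A linear operator moved past $\bar\Omega(Z)\bar\Omega(W)$ leaves one commutator for each factor:
one gives the action of the tensor on $Y$, the other that of the flipped tensor. The factor
$\frac12$ offsets the $2$ built into `circ`. -/
theorem quadOm_commutator (Γ : Reduced (cxPlane C.plane) ⊗[ℂ] Reduced (cxPlane C.plane))
    (Y : Reduced (cxPlane C.plane)) (u : States C) :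
    quadOm C Γ (redOm C Y u) = redOm C Y (quadOm C Γ u) + (Complex.I / 2) •
      redOm C (circ (redSymp (cxPlane C.plane)) Γ Y +
        circ (redSymp (cxPlane C.plane)) (TensorProduct.comm ℂ _ _ Γ) Y) u := by
  induction Γ with
  | zero => simp
  | add a b ha hb => simp only [map_add, LinearMap.add_apply, ha, hb]; module
  | tmul Z W =>
    simp only [TensorProduct.comm_tmul, circ_tmul, quadOm_tmul, map_add, map_smul,
      LinearMap.add_apply, LinearMap.smul_apply]
    rw [redOm_commutator C W Y, map_add, map_smul, redOm_commutator C Z Y,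
      redSymp_swap _ W Y, redSymp_swap _ Z Y]
    module

variable (L : Submodule ℝ (Phase ℝ n))

theorem cxTensor_tmul (Z W : Reduced L) : cxTensor L (Z ⊗ₜ W) = cxRed L Z ⊗ₜ[ℂ] cxRed L W := rfl

theorem comm_cxTensor (Γ : Reduced L ⊗[ℝ] Reduced L) :
    TensorProduct.comm ℂ _ _ (cxTensor L Γ) = cxTensor L (TensorProduct.comm ℝ _ _ Γ) := by
  induction Γ with
  | zero => simp
  | add a b ha hb => simp only [map_add, ha, hb]
  | tmul Z W => simp only [TensorProduct.comm_tmul, cxTensor_tmul]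

/-- The generator of the complexified reduced system. -/
def cxFlow (Γ : Reduced L ⊗[ℝ] Reduced L) : Module.End ℂ (Reduced (cxPlane L)) :=
  circ (redSymp (cxPlane L)) (cxTensor L Γ)

theorem cxFlow_add (Γ Γ' : Reduced L ⊗[ℝ] Reduced L) :
    cxFlow L (Γ + Γ') = cxFlow L Γ + cxFlow L Γ' := by
  simp only [cxFlow, map_add]

theorem cxFlow_tmul (Z W : Reduced L) (Y : Reduced (cxPlane L)) :
    cxFlow L (Z ⊗ₜ W) Y = (2 * redSymp (cxPlane L) Y (cxRed L Z)) • cxRed L W := rfl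

theorem cxFlow_zero : cxFlow L 0 = 0 := by
  simp only [cxFlow, map_zero]

theorem cxFlow_cxRed (Γ : Reduced L ⊗[ℝ] Reduced L) (X : Reduced L) :
    cxFlow L Γ (cxRed L X) = cxRed L (circ (redSymp L) Γ X) := by
  induction Γ with
  | zero => simp [cxFlow_zero]
  | add a b ha hb => simp only [cxFlow_add, map_add, LinearMap.add_apply, ha, hb]
  | tmul Z W =>
    rw [cxFlow_tmul, circ_tmul, map_smul, redSymp_cxRed, ← Complex.coe_smul]
    push_cast
    rfl

theorem cxFlow_conjRed (Γ : Reduced L ⊗[ℝ] Reduced L) (Y : Reduced (cxPlane L)) :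
    cxFlow L Γ (conjRed L Y) = conjRed L (cxFlow L Γ Y) := by
  induction Γ with
  | zero => simp [cxFlow_zero]
  | add a b ha hb => simp only [cxFlow_add, map_add, LinearMap.add_apply, ha, hb]
  | tmul Z W =>
    rw [cxFlow_tmul, cxFlow_tmul, map_smulₛₗ, conjRed_cxRed]
    conv_lhs => rw [← conjRed_cxRed L Z, redSymp_conjRed]
    rw [map_mul, map_ofNat]

theorem reRed_cxFlow (Γ : Reduced L ⊗[ℝ] Reduced L) (Y : Reduced (cxPlane L)) :
    reRed L (cxFlow L Γ Y) = circ (redSymp L) Γ (reRed L Y) := by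
  rw [cxRed_reRed L Y, map_add, map_smul, cxFlow_cxRed, cxFlow_cxRed, map_add, map_add]
  have h : ∀ X, reRed L (cxRed L X) = X := fun X => by
    simpa using reRed_smul_cxRed L 1 X
  simp only [reRed_smul_cxRed, h, Complex.I_re, zero_smul, add_zero]

theorem cxFlow_skew {Γ : Reduced L ⊗[ℝ] Reduced L} (hΓ : TensorProduct.comm ℝ _ _ Γ = Γ)
    (X Y : Reduced (cxPlane L)) :
    redSymp (cxPlane L) (cxFlow L Γ X) Y = -redSymp (cxPlane L) X (cxFlow L Γ Y) := by
  have := circ_skew (redSymp_swap (cxPlane L)) (cxTensor L Γ) X Y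
  rwa [comm_cxTensor, hΓ] at this

/-- The ladder relation: if $Y$ is an eigenvector of the flow with eigenvalue $\mu$, then
$\bar\Omega(Y)$ shifts the energy by $i\mu$. For symmetric tensors the two halves of the general
commutator coincide. -/
theorem redOm2_commutator {Γ : Reduced C.plane ⊗[ℝ] Reduced C.plane}
    (hΓ : TensorProduct.comm ℝ _ _ Γ = Γ) (Y : Reduced (cxPlane C.plane)) (u : States C) :
    redOm2 C Γ (redOm C Y u) =
      redOm C Y (redOm2 C Γ u) + Complex.I • redOm C (cxFlow C.plane Γ Y) u := by
  rw [redOm2_eq, quadOm_commutator, comm_cxTensor, hΓ, cxFlow, map_add, LinearMap.add_apply]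
  module

end Tensor

/-! ### Gaussian wave functions -/

open Matrix in
/-- The plane `{(A Q, Q)}`: the vectors `Y` such that `Ω(Y)` annihilates the Gaussian `ψ_A`. -/
def lagr {n : ℕ} (A : Matrix (Fin n) (Fin n) ℂ) : Submodule ℂ (Phase ℂ n) where
  carrier := {Y | Y.1 = A *ᵥ Y.2}
  zero_mem' := by simp
  add_mem' {X Y} hX hY := by
    simp only [Set.mem_ofPred_eq] at hX hY ⊢
    rw [Prod.fst_add, Prod.snd_add, mulVec_add, hX, hY]
  smul_mem' c X hX := by
    simp only [Set.mem_ofPred_eq] at hX ⊢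
    rw [Prod.smul_fst, Prod.smul_snd, mulVec_smul, hX]

/-! ### The Lagrangian plane of a Gaussian: positivity and decompositions. -/

section Lagrangian

open Matrix

variable {n : ℕ} {A : Matrix (Fin n) (Fin n) ℂ}

theorem mem_lagr {Y : Phase ℂ n} : Y ∈ lagr A ↔ Y.1 = A *ᵥ Y.2 := Iff.rfl

theorem symp_eq_dotProduct (X Y : Phase ℂ n) : symp ℂ n X Y = X.1 ⬝ᵥ Y.2 - Y.1 ⬝ᵥ X.2 := by
  simp [symp_apply, dotProduct, Finset.sum_sub_distrib]

theorem mulVec_dotProduct_comm (hA : A.IsSymm) (v w : Fin n → ℂ) :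
    (A *ᵥ v) ⬝ᵥ w = (A *ᵥ w) ⬝ᵥ v := by
  rw [dotProduct_comm, dotProduct_mulVec, ← mulVec_transpose, hA.eq]

/-- Pairing with the vectors $(Ae_j,e_j)$ recovers the coordinates of $P-AQ$; the converse is the
symmetry of $A$. -/
theorem perp_lagr (hA : A.IsSymm) : perp (lagr A) = lagr A := by
  ext Y
  constructor
  · intro h
    rw [mem_lagr]
    ext j
    have := h (A *ᵥ Pi.single j 1, Pi.single j 1) rfl
    rw [symp_eq_dotProduct, mulVec_dotProduct_comm hA, dotProduct_single, dotProduct_single,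
      mul_one, mul_one] at this
    exact (sub_eq_zero.1 this).symm
  · intro h X hX
    rw [mem_lagr] at h hX
    rw [symp_eq_dotProduct, h, hX, mulVec_dotProduct_comm hA, sub_self]

theorem symp_lagr (hA : A.IsSymm) {X Y : Phase ℂ n} (hX : X ∈ lagr A) (hY : Y ∈ lagr A) :
    symp ℂ n X Y = 0 := (perp_lagr hA).ge hY X hX

theorem symp_conjPhase_self_re (Y : Phase ℂ n) : (symp ℂ n Y (conjPhase n Y)).re = 0 := by
  have h := symp_conjPhase Y (conjPhase n Y)
  rw [conjPhase_conjPhase, symp_swap] at h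
  have := congrArg Complex.re h
  simp only [Complex.neg_re, Complex.conj_re] at this
  linarith

theorem im_symp_lagr (hA : A.IsSymm) {Y : Phase ℂ n} (hY : Y ∈ lagr A) :
    (symp ℂ n Y (conjPhase n Y)).im =
      2 * ((fun j => (Y.2 j).re) ⬝ᵥ (A.map Complex.im) *ᵥ (fun j => (Y.2 j).re) +
        (fun j => (Y.2 j).im) ⬝ᵥ (A.map Complex.im) *ᵥ (fun j => (Y.2 j).im)) := by
  set q := Y.2 with hq
  -- The value is $z-\bar z$ with $z=(AQ)\cdot\bar Q$, so only $\operatorname{Im}z$ matters.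
  have hz : symp ℂ n Y (conjPhase n Y) = (A *ᵥ q) ⬝ᵥ (fun j => starRingEnd ℂ (q j)) -
      starRingEnd ℂ ((A *ᵥ q) ⬝ᵥ (fun j => starRingEnd ℂ (q j))) := by
    rw [symp_eq_dotProduct, mem_lagr.1 hY]
    simp [conjPhase, dotProduct, mem_lagr.1 hY, hq]
  -- The contribution of $\operatorname{Re}A$ to $\operatorname{Im}z$ pairs a symmetric matrix with
  -- an antisymmetric expression.
  have hR : ∑ j, ∑ k, (A j k).re * ((q k).im * (q j).re - (q k).re * (q j).im) = 0 := by
    simp only [mul_sub, Finset.sum_sub_distrib]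
    rw [sub_eq_zero]
    conv_rhs => rw [Finset.sum_comm]
    refine Finset.sum_congr rfl fun j _ => Finset.sum_congr rfl fun k _ => ?_
    rw [hA.apply j k]
    ring
  rw [hz, Complex.sub_im, Complex.conj_im, sub_neg_eq_add, ← two_mul]
  congr 1
  rw [← add_zero (_ + _), ← hR]
  simp only [dotProduct, mulVec, Complex.im_sum, Finset.mul_sum, Finset.sum_mul,
    ← Finset.sum_add_distrib, Matrix.map_apply]
  refine Finset.sum_congr rfl fun j _ => Finset.sum_congr rfl fun k _ => ?_
  simp [Complex.mul_im, Complex.mul_re]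
  ring

theorem im_symp_lagr_pos (hA : A.IsSymm) (hP : (A.map Complex.im).PosDef) {Y : Phase ℂ n}
    (hY : Y ∈ lagr A) (h0 : Y ≠ 0) : 0 < (symp ℂ n Y (conjPhase n Y)).im := by
  rw [im_symp_lagr hA hY]
  have hpos : ∀ x : Fin n → ℝ, 0 ≤ x ⬝ᵥ (A.map Complex.im) *ᵥ x := fun x => by
    simpa using hP.posSemidef.dotProduct_mulVec_nonneg x
  have hpos' : ∀ x : Fin n → ℝ, x ≠ 0 → 0 < x ⬝ᵥ (A.map Complex.im) *ᵥ x := fun x hx => by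
    simpa using hP.dotProduct_mulVec_pos hx
  by_cases hx : (fun j => (Y.2 j).re) = 0
  · by_cases hy : (fun j => (Y.2 j).im) = 0
    · have : Y.2 = 0 := by
        ext j
        exact Complex.ext (congrFun hx j) (congrFun hy j)
      exact absurd (Prod.ext (by rw [mem_lagr.1 hY, this]; simp) this) h0
    · linarith [hpos (fun j => (Y.2 j).re), hpos' _ hy]
  · linarith [hpos (fun j => (Y.2 j).im), hpos' _ hx]

theorem eq_zero_of_symp_conj (hA : A.IsSymm) (hP : (A.map Complex.im).PosDef) {Y : Phase ℂ n}
    (hY : Y ∈ lagr A) (h : symp ℂ n Y (conjPhase n Y) = 0) : Y = 0 := by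
  by_contra h0
  have := im_symp_lagr_pos hA hP hY h0
  rw [h] at this
  exact lt_irrefl _ this

/-- Every phase space vector decomposes into a creation part and an annihilation part,
modulo the constraint plane; the creation part can be taken skew-orthogonal to the plane. -/
theorem exists_decomp (hA : A.IsSymm) (hP : (A.map Complex.im).PosDef)
    (L : Submodule ℝ (Phase ℝ n)) (W : Phase ℂ n) :
    ∃ V ∈ lagr A ⊓ perp (cxPlane L), ∃ X ∈ cxPlane L, ∃ B ∈ lagr A,
      W = conjPhase n V + X + B := by
  -- It suffices that the skew-orthogonal complement of the sum vanish. A vector $Y$ in it lies in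
  -- `lagr A` and in the complement of the plane, so $Y^*$ belongs to the first summand; hence
  -- $\omega(Y,Y^*)=0$, which positivity excludes unless $Y=0$.
  have htop : ((lagr A ⊓ perp (cxPlane L)).comap (conjPhase n)) ⊔ cxPlane L ⊔ lagr A = ⊤ := by
    refine eq_top_of_perp_eq_bot (eq_bot_iff.2 fun Y hY => ?_)
    have h1 : Y ∈ lagr A := by
      rw [← perp_lagr hA]
      exact perp_antitone le_sup_right hY
    have h2 : Y ∈ perp (cxPlane L) := perp_antitone (le_sup_right.trans le_sup_left) hY
    have h3 := perp_antitone (le_sup_left.trans le_sup_left) hY (conjPhase n Y) (by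
      rw [Submodule.mem_comap, conjPhase_conjPhase]
      exact ⟨h1, h2⟩)
    exact eq_zero_of_symp_conj hA hP h1 (by rw [symp_swap, h3, neg_zero])
  have hW : W ∈ ((lagr A ⊓ perp (cxPlane L)).comap (conjPhase n)) ⊔ cxPlane L ⊔ lagr A :=
    htop ▸ Submodule.mem_top
  obtain ⟨U, hU, B, hB, rfl⟩ := Submodule.mem_sup.1 hW
  obtain ⟨V, hV, X, hX, rfl⟩ := Submodule.mem_sup.1 hU
  exact ⟨conjPhase n V, hV, X, hX, B, hB, by rw [conjPhase_conjPhase]⟩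

/-- With no constraints $X=V^*+B$. Reality of $X$ makes $B-V$ a self-conjugate vector of a positive
isotropic plane, hence zero. -/
theorem exists_real_decomp (hA : A.IsSymm) (hP : (A.map Complex.im).PosDef) (X : Phase ℝ n) :
    ∃ Y ∈ lagr A, cx n X = Y + conjPhase n Y := by
  obtain ⟨V, hV, U, hU, B, hB, h⟩ := exists_decomp hA hP ⊥ (cx n X)
  have hU0 : U = 0 := by simpa [cxPlane] using hU
  rw [hU0, add_zero] at h
  have h2 := congrArg (conjPhase n) h
  rw [conjPhase_cx, map_add, conjPhase_conjPhase, h] at h2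
  have h3 : conjPhase n (B - V) = B - V := by
    rw [map_sub]
    linear_combination (exp := 1) -h2
  have h4 : B - V = 0 := eq_zero_of_symp_conj hA hP (sub_mem hB hV.1) (by
    rw [h3]; exact symp_lagr hA (sub_mem hB hV.1) (sub_mem hB hV.1))
  exact ⟨B, hB, by rw [h, ← sub_eq_zero.1 h4, add_comm]⟩

end Lagrangian

/-! ### Matrix elements of Gaussians; the class of a Gaussian is non-zero. -/

section Gaussian

open Matrix

variable {n : ℕ} {A : Matrix (Fin n) (Fin n) ℂ} {ψ : 𝓢(Conf n, ℂ)}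

theorem IsGaussian.fderiv_apply (h : IsGaussian A ψ) (ξ v : Conf n) :
    fderiv ℝ ψ ξ v =
      Complex.I * ((fun j => (v j : ℂ)) ⬝ᵥ A *ᵥ fun j => (ξ j : ℂ)) * ψ ξ := by
  obtain ⟨hA, -, c, -, hψ⟩ := h
  have h1 := (ψ.differentiableAt (x := ξ)).hasFDerivAt.hasLineDerivAt v
  have hq : ∀ η : Conf n, ∑ j, ∑ k, (η j : ℂ) * A j k * (η k : ℂ) =
      (fun j => (η j : ℂ)) ⬝ᵥ A *ᵥ fun j => (η j : ℂ) := fun η => by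
    simp only [dotProduct, mulVec, Finset.mul_sum, mul_assoc]
  have h2 : HasLineDerivAt ℝ ψ
      (Complex.I * ((fun j => (v j : ℂ)) ⬝ᵥ A *ᵥ fun j => (ξ j : ℂ)) * ψ ξ) ξ v := by
    -- On a line the exponent is a quadratic polynomial in $t$, the two cross terms agreeing because
    -- $A$ is symmetric.
    have e : ∀ t : ℝ, ψ (ξ + t • v) = c * Complex.exp (Complex.I / 2 *
        ((fun j => (ξ j : ℂ)) ⬝ᵥ A *ᵥ (fun j => (ξ j : ℂ)) +
          (t : ℂ) * (2 * ((fun j => (v j : ℂ)) ⬝ᵥ A *ᵥ fun j => (ξ j : ℂ))) +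
          (t : ℂ) ^ 2 * ((fun j => (v j : ℂ)) ⬝ᵥ A *ᵥ fun j => (v j : ℂ)))) := by
      intro t
      rw [hψ, hq]
      congr 4
      have : (fun j => ((ξ + t • v) j : ℂ)) = (fun j => (ξ j : ℂ)) + (t : ℂ) • fun j => (v j : ℂ) := by
        ext j; simp
      rw [this]
      simp only [mulVec_add, mulVec_smul, dotProduct_add, add_dotProduct, smul_dotProduct,
        dotProduct_smul, smul_eq_mul]
      rw [dotProduct_comm (fun j => (ξ j : ℂ)) (A *ᵥ fun j => (v j : ℂ)),
        mulVec_dotProduct_comm hA, dotProduct_comm (A *ᵥ fun j => (ξ j : ℂ))]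
      ring
    unfold HasLineDerivAt
    simp only [e]
    have hid : HasDerivAt (fun t : ℝ => (t : ℂ)) 1 0 := (hasDerivAt_id (0 : ℝ)).ofReal_comp
    have hpoly := (((hid.mul_const (2 * ((fun j => (v j : ℂ)) ⬝ᵥ A *ᵥ fun j => (ξ j : ℂ)))).const_add
      ((fun j => (ξ j : ℂ)) ⬝ᵥ A *ᵥ (fun j => (ξ j : ℂ)))).add ((hid.pow 2).mul_const
      ((fun j => (v j : ℂ)) ⬝ᵥ A *ᵥ fun j => (v j : ℂ))))
    refine ((hpoly.const_mul (Complex.I / 2)).cexp.const_mul c).congr_deriv ?_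
    rw [hψ ξ, hq]
    simp
    ring
  exact h1.unique h2

theorem IsGaussian.Om_apply (h : IsGaussian A ψ) (Y : Phase ℂ n) (ξ : Conf n) :
    Om n Y ψ ξ = ((Y.1 - A *ᵥ Y.2) ⬝ᵥ fun j => (ξ j : ℂ)) * ψ ξ := by
  have e : ∀ j : Fin n, (fun i => ((EuclideanSpace.single j (1 : ℝ) : Conf n) i : ℂ)) =
      Pi.single j 1 := fun j => by
    ext i
    rcases eq_or_ne i j with rfl | hij
    · simp
    · simp [hij]
  rw [ConstrainedQM.Om_apply, sub_dotProduct, mulVec_dotProduct_comm h.1]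
  simp only [h.fderiv_apply, e, single_one_dotProduct]
  rw [sub_mul, dotProduct, dotProduct, Finset.sum_mul, Finset.sum_mul, ← Finset.sum_sub_distrib]
  refine Finset.sum_congr rfl fun j _ => ?_
  ring_nf
  rw [Complex.I_sq]
  ring

theorem IsGaussian.Om_eq_zero (h : IsGaussian A ψ) {Y : Phase ℂ n} (hY : Y ∈ lagr A) :
    Om n Y ψ = 0 := by
  ext ξ
  rw [h.Om_apply, mem_lagr.1 hY]
  simp

theorem coef_add_right (f g g' : 𝓢(Conf n, ℂ)) (X : Phase ℝ n) :
    coef f (g + g') X = coef f g X + coef f g' X := by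
  have e : ∀ g, coef f g X = starRingEnd ℂ (coef g f (-X)) := fun g => by
    rw [conj_coef, neg_neg]
  rw [e, e g, e g', coef_add_left, map_add]

theorem coef_Om_left_complex (f g : 𝓢(Conf n, ℂ)) (X : Phase ℝ n) (Y : Phase ℂ n) :
    coef (Om n Y f) g X =
      coef f (Om n (conjPhase n Y) g) X - symp ℂ n (cx n X) (conjPhase n Y) * coef f g X := by
  have e : conjPhase n Y = cx n (fun j => (Y.1 j).re, fun j => (Y.2 j).re) +
      (-Complex.I) • cx n (fun j => (Y.1 j).im, fun j => (Y.2 j).im) := by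
    conv_lhs => rw [cx_re_im Y, map_add, map_smulₛₗ, conjPhase_cx, conjPhase_cx, Complex.conj_I]
  rw [e]
  conv_lhs => rw [cx_re_im Y]
  simp only [map_add, map_smul, LinearMap.add_apply, LinearMap.smul_apply, symp_cx]
  rw [coef_add_left, coef_smul_left, coef_add_right, coef_smul_right, coef_Om_left, coef_Om_left,
    Complex.conj_I, smul_eq_mul]
  ring

theorem IsGaussian.ne_zero (h : IsGaussian A ψ) (ξ : Conf n) : ψ ξ ≠ 0 := by
  obtain ⟨-, -, c, hc, hψ⟩ := h
  rw [hψ]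
  exact mul_ne_zero hc (Complex.exp_ne_zero _)

theorem IsGaussian.coef_zero_pos (h : IsGaussian A ψ) :
    ∃ r : ℝ, 0 < r ∧ coef ψ ψ 0 = (r : ℂ) := by
  have e : ∀ ξ, starRingEnd ℂ (ψ ξ) * weyl 0 ψ ξ = ((‖ψ ξ‖ ^ 2 : ℝ) : ℂ) := fun ξ => by
    rw [weyl_zero, mul_comm, Complex.mul_conj, Complex.normSq_eq_norm_sq]
  have hi : Integrable (fun ξ => ‖ψ ξ‖ ^ 2) := by
    have := (integrable_mul_weyl ψ ψ 0).norm
    simp only [e, Complex.norm_real, Real.norm_of_nonneg (sq_nonneg _)] at this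
    exact this
  refine ⟨∫ ξ, ‖ψ ξ‖ ^ 2, ?_, ?_⟩
  · rw [integral_pos_iff_support_of_nonneg (fun ξ => sq_nonneg _) hi]
    have : Function.support (fun ξ => ‖ψ ξ‖ ^ 2) = Set.univ := by
      ext ξ
      simp [h.ne_zero ξ]
    rw [this]
    exact isOpen_univ.measure_pos volume ⟨0, trivial⟩
  · rw [coef]
    simp_rw [e]
    exact integral_complex_ofReal

/-- Write $X=Y+Y^*$ with $\Omega(Y)\psi=0$. Then $f(t)=(\psi,e^{it\Omega(X)}\psi)$ solves
$f'=-c\,t\,f$ with $c=\frac1i\omega(Y,Y^*)$, so $f(1)=e^{-c/2}f(0)$, and $f(0)$ is the squared $L^2$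
norm. No Gaussian integral has to be evaluated. -/
theorem IsGaussian.coef_pos (h : IsGaussian A ψ) (X : Phase ℝ n) :
    ∃ r : ℝ, 0 < r ∧ coef ψ ψ X = (r : ℂ) := by
  obtain ⟨Y, hY, hX⟩ := exists_real_decomp h.1 h.2.1 X
  set c : ℝ := (symp ℂ n Y (conjPhase n Y)).im
  have hc : symp ℂ n Y (conjPhase n Y) = Complex.I * c := by
    apply Complex.ext
    · simp [symp_conjPhase_self_re]
    · simp [c]
  have hd : ∀ t : ℝ, HasDerivAt (fun s : ℝ => coef ψ ψ (s • X))
      (-(c * t : ℝ) * coef ψ ψ (t • X)) t := by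
    intro t
    have h1 := coef_hasDerivAt ψ ψ (t • X) X (by
      rw [map_smul, LinearMap.smul_apply]
      have := symp_swap X X
      rw [self_eq_neg.1 this, smul_zero])
    have h2 : HasDerivAt (fun s : ℝ => coef ψ ψ (s • X))
        (Complex.I * coef ψ (Om n (cx n X) ψ) (t • X)) t := by
      have h3 : HasDerivAt (fun s : ℝ => s - t) 1 t := (hasDerivAt_id t).sub_const t
      have h1' : HasDerivAt (fun s : ℝ => coef ψ ψ (t • X + s • X))
        (Complex.I * coef ψ (Om n (cx n X) ψ) (t • X)) (t - t) := by rwa [sub_self]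
      have h4 := HasDerivAt.scomp (h := fun s : ℝ => s - t) t h1' h3
      rw [one_smul] at h4
      refine h4.congr_of_eventuallyEq (Eventually.of_forall fun s => ?_)
      simp only [Function.comp_apply]
      rw [← add_smul, add_sub_cancel]
    refine h2.congr_deriv ?_
    -- Moving the vanishing $\Omega(Y)\psi$ from the left slot to the right replaces $\Omega(Y^*)$
    -- there by a scalar proportional to $t$.
    have h5 := coef_Om_left_complex ψ ψ (t • X) Y
    rw [h.Om_eq_zero hY] at h5
    have h6 : coef (0 : 𝓢(Conf n, ℂ)) ψ (t • X) = 0 := by simp [coef]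
    have h7 : symp ℂ n (conjPhase n Y) (conjPhase n Y) = 0 := self_eq_neg.1 (symp_swap _ _)
    rw [h6, map_smul, hX, ← Complex.coe_smul, map_smul, LinearMap.smul_apply, map_add,
      LinearMap.add_apply, h7, add_zero, hc] at h5
    rw [hX, map_add, LinearMap.add_apply, h.Om_eq_zero hY, zero_add,
      sub_eq_zero.1 h5.symm]
    simp only [smul_eq_mul]
    push_cast
    ring_nf
    rw [Complex.I_sq]
    ring
  have hconst : ∀ t : ℝ, HasDerivAt
      (fun s : ℝ => coef ψ ψ (s • X) * ((Real.exp (c * s ^ 2 / 2) : ℝ) : ℂ)) 0 t := by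
    intro t
    have h1 : HasDerivAt (fun s : ℝ => Real.exp (c * s ^ 2 / 2))
        (Real.exp (c * t ^ 2 / 2) * (c * t)) t := by
      have : HasDerivAt (fun s : ℝ => c * s ^ 2 / 2) (c * t) t := by
        refine (((hasDerivAt_pow 2 t).const_mul c).div_const 2).congr_deriv ?_
        simp
        ring
      exact this.exp
    refine ((hd t).mul h1.ofReal_comp).congr_deriv ?_
    push_cast
    ring
  have heq := is_const_of_deriv_eq_zero (fun t => (hconst t).differentiableAt)
    (fun t => (hconst t).deriv) 1 0
  simp only [one_smul, zero_smul] at heq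
  obtain ⟨r, hr, hr0⟩ := h.coef_zero_pos
  refine ⟨r * Real.exp (-(c / 2)), by positivity, ?_⟩
  rw [hr0] at heq
  have he : (Real.exp (c * 1 ^ 2 / 2) : ℂ) ≠ 0 := by exact_mod_cast (Real.exp_pos _).ne'
  apply mul_right_cancel₀ he
  rw [heq, ← Complex.ofReal_mul, ← Complex.ofReal_mul, mul_assoc, ← Real.exp_add]
  ring_nf

/-- The squared norm is the integral over the constraint plane of a function that is positive
everywhere. -/
theorem IsGaussian.cls_ne_zero (C : ConstraintPlane n) (h : IsGaussian A ψ) : cls C ψ ≠ 0 := by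
  intro h0
  have h1 : form C ψ ψ = 0 := by rw [← inner_cls, h0, inner_zero_left]
  choose r hr hc using h.coef_pos
  have hi := integrable_coef C.plane C.μ ψ ψ
  rw [form] at h1
  simp_rw [hc] at h1 hi
  rw [integral_complex_ofReal, Complex.ofReal_eq_zero] at h1
  have hi' : Integrable (fun X : C.plane => r X) C.μ := by simpa using hi.re
  have hpos : 0 < ∫ X : C.plane, r X ∂C.μ := by
    rw [integral_pos_iff_support_of_nonneg (fun X => (hr _).le) hi']
    have : Function.support (fun X : C.plane => r X) = Set.univ := by
      ext X
      simp [(hr (X : Phase ℝ n)).ne']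
    rw [this]
    exact isOpen_univ.measure_pos C.μ ⟨0, trivial⟩
  exact hpos.ne' h1

end Gaussian

/-! ### The reduced germ of a Gaussian -/

section Germ

variable {n : ℕ} {A : Matrix (Fin n) (Fin n) ℂ} {ψ : 𝓢(Conf n, ℂ)} (C : ConstraintPlane n)

theorem cxPlane_isotropic : cxPlane C.plane ≤ perp (cxPlane C.plane) :=
  cxPlane_le_perp C.isotropic

/-- The image of the plane `lagr A` in the complexified reduced phase space. -/
def redLagr (A : Matrix (Fin n) (Fin n) ℂ) : Submodule ℂ (Reduced (cxPlane C.plane)) :=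
  ((lagr A).comap (perp (cxPlane C.plane)).subtype).map
    ((cxPlane C.plane).submoduleOf (perp (cxPlane C.plane))).mkQ

variable {C} in
theorem redSymp_redLagr (hA : A.IsSymm) {X Y : Reduced (cxPlane C.plane)}
    (hX : X ∈ redLagr C A) (hY : Y ∈ redLagr C A) : redSymp (cxPlane C.plane) X Y = 0 := by
  obtain ⟨x, hx, rfl⟩ := hX
  obtain ⟨y, hy, rfl⟩ := hY
  exact symp_lagr hA hx hy

variable {C} in
theorem im_redSymp_pos (h : IsGaussian A ψ) {Y : Reduced (cxPlane C.plane)}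
    (hY : Y ∈ redLagr C A) (h0 : Y ≠ 0) :
    0 < (redSymp (cxPlane C.plane) Y (conjRed C.plane Y)).im := by
  obtain ⟨y, hy, rfl⟩ := hY
  refine im_symp_lagr_pos h.1 h.2.1 hy fun hy0 => h0 ?_
  rw [show y = 0 from Subtype.ext hy0, map_zero]

theorem exists_redLagr_decomp (h : IsGaussian A ψ) (Y : Reduced (cxPlane C.plane)) :
    ∃ V ∈ redLagr C A, ∃ B ∈ redLagr C A, Y = conjRed C.plane V + B := by
  obtain ⟨y, rfl⟩ := Submodule.Quotient.mk_surjective _ Y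
  obtain ⟨V, ⟨hV, hV'⟩, X, hX, B, hB, e⟩ := exists_decomp h.1 h.2.1 C.plane (y : Phase ℂ n)
  -- The annihilation part is automatically skew-orthogonal to the plane, being the difference of
  -- vectors that are.
  have hB' : B ∈ perp (cxPlane C.plane) := by
    have : B = y - conjPhase n V - X := by rw [e]; abel
    rw [this]
    exact sub_mem (sub_mem y.2 (conj_mem_perp hV')) (cxPlane_isotropic C hX)
  refine ⟨Submodule.Quotient.mk ⟨V, hV'⟩, ⟨⟨V, hV'⟩, hV, rfl⟩,
    Submodule.Quotient.mk ⟨B, hB'⟩, ⟨⟨B, hB'⟩, hB, rfl⟩, ?_⟩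
  rw [conjRed_mk, ← Submodule.Quotient.mk_add]
  refine (Submodule.Quotient.eq _).2 ?_
  change (y : Phase ℂ n) - (conjPhase n V + B) ∈ cxPlane C.plane
  have : (y : Phase ℂ n) - (conjPhase n V + B) = X := by rw [e]; abel
  rwa [this]

theorem redOm_cls_of_mem (h : IsGaussian A ψ) {Y : Reduced (cxPlane C.plane)}
    (hY : Y ∈ redLagr C A) : redOm C Y (cls C ψ) = 0 := by
  obtain ⟨y, hy, rfl⟩ := hY
  exact (congrArg (cls C) (h.Om_eq_zero hy)).trans rfl

/-- Of $Y=V^*+B$ only $V^*$ acts, and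
$\|\bar\Omega(V^*)[\psi]\|^2=\frac1i\omega(V,V^*)\|[\psi]\|^2$. Since $[\psi]\ne0$, this vanishes
only for $V=0$. Thus forming classes adds no annihilators beyond those already present for $\psi$
itself. -/
theorem redOm_cls_eq_zero_iff (h : IsGaussian A ψ) {Y : Reduced (cxPlane C.plane)} :
    redOm C Y (cls C ψ) = 0 ↔ Y ∈ redLagr C A := by
  refine ⟨fun h0 => ?_, redOm_cls_of_mem C h⟩
  obtain ⟨V, hV, B, hB, rfl⟩ := exists_redLagr_decomp C h Y
  rw [map_add, LinearMap.add_apply, redOm_cls_of_mem C h hB, add_zero] at h0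
  have h1 := norm_sq_redOm_conj C V (cls C ψ)
  rw [h0, redOm_cls_of_mem C h hV, norm_zero] at h1
  have h2 : ((‖cls C ψ‖ ^ 2 : ℝ) : ℂ) ≠ 0 := by
    simpa using h.cls_ne_zero C
  have h3 : redSymp (cxPlane C.plane) V (conjRed C.plane V) = 0 := by
    have h4 := h1.symm
    simp only [ne_eq, OfNat.ofNat_ne_zero, not_false_eq_true, zero_pow, Complex.ofReal_zero,
      zero_add] at h4
    simpa using (mul_eq_zero.1 h4).resolve_right h2
  have h5 : V = 0 := by
    by_contra hne
    have := im_redSymp_pos h hV hne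
    rw [h3] at this
    exact lt_irrefl _ this
  rw [h5, map_zero, zero_add]
  exact hB

theorem mem_hGerm_iff (y : perp (cxPlane C.plane)) :
    (y : Phase ℂ n) ∈ hGerm C ψ ↔ redOm C (Submodule.Quotient.mk y) (cls C ψ) = 0 := by
  rw [redOm_mk_cls, cls_eq_zero_iff]
  exact ⟨fun h => h.2, fun h => ⟨y.2, h⟩⟩

/-- A common vector $Y$ has both $Y$ and $Y^*$ in an isotropic plane, against positivity; spanning
is the decomposition into creation and annihilation parts. -/
theorem isCompl_redLagr (h : IsGaussian A ψ) :
    IsCompl (redLagr C A) ((redLagr C A).comap (conjRed C.plane)) := by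
  constructor
  · rw [Submodule.disjoint_def]
    intro Y hY hY'
    by_contra h0
    have := im_redSymp_pos h hY h0
    rw [redSymp_redLagr h.1 hY hY'] at this
    exact lt_irrefl _ this
  · rw [codisjoint_iff, eq_top_iff]
    rintro Y -
    obtain ⟨V, hV, B, hB, rfl⟩ := exists_redLagr_decomp C h Y
    rw [add_comm]
    exact Submodule.add_mem_sup hB (by rw [Submodule.mem_comap, conjRed_conjRed]; exact hV)

end Germ

/-! ### Stability -/

/-- The constant is the minimum of the quadratic form on the compact unit sphere. -/
theorem exists_pos_mul_sq_le {V : Type*} [NormedAddCommGroup V] [NormedSpace ℝ V]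
    [FiniteDimensional ℝ V] (B : V →L[ℝ] V →L[ℝ] ℝ) (hB : ∀ X, X ≠ 0 → 0 < B X X) :
    ∃ c > 0, ∀ X, c * ‖X‖ ^ 2 ≤ B X X := by
  rcases subsingleton_or_nontrivial V with hV | hV
  · exact ⟨1, one_pos, fun X => by rw [Subsingleton.elim X 0]; simp⟩
  have hc : Continuous fun X => B X X := by fun_prop
  obtain ⟨X₀, hX₀, hmin⟩ := (isCompact_sphere (0 : V) 1).exists_isMinOn
    (NormedSpace.sphere_nonempty.2 zero_le_one) hc.continuousOn
  have hX₀' : X₀ ≠ 0 := by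
    rintro rfl
    simp at hX₀
  refine ⟨B X₀ X₀, hB _ hX₀', fun X => ?_⟩
  rcases eq_or_ne X 0 with rfl | hX
  · simp
  have hn : 0 < ‖X‖ := norm_pos_iff.2 hX
  have h1 : B X₀ X₀ ≤ B (‖X‖⁻¹ • X) (‖X‖⁻¹ • X) :=
    hmin (by simp [norm_smul, hn.ne'])
  simp only [map_smul, smul_apply, smul_eq_mul] at h1
  calc B X₀ X₀ * ‖X‖ ^ 2 ≤ (‖X‖⁻¹ * (‖X‖⁻¹ * B X X)) * ‖X‖ ^ 2 := by gcongr
    _ = B X X := by field_simp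

/-- $B(X,X)$ is conserved along solutions and comparable to the squared norm, so its sublevel sets
are the trapping neighbourhoods. -/
theorem isStable_of_invariant_form {V : Type} [NormedAddCommGroup V] [NormedSpace ℝ V]
    [FiniteDimensional ℝ V] (T : V →ₗ[ℝ] V) (B : V →ₗ[ℝ] V →ₗ[ℝ] ℝ) (hB : ∀ X, X ≠ 0 → 0 < B X X)
    (hT : ∀ X, B (T X) X + B X (T X) = 0) : IsStable T := by
  let B' : V →L[ℝ] V →L[ℝ] ℝ := LinearMap.toContinuousLinearMap
    ((LinearMap.toContinuousLinearMap : (V →ₗ[ℝ] ℝ) ≃ₗ[ℝ] (V →L[ℝ] ℝ)).toLinearMap.comp B)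
  have hB' : ∀ X Y, B' X Y = B X Y := fun _ _ => rfl
  obtain ⟨c, hc, hle⟩ := exists_pos_mul_sq_le B' fun X hX => hB X hX
  intro U hU
  obtain ⟨ε, hε, hball⟩ := Metric.mem_nhds_iff.1 hU
  refine ⟨{X | B' X X < c * ε ^ 2}, ?_, fun Y hY h0 t _ => hball ?_⟩
  · have hcont : Continuous fun X => B' X X := by fun_prop
    refine (isOpen_lt hcont continuous_const).mem_nhds ?_
    change B' 0 0 < _
    rw [map_zero]
    simpa using by positivity
  · have hd : ∀ s, HasDerivAt (fun s => B' (Y s) (Y s)) 0 s := by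
      intro s
      have h1 : HasDerivAt (fun s => B' (Y s)) (B' (T (Y s))) s :=
        B'.hasFDerivAt.comp_hasDerivAt s (hY s)
      refine (h1.clm_apply (hY s)).congr_deriv ?_
      exact hT (Y s)
    have hconst := is_const_of_deriv_eq_zero (fun s => (hd s).differentiableAt)
      (fun s => (hd s).deriv) t 0
    rw [mem_ball_zero_iff]
    have h2 := hle (Y t)
    rw [hconst] at h2
    have h3 : c * ‖Y t‖ ^ 2 < c * ε ^ 2 := h2.trans_lt h0
    exact lt_of_pow_lt_pow_left₀ 2 hε.le (lt_of_mul_lt_mul_left h3 hc.le)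

/-- Closedness makes the quotient seminorm a norm; the same holds for the complex quotient below. -/
instance {n : ℕ} (L : Submodule ℝ (Phase ℝ n)) :
    IsClosed ((L.submoduleOf (perp L) : Submodule ℝ (perp L)) : Set (perp L)) :=
  Submodule.closed_of_finiteDimensional _

instance {n : ℕ} (L : Submodule ℂ (Phase ℂ n)) :
    IsClosed ((L.submoduleOf (perp L) : Submodule ℂ (perp L)) : Set (perp L)) :=
  Submodule.closed_of_finiteDimensional _

section

variable {n : ℕ} {A : Matrix (Fin n) (Fin n) ℂ} {ψ : 𝓢(Conf n, ℂ)} (C : ConstraintPlane n)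

/-- Applying the ladder relation to an eigenvector killed by $\bar\Omega(Y)$ leaves only
$i\,\bar\Omega(Y\circ\bar\Gamma)[\psi]=0$. -/
theorem cxFlow_mem_redLagr (h : IsGaussian A ψ) {Γ : Reduced C.plane ⊗[ℝ] Reduced C.plane}
    (hΓ : TensorProduct.comm ℝ _ _ Γ = Γ) {lam : ℂ}
    (he : (redOm2 C Γ).HasEigenvector lam (cls C ψ)) {Y : Reduced (cxPlane C.plane)}
    (hY : Y ∈ redLagr C A) : cxFlow C.plane Γ Y ∈ redLagr C A := by
  rw [← redOm_cls_eq_zero_iff C h] at hY ⊢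
  have h1 := redOm2_commutator C hΓ Y (cls C ψ)
  rw [he.apply_eq_smul, map_smul, hY, map_zero, smul_zero, zero_add] at h1
  exact (smul_eq_zero.1 h1.symm).resolve_left Complex.I_ne_zero

/-- The Hermitian form of the annihilation part, on the real reduced phase space. -/
def energyForm (h : IsGaussian A ψ) : Reduced C.plane →ₗ[ℝ] Reduced C.plane →ₗ[ℝ] ℝ :=
  LinearMap.mk₂ ℝ (fun X Y => (redSymp (cxPlane C.plane)
      (Submodule.projection _ _ (isCompl_redLagr C h) (cxRed C.plane X))
      (conjRed C.plane (Submodule.projection _ _ (isCompl_redLagr C h) (cxRed C.plane Y)))).im)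
    (fun X X' Y => by simp only [map_add, LinearMap.add_apply, Complex.add_im])
    (fun c X Y => by
      rw [map_smul, ← Complex.coe_smul, map_smul, map_smul, LinearMap.smul_apply, smul_eq_mul,
        Complex.im_ofReal_mul, smul_eq_mul])
    (fun X Y Y' => by simp only [map_add, Complex.add_im])
    (fun c X Y => by
      rw [map_smul, ← Complex.coe_smul, map_smul, map_smulₛₗ, map_smul, smul_eq_mul,
        Complex.conj_ofReal, Complex.im_ofReal_mul, smul_eq_mul])

/-- The annihilator plane is invariant, and so is its conjugate since the flow is real. The
projection therefore commutes with the flow, and skewness of the flow makes `energyForm` a conserved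
positive form. -/
theorem reducedStable_of_eigenvector (h : IsGaussian A ψ)
    {Γ : Reduced C.plane ⊗[ℝ] Reduced C.plane}
    (hΓ : TensorProduct.comm ℝ _ _ Γ = Γ) {lam : ℂ}
    (he : (redOm2 C Γ).HasEigenvector lam (cls C ψ)) : ReducedStable C Γ := by
  have hc := isCompl_redLagr C h
  have hinv : ∀ Y ∈ redLagr C A, cxFlow C.plane Γ Y ∈ redLagr C A :=
    fun Y hY => cxFlow_mem_redLagr C h hΓ he hY
  have hcomm : ∀ Y, Submodule.projection _ _ hc (cxFlow C.plane Γ Y) = cxFlow C.plane Γ (Submodule.projection _ _ hc Y) := by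
    intro Y
    obtain ⟨V, hV, B, hB, rfl⟩ := exists_redLagr_decomp C h Y
    have h1 : ∀ V ∈ redLagr C A, Submodule.projection _ _ hc (conjRed C.plane V) = 0 := fun V hV =>
      (Submodule.projection_apply_eq_zero_iff hc).2 (by rwa [Submodule.mem_comap, conjRed_conjRed])
    have h2 : ∀ B ∈ redLagr C A, Submodule.projection _ _ hc B = B := fun B hB =>
      Submodule.projection_apply_left hc ⟨B, hB⟩
    simp only [map_add, cxFlow_conjRed]
    rw [h1 _ hV, h1 _ (hinv V hV), h2 _ hB, h2 _ (hinv B hB), map_zero]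
  refine isStable_of_invariant_form (V := Reduced C.plane) (circ (redSymp C.plane) Γ) 
    (energyForm C h) ?_ ?_
  · intro X hX
    refine im_redSymp_pos h (Submodule.projection_apply_mem hc _) fun h0 => hX ?_
    -- A real vector with zero projection lies in the conjugate plane, hence by reality in both
    -- summands, hence is zero.
    rw [Submodule.projection_apply_eq_zero_iff hc, Submodule.mem_comap, conjRed_cxRed] at h0
    have h1 : cxRed C.plane X = 0 := by
      refine (Submodule.disjoint_def.1 hc.disjoint) _ h0 ?_
      rwa [Submodule.mem_comap, conjRed_cxRed]
    have h2 := reRed_smul_cxRed C.plane 1 X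
    rw [h1] at h2
    simpa using h2.symm
  · intro X
    simp only [energyForm, LinearMap.mk₂_apply, ← cxFlow_cxRed, hcomm]
    rw [← Complex.add_im, cxFlow_skew _ hΓ, ← cxFlow_conjRed]
    simp

end

/-! ### Normal modes of a stable system -/

section AbstractModes

variable {W : Type} [AddCommGroup W] [Module ℂ W]

/-- Over $\mathbb C$ the generalized eigenspaces span; without Jordan chains of length two each of
them is an eigenspace. -/
theorem iSup_eigenspace_eq_top_of_jordan [FiniteDimensional ℂ W] (T : Module.End ℂ W)
    (hss : ∀ (l : ℂ) (v w : W), T v = l • v → T w = l • w + v → v = 0) :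
    ⨆ l, T.genEigenspace l 1 = ⊤ := by
  rw [eq_top_iff, ← Module.End.iSup_maxGenEigenspace_eq_top T]
  refine iSup_mono fun l w hw => ?_
  obtain ⟨k, hk⟩ := Module.End.mem_maxGenEigenspace T l w |>.1 hw
  -- The exponent is $k+1$ because the exponent supplied by the generalized eigenspace may be $0$.
  have key : ∀ (k : ℕ) (w : W), ((T - l • (1 : Module.End ℂ W)) ^ (k + 1)) w = 0 →
      (T - l • (1 : Module.End ℂ W)) w = 0 := by
    intro k
    induction k with
    | zero => intro w hw; simpa using hw
    | succ k ih =>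
      intro w hw
      rw [pow_succ, Module.End.mul_apply] at hw
      exact hss l _ w (by simpa [sub_eq_zero] using ih _ hw) (by simp)
  have h1 := key k w (by rw [pow_succ', Module.End.mul_apply, hk, map_zero])
  change w ∈ T.eigenspace l
  rw [Module.End.mem_eigenspace_iff]
  simpa [sub_eq_zero] using h1

variable {ω : W →ₗ[ℂ] W →ₗ[ℂ] ℂ} {σ : W →ₛₗ[starRingEnd ℂ] W} {T : Module.End ℂ W}

/-- A normalized family of eigenvectors of `T` for a symplectic form `ω` and a conjugation `σ`. -/
structure IsModeFamily (ω : W →ₗ[ℂ] W →ₗ[ℂ] ℂ) (σ : W →ₛₗ[starRingEnd ℂ] W)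
    (T : Module.End ℂ W) {d : ℕ} (β : Fin d → ℝ) (Y : Fin d → W) : Prop where
  eigen : ∀ I, T (Y I) = (Complex.I * β I) • Y I
  normalized : ∀ I J, 1 / Complex.I * ω (Y I) (σ (Y J)) = if I = J then 1 else 0
  isotropic : ∀ I J, ω (Y I) (Y J) = 0

theorem IsModeFamily.symp_conj {d : ℕ} {β : Fin d → ℝ} {Y : Fin d → W}
    (h : IsModeFamily ω σ T β Y) (I J : Fin d) :
    ω (Y I) (σ (Y J)) = Complex.I * if I = J then 1 else 0 := by
  rw [← h.normalized I J]
  field_simp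

theorem IsModeFamily.conj_symp {d : ℕ} {β : Fin d → ℝ} {Y : Fin d → W}
    (h : IsModeFamily ω σ T β Y) (hω : ∀ X Y, ω X Y = -ω Y X) (I J : Fin d) :
    ω (σ (Y I)) (Y J) = -(Complex.I * if I = J then 1 else 0) := by
  rw [hω, h.symp_conj]
  simp only [eq_comm]

theorem IsModeFamily.conj_isotropic {d : ℕ} {β : Fin d → ℝ} {Y : Fin d → W}
    (h : IsModeFamily ω σ T β Y) (hωσ : ∀ X Y, ω (σ X) (σ Y) = starRingEnd ℂ (ω X Y))
    (I J : Fin d) : ω (σ (Y I)) (σ (Y J)) = 0 := by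
  rw [hωσ, h.isotropic, map_zero]

theorem IsModeFamily.linearIndependent {d : ℕ} {β : Fin d → ℝ} {Y : Fin d → W}
    (h : IsModeFamily ω σ T β Y) (hω : ∀ X Y, ω X Y = -ω Y X)
    (hωσ : ∀ X Y, ω (σ X) (σ Y) = starRingEnd ℂ (ω X Y)) :
    LinearIndependent ℂ (Sum.elim Y (fun I => σ (Y I))) := by
  rw [Fintype.linearIndependent_iff]
  intro g hg
  simp only [Fintype.sum_sum_type, Sum.elim_inl, Sum.elim_inr] at hg
  have h1 : ∀ Z, ∑ I, g (Sum.inl I) * ω (Y I) Z + ∑ I, g (Sum.inr I) * ω (σ (Y I)) Z = 0 := by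
    intro Z
    have := congrArg (fun w => ω w Z) hg
    simpa [map_add, map_sum, LinearMap.add_apply, LinearMap.sum_apply] using this
  rintro (J | J)
  · have := h1 (σ (Y J))
    simpa [h.symp_conj, h.conj_isotropic hωσ, Complex.I_ne_zero] using this
  · have := h1 (Y J)
    simpa [h.conj_symp hω, h.isotropic, Complex.I_ne_zero] using this

/-- Work in the skew-orthogonal complement of the modes already found and their conjugates: it is
non-zero by dimension count and invariant under `T` and `σ`. The Hermitian form
$\frac1i\omega(u,\sigma u)$ cannot vanish on an eigenspace there, by nondegeneracy, so some
eigenvector can be normalized, after conjugation if the sign is negative. -/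
theorem exists_mode_extension [FiniteDimensional ℂ W] (hω : ∀ X Y, ω X Y = -ω Y X)
    (hnd : ∀ Y, (∀ X, ω X Y = 0) → Y = 0) (hσ : ∀ Y, σ (σ Y) = Y)
    (hωσ : ∀ X Y, ω (σ X) (σ Y) = starRingEnd ℂ (ω X Y)) (hT : ∀ Y, T (σ Y) = σ (T Y))
    (hskew : ∀ X Y, ω (T X) Y = -ω X (T Y))
    (himag : ∀ (l : ℂ) (v : W), T v = l • v → v ≠ 0 → l.re = 0)
    (htop : ⨆ l, T.genEigenspace l 1 = ⊤)
    {d : ℕ} {β : Fin d → ℝ} {Y : Fin d → W} (h : IsModeFamily ω σ T β Y)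
    (hd : 2 * d < finrank ℂ W) :
    ∃ (b : ℝ) (y : W), T y = (Complex.I * b) • y ∧ 1 / Complex.I * ω y (σ y) = 1 ∧
      ∀ I, ω (Y I) y = 0 ∧ ω (Y I) (σ y) = 0 := by
  let Φ : W →ₗ[ℂ] (Fin d → ℂ) × (Fin d → ℂ) :=
    (LinearMap.pi fun I => ω (Y I)).prod (LinearMap.pi fun I => ω (σ (Y I)))
  have hΦ : ∀ Z, Z ∈ LinearMap.ker Φ ↔ ∀ I, ω (Y I) Z = 0 ∧ ω (σ (Y I)) Z = 0 := by
    intro Z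
    rw [LinearMap.mem_ker]
    exact ⟨fun h I => ⟨congrFun (congrArg Prod.fst h) I, congrFun (congrArg Prod.snd h) I⟩,
      fun h => Prod.ext (funext fun I => (h I).1) (funext fun I => (h I).2)⟩
  have hTσ : ∀ I, T (σ (Y I)) = -(Complex.I * β I) • σ (Y I) := fun I => by
    rw [hT, h.eigen, map_smulₛₗ]
    simp
  have hinv : ∀ Z ∈ LinearMap.ker Φ, T Z ∈ LinearMap.ker Φ := by
    intro Z hZ
    rw [hΦ] at hZ ⊢
    refine fun I => ⟨?_, ?_⟩
    · rw [← neg_eq_zero, ← hskew, h.eigen, map_smul, LinearMap.smul_apply, (hZ I).1, smul_zero]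
    · rw [← neg_eq_zero, ← hskew, hTσ, map_smul, LinearMap.smul_apply, (hZ I).2, smul_zero]
  have hσinv : ∀ Z ∈ LinearMap.ker Φ, σ Z ∈ LinearMap.ker Φ := by
    intro Z hZ
    rw [hΦ] at hZ ⊢
    refine fun I => ⟨?_, ?_⟩
    · rw [← hσ (Y I), hωσ, (hZ I).2, map_zero]
    · rw [hωσ, (hZ I).1, map_zero]
  have hne : LinearMap.ker Φ ≠ ⊥ := by
    refine LinearMap.ker_ne_bot_of_finrank_lt ?_
    simp only [finrank_prod, finrank_fintype_fun_eq_card, Fintype.card_fin]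
    omega
  have hsum := Submodule.eq_iSup_inf_genEigenspace 1 hinv htop
  obtain ⟨l, hl⟩ : ∃ l, LinearMap.ker Φ ⊓ T.genEigenspace l 1 ≠ ⊥ := by
    by_contra! hcon
    exact hne (by rw [hsum]; simp [hcon])
  obtain ⟨v, ⟨hvΦ, hvl⟩, hv0⟩ := Submodule.exists_mem_ne_zero_of_ne_bot hl
  have hvl' : ∀ {l : ℂ} {v : W}, v ∈ T.genEigenspace l 1 → T v = l • v := fun hv =>
    Module.End.mem_eigenspace_iff.1 hv
  have hlre := himag l v (hvl' hvl) hv0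
  obtain ⟨u, ⟨huΦ, hul⟩, hu⟩ : ∃ u ∈ LinearMap.ker Φ ⊓ T.genEigenspace l 1, ω u (σ u) ≠ 0 := by
    by_contra! hcon
    apply hv0
    -- Polarization with $v+w$ and $v+iw$.
    have h1 : ∀ w ∈ LinearMap.ker Φ ⊓ T.genEigenspace l 1, ω v (σ w) = 0 := by
      intro w hw
      have hv : v ∈ LinearMap.ker Φ ⊓ T.genEigenspace l 1 := ⟨hvΦ, hvl⟩
      have e1 := hcon _ (add_mem hv hw)
      have e2 := hcon _ (add_mem hv (Submodule.smul_mem _ Complex.I hw))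
      simp only [map_add, map_smulₛₗ, LinearMap.add_apply, LinearMap.smul_apply, smul_eq_mul,
        hcon v hv, hcon w hw, Complex.conj_I, RingHom.id_apply] at e1 e2
      linear_combination (1 / 2) * e1 + Complex.I / 2 * e2 +
        (1 / 2 * ω v (σ w) - 1 / 2 * ω w (σ v)) * Complex.I_sq
    have h2 : ∀ w ∈ LinearMap.ker Φ, ω v (σ w) = 0 := by
      intro w hw
      rw [hsum] at hw
      induction hw using Submodule.iSup_induction' with
      | zero => simp
      | add x y _ _ hx hy => rw [map_add, map_add, hx, hy, add_zero]
      | mem m w hw =>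
        by_cases hml : m = l
        · rw [hml] at hw
          exact h1 w hw
        by_cases hw0 : w = 0
        · simp [hw0]
        have hm := himag m w (hvl' hw.2) hw0
        have e := hskew v (σ w)
        rw [hvl' hvl, hT, hvl' hw.2] at e
        simp only [map_smulₛₗ, LinearMap.smul_apply, smul_eq_mul, RingHom.id_apply] at e
        -- Because eigenvalues are imaginary, `σ` negates $m$ twice over, and distinct eigenspaces
        -- are orthogonal for $\omega(\cdot,\sigma\,\cdot)$.
        have hconj : starRingEnd ℂ m = -m := by
          apply Complex.ext <;> simp [hm]
        rw [hconj] at e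
        have : (l - m) * ω v (σ w) = 0 := by linear_combination e
        exact (mul_eq_zero.1 this).resolve_left (sub_ne_zero.2 (Ne.symm hml))
    have h3 : ∀ w ∈ LinearMap.ker Φ, ω v w = 0 := fun w hw => by
      have := h2 _ (hσinv w hw)
      rwa [hσ] at this
    refine hnd v fun X => ?_
    have hv := (hΦ v).1 hvΦ
    -- The projection of $X$ to the complement: its components along the modes and their conjugates
    -- are removed, and $v$ is orthogonal to these anyway.
    let X' := X - ∑ I, (1 / Complex.I * ω X (σ (Y I))) • Y I +
      ∑ I, (1 / Complex.I * ω X (Y I)) • σ (Y I)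
    have hX' : X' ∈ LinearMap.ker Φ := by
      rw [hΦ]
      intro J
      simp only [X', map_add, map_sub, map_sum, map_smul, smul_eq_mul, h.symp_conj, h.isotropic,
        h.conj_symp hω, h.conj_isotropic hωσ]
      rw [hω (Y J) X, hω (σ (Y J)) X]
      constructor
      · simp
        linear_combination (-ω X (Y J)) * Complex.I_sq
      · simp
        linear_combination (-ω X (σ (Y J))) * Complex.I_sq
    have h4 := h3 X' hX'
    have h5 : ∀ I, ω v (Y I) = 0 ∧ ω v (σ (Y I)) = 0 := fun I => by
      rw [hω, (hv I).1, hω v, (hv I).2]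
      simp
    simp only [X', map_add, map_sub, map_sum, map_smul, h5, smul_zero, Finset.sum_const_zero,
      sub_zero, add_zero] at h4
    rw [hω, h4, neg_zero]
  have hure : (ω u (σ u)).re = 0 := by
    have e := hωσ u (σ u)
    rw [hσ, hω] at e
    have := congrArg Complex.re e
    simp only [Complex.neg_re, Complex.conj_re] at this
    linarith
  have huim : (ω u (σ u)).im ≠ 0 := fun h0 => hu (Complex.ext hure h0)
  have hTu : T u = (Complex.I * l.im) • u := by
    rw [hvl' hul]
    congr 1
    apply Complex.ext <;> simp [hlre]
  -- Rescaling by $s^{-1/2}$ normalizes a vector with $\omega(u,\sigma u)=is$, $s>0$.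
  have scale : ∀ (b : ℝ) (u : W), u ∈ LinearMap.ker Φ → T u = (Complex.I * b) • u →
      (ω u (σ u)).re = 0 → 0 < (ω u (σ u)).im →
      ∃ (b : ℝ) (y : W), T y = (Complex.I * b) • y ∧ 1 / Complex.I * ω y (σ y) = 1 ∧
        ∀ I, ω (Y I) y = 0 ∧ ω (Y I) (σ y) = 0 := by
    intro b u hu hTu hre him
    set s := (ω u (σ u)).im
    have hs : ω u (σ u) = Complex.I * s := by
      apply Complex.ext <;> simp [hre, s]
    have hy : ((Real.sqrt s)⁻¹ : ℂ) • u ∈ LinearMap.ker Φ := Submodule.smul_mem _ _ hu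
    refine ⟨b, ((Real.sqrt s)⁻¹ : ℂ) • u, ?_, ?_, fun I => ⟨((hΦ _).1 hy I).1,
      ((hΦ _).1 (hσinv _ hy) I).1⟩⟩
    · rw [map_smul, hTu, smul_comm]
    · have h1 : ((Real.sqrt s : ℝ) : ℂ) * ((Real.sqrt s : ℝ) : ℂ) = s := by
        rw [← Complex.ofReal_mul, Real.mul_self_sqrt him.le]
      have h2 : ((Real.sqrt s : ℝ) : ℂ) ≠ 0 := by
        exact_mod_cast (Real.sqrt_pos.2 him).ne'
      simp only [map_smulₛₗ, LinearMap.smul_apply, smul_eq_mul, RingHom.id_apply, map_inv₀,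
        Complex.conj_ofReal, hs, ← h1]
      field_simp
  rcases lt_or_gt_of_ne huim with hneg | hpos
  -- Negative sign: the conjugate vector has the opposite sign and the opposite frequency.
  · refine scale (-l.im) (σ u) (hσinv u huΦ) ?_ ?_ ?_
    · rw [hT, hTu, map_smulₛₗ]
      simp
    · rw [hσ, hω, Complex.neg_re, hure, neg_zero]
    · rw [hσ, hω, Complex.neg_im]
      linarith
  · exact scale l.im u huΦ hTu hure hpos

theorem exists_modeFamily [FiniteDimensional ℂ W] (hω : ∀ X Y, ω X Y = -ω Y X)
    (hnd : ∀ Y, (∀ X, ω X Y = 0) → Y = 0) (hσ : ∀ Y, σ (σ Y) = Y)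
    (hωσ : ∀ X Y, ω (σ X) (σ Y) = starRingEnd ℂ (ω X Y)) (hT : ∀ Y, T (σ Y) = σ (T Y))
    (hskew : ∀ X Y, ω (T X) Y = -ω X (T Y))
    (himag : ∀ (l : ℂ) (v : W), T v = l • v → v ≠ 0 → l.re = 0)
    (htop : ⨆ l, T.genEigenspace l 1 = ⊤) (d : ℕ) (hd : 2 * d ≤ finrank ℂ W) :
    ∃ (β : Fin d → ℝ) (Y : Fin d → W), IsModeFamily ω σ T β Y := by
  induction d with
  | zero => exact ⟨Fin.elim0, Fin.elim0, ⟨fun I => I.elim0, fun I => I.elim0, fun I => I.elim0⟩⟩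
  | succ d ih =>
    obtain ⟨β, Y, h⟩ := ih (by omega)
    obtain ⟨b, y, hTy, hn, ho⟩ := exists_mode_extension hω hnd hσ hωσ hT hskew himag htop h
      (by omega)
    have ho' : ∀ I, ω y (σ (Y I)) = 0 := fun I => by
      rw [← hσ y, hωσ, hω, (ho I).2]
      simp
    refine ⟨Fin.cons b β, Fin.cons y Y, ⟨?_, ?_, ?_⟩⟩
    · refine Fin.cases ?_ fun I => ?_
      · simpa using hTy
      · simpa using h.eigen I
    · refine Fin.cases ?_ fun I => ?_
      · refine Fin.cases ?_ fun J => ?_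
        · simpa using hn
        · simp [ho', (Fin.succ_ne_zero J).symm]
      · refine Fin.cases ?_ fun J => ?_
        · simp [(ho I).2]
        · simpa using h.normalized I J
    · refine Fin.cases ?_ fun I => ?_
      · refine Fin.cases ?_ fun J => ?_
        · simpa using self_eq_neg.1 (hω y y)
        · simp only [Fin.cons_zero, Fin.cons_succ]
          rw [hω, (ho J).1, neg_zero]
      · refine Fin.cases ?_ fun J => ?_
        · simpa using (ho I).1
        · simpa using h.isotropic I J

end AbstractModes

/-! ### From stability to imaginary, semisimple spectrum and normal modes. -/

section StableModes

/-- By linearity a solution can be scaled until it starts in the neighbourhood that stability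
assigns to the unit ball. -/
theorem IsStable.exists_bound {V : Type} [NormedAddCommGroup V] [NormedSpace ℝ V]
    {T : V →ₗ[ℝ] V} (hT : IsStable T) {Y : ℝ → V} (hY : IsSolution T Y) :
    ∃ M, ∀ t, 0 ≤ t → ‖Y t‖ ≤ M := by
  obtain ⟨W, hW, h⟩ := hT (Metric.ball 0 1) (Metric.ball_mem_nhds 0 one_pos)
  have hc : Tendsto (fun ε : ℝ => ε • Y 0) (𝓝[>] 0) (𝓝 0) := by
    have : Continuous fun ε : ℝ => ε • Y 0 := by fun_prop
    have h0 := this.tendsto 0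
    rw [zero_smul] at h0
    exact h0.mono_left nhdsWithin_le_nhds
  obtain ⟨ε, hε, hpos⟩ := ((hc.eventually hW).and self_mem_nhdsWithin).exists
  have hpos : 0 < ε := hpos
  refine ⟨ε⁻¹, fun t ht => ?_⟩
  have h1 := h (fun s => ε • Y s) (fun s => by
    rw [map_smul]
    exact (hY s).const_smul ε) hε t ht
  rw [mem_ball_zero_iff, norm_smul, Real.norm_of_nonneg hpos.le] at h1
  rw [← one_div, le_div_iff₀ hpos]
  linarith

section Abstract

variable {W : Type} [NormedAddCommGroup W] [NormedSpace ℂ W] [NormedSpace ℝ W]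
  [IsScalarTower ℝ ℂ W] {T : W →ₗ[ℂ] W}

/-- `R` and `S` play the parts of real part and inclusion: the real parts of $c$ and of $-ic$ are
solutions of the real system, and together they recover $c$. -/
theorem IsStable.exists_bound_complex {V : Type} [NormedAddCommGroup V] [NormedSpace ℝ V]
    [FiniteDimensional ℝ V] [FiniteDimensional ℝ W] {T₀ : V →ₗ[ℝ] V} (h : IsStable T₀)
    (R : W →ₗ[ℝ] V) (S : V →ₗ[ℝ] W) (hR : ∀ w, R (T w) = T₀ (R w))
    (hS : ∀ w, w = S (R w) + Complex.I • S (R (-Complex.I • w))) {c : ℝ → W}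
    (hc : IsSolution T c) : ∃ M, ∀ t, 0 ≤ t → ‖c t‖ ≤ M := by
  let R' : W →L[ℝ] V := LinearMap.toContinuousLinearMap R
  let S' : V →L[ℝ] W := LinearMap.toContinuousLinearMap S
  have key : ∀ c : ℝ → W, IsSolution T c → ∃ M, ∀ t, 0 ≤ t → ‖R (c t)‖ ≤ M := by
    intro c hc
    refine IsStable.exists_bound h (Y := fun t => R (c t)) fun t => ?_
    have h1 : HasDerivAt (fun t => R' (c t)) (R' (T (c t))) t :=
      R'.hasFDerivAt.comp_hasDerivAt t (hc t)
    exact h1.congr_deriv (hR (c t))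
  obtain ⟨M₁, h₁⟩ := key c hc
  obtain ⟨M₂, h₂⟩ := key (fun t => -Complex.I • c t) fun t => by
    rw [map_smul]
    exact (hc t).const_smul _
  refine ⟨‖S'‖ * M₁ + ‖S'‖ * M₂, fun t ht => ?_⟩
  rw [hS (c t)]
  refine (norm_add_le _ _).trans (add_le_add ?_ ?_)
  · exact (S'.le_opNorm _).trans (mul_le_mul_of_nonneg_left (h₁ t ht) (norm_nonneg _))
  · rw [norm_smul, Complex.norm_I, one_mul]
    exact (S'.le_opNorm _).trans (mul_le_mul_of_nonneg_left (h₂ t ht) (norm_nonneg _))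

/-- The secular solution attached to a Jordan chain; its linear growth will contradict boundedness.
-/
theorem isSolution_jordan {l : ℂ} {v w : W} (hv : T v = l • v) (hw : T w = l • w + v) :
    IsSolution T (fun s : ℝ => Complex.exp (l * s) • (w + (s : ℂ) • v)) := by
  intro t
  have hid : HasDerivAt (fun s : ℝ => (s : ℂ)) 1 t := (hasDerivAt_id t).ofReal_comp
  have h1 : HasDerivAt (fun s : ℝ => Complex.exp (l * s)) (Complex.exp (l * t) * (l * 1)) t :=
    (hid.const_mul l).cexp
  have h2 : HasDerivAt (fun s : ℝ => w + (s : ℂ) • v) ((1 : ℂ) • v) t :=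
    (hid.smul_const v).const_add w
  refine (h1.smul h2).congr_deriv ?_
  rw [map_smul, map_add, map_smul, hv, hw]
  module

theorem isSolution_exp_smul {l : ℂ} {w : W} (hw : T w = l • w) :
    IsSolution T (fun s : ℝ => Complex.exp (l * s) • w) := by
  simpa only [smul_zero, add_zero] using
    isSolution_jordan (T := T) (l := l) (v := 0) (w := w) (by simp) (by simpa using hw)

theorem eq_smul_of_isSolution_exp {l : ℂ} {w : W}
    (h : IsSolution T (fun s : ℝ => Complex.exp (l * s) • w)) : T w = l • w := by
  have h2 : HasDerivAt (fun t : ℝ => Complex.exp (l * t) • w) (l • w) 0 := by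
    have hid : HasDerivAt (fun s : ℝ => (s : ℂ)) 1 0 := (hasDerivAt_id (0 : ℝ)).ofReal_comp
    refine (((hid.const_mul l).cexp).smul_const w).congr_deriv ?_
    simp
  simpa using (h 0).unique h2

theorem re_nonpos_of_bounded
    (hb : ∀ c : ℝ → W, IsSolution T c → ∃ M, ∀ t, 0 ≤ t → ‖c t‖ ≤ M) {l : ℂ} {v : W}
    (hv : T v = l • v) (h0 : v ≠ 0) : l.re ≤ 0 := by
  obtain ⟨M, hM⟩ := hb _ (isSolution_exp_smul hv)
  by_contra! hl
  have h1 : Tendsto (fun t : ℝ => Real.exp (l.re * t) * ‖v‖) atTop atTop :=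
    (Real.tendsto_exp_atTop.comp (tendsto_id.const_mul_atTop hl)).atTop_mul_const
      (norm_pos_iff.2 h0)
  obtain ⟨t, ht0, ht⟩ := ((eventually_ge_atTop 0).and (h1.eventually_gt_atTop M)).exists
  have h2 := hM t ht0
  rw [norm_smul, Complex.norm_exp] at h2
  simp only [Complex.mul_re, Complex.ofReal_re, Complex.ofReal_im, mul_zero, sub_zero] at h2
  linarith

/-- If $l$ is an eigenvalue then so is $-l$: the range of $T+l$ is orthogonal to $v$ by skewness, so
$T+l$ is not surjective, hence not injective. Forward boundedness applied to both signs leaves only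
imaginary $l$. -/
theorem re_eq_zero_of_bounded [FiniteDimensional ℂ W]
    (hb : ∀ c : ℝ → W, IsSolution T c → ∃ M, ∀ t, 0 ≤ t → ‖c t‖ ≤ M)
    {ω : W →ₗ[ℂ] W →ₗ[ℂ] ℂ} (hnd : ∀ Y, (∀ X, ω X Y = 0) → Y = 0)
    (hskew : ∀ X Y, ω (T X) Y = -ω X (T Y)) {l : ℂ} {v : W}
    (hv : T v = l • v) (h0 : v ≠ 0) : l.re = 0 := by
  refine le_antisymm (re_nonpos_of_bounded hb hv h0) ?_
  set S : Module.End ℂ W := T + l • (1 : Module.End ℂ W) with hS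
  have hns : ¬ Function.Injective S := by
    intro hinj
    have hsurj := LinearMap.injective_iff_surjective.1 hinj
    apply h0
    refine hnd v fun X => ?_
    obtain ⟨X, rfl⟩ := hsurj X
    simp only [hS, LinearMap.add_apply, LinearMap.smul_apply, Module.End.one_apply, map_add,
      map_smul, hskew, hv]
    simp
  rw [injective_iff_map_eq_zero] at hns
  push Not at hns
  obtain ⟨z, hz, hz0⟩ := hns
  have hz' : T z = (-l) • z := by
    rw [neg_smul]
    exact eq_neg_of_add_eq_zero_left hz
  have := re_nonpos_of_bounded hb hz' hz0
  simp only [Complex.neg_re] at this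
  linarith

theorem eq_zero_of_jordan_of_bounded
    (hb : ∀ c : ℝ → W, IsSolution T c → ∃ M, ∀ t, 0 ≤ t → ‖c t‖ ≤ M)
    (himag : ∀ (l : ℂ) (v : W), T v = l • v → v ≠ 0 → l.re = 0) (l : ℂ) (v w : W)
    (hv : T v = l • v) (hw : T w = l • w + v) : v = 0 := by
  by_contra h0
  obtain ⟨M, hM⟩ := hb _ (isSolution_jordan hv hw)
  have hl := himag l v hv h0
  have h1 : Tendsto (fun t : ℝ => t * ‖v‖) atTop atTop :=
    tendsto_id.atTop_mul_const (norm_pos_iff.2 h0)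
  obtain ⟨t, ht0, ht⟩ := ((eventually_ge_atTop 0).and (h1.eventually_gt_atTop (M + ‖w‖))).exists
  have h2 := hM t ht0
  rw [norm_smul, Complex.norm_exp] at h2
  simp only [Complex.mul_re, Complex.ofReal_re, Complex.ofReal_im, mul_zero, sub_zero, hl, zero_mul,
    Real.exp_zero, one_mul] at h2
  have h3 : ‖(t : ℂ) • v‖ ≤ ‖w + (t : ℂ) • v‖ + ‖w‖ := by
    have := norm_sub_le (w + (t : ℂ) • v) w
    rwa [add_sub_cancel_left] at this
  rw [norm_smul, Complex.norm_real, Real.norm_of_nonneg ht0] at h3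
  linarith

end Abstract

variable {n : ℕ} (C : ConstraintPlane n) {Γ : Reduced C.plane ⊗[ℝ] Reduced C.plane}

instance reducedNormedSpace (L : Submodule ℂ (Phase ℂ n)) : NormedSpace ℝ (Reduced L) :=
  Submodule.Quotient.normedSpace (L.submoduleOf (perp L)) ℝ

theorem isNormalModes_of_isModeFamily {d : ℕ} {β : Fin d → ℝ}
    {Y : Fin d → Reduced (cxPlane C.plane)}
    (h : IsModeFamily (redSymp (cxPlane C.plane)) (conjRed C.plane) (cxFlow C.plane Γ) β Y) :
    IsNormalModes C Γ β Y where
  solution I := by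
    have := isSolution_exp_smul (W := Reduced (cxPlane C.plane)) (T := cxFlow C.plane Γ)
      (h.eigen I)
    exact this
  solution_conj I := by
    have := isSolution_exp_smul (W := Reduced (cxPlane C.plane)) (T := cxFlow C.plane Γ)
      (l := -(Complex.I * β I)) (w := conjRed C.plane (Y I)) (by
        rw [cxFlow_conjRed, h.eigen, map_smulₛₗ]; simp)
    simp only [neg_mul] at this
    exact this
  independent := by
    -- Independence of the functions already holds for their values at $t=0$.
    refine LinearIndependent.of_comp (LinearMap.proj (0 : ℝ)) ?_
    convert h.linearIndependent (redSymp_swap _) (redSymp_conjRed _) using 1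
    ext I
    rcases I with I | I <;> simp
  normalized := h.normalized
  isotropic := h.isotropic

theorem IsNormalModes.isModeFamily {d : ℕ} {β : Fin d → ℝ}
    {Y : Fin d → Reduced (cxPlane C.plane)} (h : IsNormalModes C Γ β Y) :
    IsModeFamily (redSymp (cxPlane C.plane)) (conjRed C.plane) (cxFlow C.plane Γ) β Y where
  eigen I := by
    have h1 : IsSolution (cxFlow C.plane Γ)
      (fun s : ℝ => Complex.exp (Complex.I * β I * s) • Y I) := h.solution I
    exact eq_smul_of_isSolution_exp (W := Reduced (cxPlane C.plane)) h1
  normalized := h.normalized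
  isotropic := h.isotropic

theorem finrank_reduced_cxPlane :
    finrank ℂ (Reduced (cxPlane C.plane)) = 2 * (n - finrank ℝ C.plane) := by
  rw [finrank_reduced (cxPlane_isotropic C), finrank_cxPlane]
  omega

theorem ReducedStable.exists_bound (h : ReducedStable C Γ) (c : ℝ → Reduced (cxPlane C.plane))
    (hc : IsSolution (cxFlow C.plane Γ) c) : ∃ M, ∀ t, 0 ≤ t → ‖c t‖ ≤ M := by
  have h' : IsStable (circ (redSymp C.plane) Γ) := h
  exact IsStable.exists_bound_complex (V := Reduced C.plane) (W := Reduced (cxPlane C.plane))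
      (T₀ := circ (redSymp C.plane) Γ) (T := cxFlow C.plane Γ) h' (reRed C.plane)
      (cxRed C.plane) (reRed_cxFlow C.plane Γ) (cxRed_reRed C.plane) hc

theorem ReducedStable.re_eq_zero (h : ReducedStable C Γ) (hΓ : TensorProduct.comm ℝ _ _ Γ = Γ)
    (l : ℂ) (v : Reduced (cxPlane C.plane)) (hv : cxFlow C.plane Γ v = l • v) (h0 : v ≠ 0) :
    l.re = 0 :=
  re_eq_zero_of_bounded (W := Reduced (cxPlane C.plane)) (T := cxFlow C.plane Γ) (h.exists_bound C)
    (eq_zero_of_redSymp _) (cxFlow_skew C.plane hΓ) hv h0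

theorem ReducedStable.iSup_eigenspace (h : ReducedStable C Γ)
    (hΓ : TensorProduct.comm ℝ _ _ Γ = Γ) :
    ⨆ l, (cxFlow C.plane Γ).genEigenspace l 1 = ⊤ := by
  refine iSup_eigenspace_eq_top_of_jordan _ fun l v w hv hw => ?_
  exact eq_zero_of_jordan_of_bounded (W := Reduced (cxPlane C.plane)) (T := cxFlow C.plane Γ)
    (h.exists_bound C) (h.re_eq_zero C hΓ) l v w hv hw

theorem ReducedStable.exists_isNormalModes (h : ReducedStable C Γ)
    (hΓ : TensorProduct.comm ℝ _ _ Γ = Γ) :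
    ∃ (β : Fin (n - finrank ℝ C.plane) → ℝ)
      (Y : Fin (n - finrank ℝ C.plane) → Reduced (cxPlane C.plane)), IsNormalModes C Γ β Y := by
  obtain ⟨β, Y, hY⟩ := exists_modeFamily (W := Reduced (cxPlane C.plane))
    (T := cxFlow C.plane Γ) (redSymp_swap _) (eq_zero_of_redSymp _)
    (conjRed_conjRed C.plane) (redSymp_conjRed C.plane) (cxFlow_conjRed C.plane Γ)
    (cxFlow_skew C.plane hΓ) (h.re_eq_zero C hΓ) (h.iSup_eigenspace C hΓ)
    (n - finrank ℝ C.plane) (finrank_reduced_cxPlane C).ge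
  exact ⟨β, Y, isNormalModes_of_isModeFamily C hY⟩

end StableModes

/-! ### Excited states -/

section Excited

/-! ### Algebra of complete mode families and of ladder operators. -/

section Abstract

variable {W : Type} [AddCommGroup W] [Module ℂ W] {ω : W →ₗ[ℂ] W →ₗ[ℂ] ℂ}
  {σ : W →ₛₗ[starRingEnd ℂ] W} {T : Module.End ℂ W} {d : ℕ} {β : Fin d → ℝ} {Y : Fin d → W}

/-- Expansion of a vector in a complete family of modes. -/
theorem IsModeFamily.expansion [FiniteDimensional ℂ W] (h : IsModeFamily ω σ T β Y) (hω : ∀ X Y, ω X Y = -ω Y X)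
    (hωσ : ∀ X Y, ω (σ X) (σ Y) = starRingEnd ℂ (ω X Y)) (hd : finrank ℂ W = 2 * d) (Z : W) :
    Z = ∑ I, ((1 / Complex.I * ω Z (σ (Y I))) • Y I - (1 / Complex.I * ω Z (Y I)) • σ (Y I)) := by
  have hspan : Z ∈ Submodule.span ℂ (Set.range (Sum.elim Y (fun I => σ (Y I)))) := by
    rw [(h.linearIndependent hω hωσ).span_eq_top_of_card_eq_finrank' (by simp [hd, two_mul])]
    trivial
  induction hspan using Submodule.span_induction with
  | mem Z hZ =>
    obtain ⟨J | J, rfl⟩ := hZ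
    · simp only [Sum.elim_inl, h.normalized, h.isotropic]
      simp
    · simp only [Sum.elim_inr, h.conj_symp hω, h.conj_isotropic hωσ]
      simp
  | zero => simp
  | add X Z _ _ hX hZ =>
    conv_lhs => rw [hX, hZ]
    rw [← Finset.sum_add_distrib]
    refine Finset.sum_congr rfl fun I _ => ?_
    simp only [map_add, LinearMap.add_apply]
    module
  | smul c Z _ hZ =>
    conv_lhs => rw [hZ]
    rw [Finset.smul_sum]
    refine Finset.sum_congr rfl fun I _ => ?_
    simp only [map_smul, LinearMap.smul_apply, smul_eq_mul]
    module

/-- Expanding the first leg in the modes, the coefficients $\omega(Z,\cdot)$ combine with the second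
leg into the action of the tensor. As the modes are eigenvectors of that action, this diagonalizes
the Hamiltonian. -/
theorem IsModeFamily.tensor_eq [FiniteDimensional ℂ W] (h : IsModeFamily ω σ T β Y) (hω : ∀ X Y, ω X Y = -ω Y X)
    (hωσ : ∀ X Y, ω (σ X) (σ Y) = starRingEnd ℂ (ω X Y)) (hd : finrank ℂ W = 2 * d)
    (Γ : W ⊗[ℂ] W) :
    Γ = (1 / (2 * Complex.I)) •
      ∑ I, (σ (Y I) ⊗ₜ[ℂ] circ ω Γ (Y I) - Y I ⊗ₜ[ℂ] circ ω Γ (σ (Y I))) := by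
  induction Γ with
  | zero => simp
  | add a b ha hb =>
    conv_lhs => rw [ha, hb]
    rw [← smul_add, ← Finset.sum_add_distrib]
    congr 1
    refine Finset.sum_congr rfl fun I _ => ?_
    simp only [map_add, LinearMap.add_apply, TensorProduct.tmul_add]
    abel
  | tmul Z Z' =>
    conv_lhs => rw [h.expansion hω hωσ hd Z, TensorProduct.sum_tmul]
    rw [Finset.smul_sum]
    refine Finset.sum_congr rfl fun I _ => ?_
    rw [circ_tmul, circ_tmul, TensorProduct.sub_tmul, ← TensorProduct.smul_tmul',
      ← TensorProduct.smul_tmul', TensorProduct.tmul_smul, TensorProduct.tmul_smul, hω Z (σ (Y I)),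
      hω Z (Y I), smul_sub, smul_smul, smul_smul]
    have e : 1 / (2 * Complex.I) = 1 / Complex.I * (1 / 2) := by field_simp
    rw [e]
    module

/-- Each factor `a I` raises the eigenvalue by `b I`; the induction is over the modes, and inside it
over the exponent of the leading one. -/
theorem map_prod_ofFn_pow {S : Type} [AddCommGroup S] [Module ℂ S] {H : Module.End ℂ S} {d : ℕ}
    {a : Fin d → Module.End ℂ S} {b : Fin d → ℂ}
    (hcomm : ∀ I u, H (a I u) = a I (H u) + b I • a I u) {e : ℂ} {u : S} (hu : H u = e • u)
    (N : Fin d → ℕ) :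
    H ((List.ofFn fun I => a I ^ N I).prod u) =
      (e + ∑ I, b I * N I) • (List.ofFn fun I => a I ^ N I).prod u := by
  induction d with
  | zero => simpa using hu
  | succ d ih =>
    have h1 := ih (fun I u => hcomm I.succ u) (fun I => N I.succ)
    rw [List.ofFn_succ, List.prod_cons, Module.End.mul_apply, Fin.sum_univ_succ]
    set v := (List.ofFn fun I : Fin d => a I.succ ^ N I.succ).prod u
    set m := N 0
    generalize m = m
    clear_value v
    induction m with
    | zero => simpa using h1
    | succ m ihm =>
      rw [pow_succ', Module.End.mul_apply, hcomm, ihm, map_smul]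
      push_cast
      module

/-- Commuting factors absorb one more letter by increasing its exponent, so the ordered monomials
are stable under every creation operator. -/
theorem exists_mul_prod_ofFn_pow {M : Type} [Monoid M] {d : ℕ} {a : Fin d → M}
    (hcomm : ∀ I J, Commute (a I) (a J)) (J : Fin d) (N : Fin d → ℕ) :
    ∃ N' : Fin d → ℕ, a J * (List.ofFn fun I => a I ^ N I).prod =
      (List.ofFn fun I => a I ^ N' I).prod := by
  induction d with
  | zero => exact J.elim0
  | succ d ih =>
    refine Fin.cases ?_ (fun J => ?_) J
    · refine ⟨Fin.cons (N 0 + 1) fun I => N I.succ, ?_⟩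
      simp only [List.ofFn_succ, List.prod_cons, Fin.cons_zero, Fin.cons_succ]
      rw [pow_succ', mul_assoc]
    · obtain ⟨N', h⟩ := ih (a := fun I => a I.succ) (fun I J => hcomm _ _) J fun I => N I.succ
      refine ⟨Fin.cons (N 0) N', ?_⟩
      simp only [List.ofFn_succ, List.prod_cons, Fin.cons_zero, Fin.cons_succ]
      rw [← h, ← mul_assoc, ← mul_assoc, ((hcomm J.succ 0).pow_right (N 0)).eq]

theorem injective_prod_ofFn_pow {S : Type} [AddCommGroup S] [Module ℂ S] {d : ℕ}
    {a : Fin d → Module.End ℂ S} (ha : ∀ I u, a I u = 0 → u = 0) (N : Fin d → ℕ) {u : S}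
    (hu : (List.ofFn fun I => a I ^ N I).prod u = 0) : u = 0 := by
  induction d with
  | zero => simpa using hu
  | succ d ih =>
    rw [List.ofFn_succ, List.prod_cons, Module.End.mul_apply] at hu
    refine ih (fun I u => ha I.succ u) (fun I => N I.succ) ?_
    set v := (List.ofFn fun I : Fin d => a I.succ ^ N I.succ).prod u
    set m := N 0
    generalize m = m at hu
    clear_value v
    induction m with
    | zero => simpa using hu
    | succ m ihm =>
      rw [pow_succ', Module.End.mul_apply] at hu
      exact ihm (ha 0 _ hu)

end Abstract

variable {n : ℕ} (C : ConstraintPlane n) {Γ : Reduced C.plane ⊗[ℝ] Reduced C.plane}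
  {d : ℕ} {β : Fin d → ℝ} {Y : Fin d → Reduced (cxPlane C.plane)} {ψ : 𝓢(Conf n, ℂ)}

/-- In the mode expansion the terms $\bar\Omega(Y_I^*)\bar\Omega(Y_I)$ kill the ground state, while
$\bar\Omega(Y_I)\bar\Omega(Y_I^*)$ contributes its commutator, the zero-point energy $\beta_I/2$. -/
theorem redOm2_cls_of_modes
    (h : IsModeFamily (redSymp (cxPlane C.plane)) (conjRed C.plane) (cxFlow C.plane Γ) β Y)
    (hd : finrank ℂ (Reduced (cxPlane C.plane)) = 2 * d)
    (h0 : ∀ I, redOm C (Y I) (cls C ψ) = 0) :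
    redOm2 C Γ (cls C ψ) = (∑ I, (β I : ℂ) * (1 / 2)) • cls C ψ := by
  have e := h.tensor_eq (redSymp_swap _) (redSymp_conjRed _) hd (cxTensor C.plane Γ)
  rw [redOm2_eq, e]
  change quadOm C ((1 / (2 * Complex.I)) • ∑ I, (conjRed C.plane (Y I) ⊗ₜ[ℂ]
    cxFlow C.plane Γ (Y I) - Y I ⊗ₜ[ℂ] cxFlow C.plane Γ (conjRed C.plane (Y I)))) (cls C ψ) = _
  rw [map_smul, map_sum, LinearMap.smul_apply, LinearMap.sum_apply, Finset.smul_sum,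
    Finset.sum_smul]
  refine Finset.sum_congr rfl fun I _ => ?_
  have hc : cxFlow C.plane Γ (conjRed C.plane (Y I)) =
      (-(Complex.I * β I)) • conjRed C.plane (Y I) := by
    rw [cxFlow_conjRed, h.eigen, map_smulₛₗ]
    simp
  rw [map_sub, LinearMap.sub_apply, quadOm_tmul, quadOm_tmul, hc, h.eigen]
  simp only [map_smul, LinearMap.smul_apply]
  rw [redOm_commutator C (Y I), h0, h.symp_conj, if_pos rfl]
  simp only [map_zero, smul_zero, zero_add, zero_sub, ← neg_smul, smul_smul]
  congr 1
  field_simp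
  linear_combination (-(β I : ℂ)) * Complex.I_sq

/-- For a normalized mode $\|\bar\Omega(Y_I^*)u\|^2=\|\bar\Omega(Y_I)u\|^2+\|u\|^2\ge\|u\|^2$. This
is why no excited state vanishes. -/
theorem redOm_conj_injective
    (h : IsModeFamily (redSymp (cxPlane C.plane)) (conjRed C.plane) (cxFlow C.plane Γ) β Y)
    (I : Fin d) (u : States C) (hu : redOm C (conjRed C.plane (Y I)) u = 0) : u = 0 := by
  have e := norm_sq_redOm_conj C (Y I) u
  rw [hu, h.normalized, if_pos rfl, one_mul, norm_zero, ← Complex.ofReal_add,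
    Complex.ofReal_inj] at e
  have : ‖u‖ ^ 2 = 0 := by nlinarith [sq_nonneg ‖redOm C (Y I) u‖, sq_nonneg ‖u‖]
  exact norm_eq_zero.1 (pow_eq_zero_iff two_ne_zero |>.1 this)

theorem hasEigenvector_excited (hΓ : TensorProduct.comm ℝ _ _ Γ = Γ)
    (h : IsModeFamily (redSymp (cxPlane C.plane)) (conjRed C.plane) (cxFlow C.plane Γ) β Y)
    (hd : finrank ℂ (Reduced (cxPlane C.plane)) = 2 * d)
    (h0 : ∀ I, redOm C (Y I) (cls C ψ) = 0) (hψ : cls C ψ ≠ 0) (N : Fin d → ℕ) :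
    (redOm2 C Γ).HasEigenvector (∑ I, (β I : ℂ) * ((N I : ℂ) + 1 / 2)) (excited C Y ψ N) := by
  refine ⟨Module.End.mem_eigenspace_iff.2 ?_, fun h1 =>
    hψ (injective_prod_ofFn_pow (redOm_conj_injective C h) N h1)⟩
  have := map_prod_ofFn_pow (H := redOm2 C Γ) (a := fun I => redOm C (conjRed C.plane (Y I)))
    (b := fun I => (β I : ℂ)) (fun I u => by
      rw [redOm2_commutator C hΓ, cxFlow_conjRed, h.eigen, map_smulₛₗ, map_smul,
        LinearMap.smul_apply, smul_smul, map_mul, Complex.conj_I, Complex.conj_ofReal]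
      congr 2
      linear_combination (-(β I : ℂ)) * Complex.I_sq) (redOm2_cls_of_modes C h hd h0) N
  refine this.trans ?_
  rw [← Finset.sum_add_distrib]
  congr 1
  exact Finset.sum_congr rfl fun I _ => by ring

/-- The linear span of the excited states. -/
def excitedSpan (Y : Fin d → Reduced (cxPlane C.plane)) (ψ : 𝓢(Conf n, ℂ)) :
    Submodule ℂ (States C) :=
  Submodule.span ℂ (Set.range (excited C Y ψ))

theorem cls_mem_excitedSpan : cls C ψ ∈ excitedSpan C Y ψ := by
  refine Submodule.subset_span ⟨0, ?_⟩
  simp only [excited, Pi.zero_apply, pow_zero]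
  rw [List.prod_eq_one (by simp), Module.End.one_apply]

theorem redOm_conj_mem_excitedSpan
    (h : IsModeFamily (redSymp (cxPlane C.plane)) (conjRed C.plane) (cxFlow C.plane Γ) β Y)
    {V : Reduced (cxPlane C.plane)} (hV : V ∈ Submodule.span ℂ (Set.range Y)) {u : States C}
    (hu : u ∈ excitedSpan C Y ψ) : redOm C (conjRed C.plane V) u ∈ excitedSpan C Y ψ := by
  have hmode : ∀ J, redOm C (conjRed C.plane (Y J)) u ∈ excitedSpan C Y ψ := by
    intro J
    induction hu using Submodule.span_induction with
    | mem u hu =>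
      obtain ⟨N, rfl⟩ := hu
      obtain ⟨N', hN'⟩ := exists_mul_prod_ofFn_pow
        (a := fun I => redOm C (conjRed C.plane (Y I))) (fun I J => by
          refine LinearMap.ext fun u => ?_
          rw [Module.End.mul_apply, Module.End.mul_apply, redOm_commutator,
            h.conj_isotropic (redSymp_conjRed _)]
          simp) J N
      refine Submodule.subset_span ⟨N', ?_⟩
      rw [excited, ← hN']
      rfl
    | zero => rw [map_zero]; exact zero_mem _
    | add x y _ _ hx hy => rw [map_add]; exact add_mem hx hy
    | smul c x _ hx => rw [map_smul]; exact Submodule.smul_mem _ _ hx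
  induction hV using Submodule.span_induction with
  | mem V hV =>
    obtain ⟨J, rfl⟩ := hV
    exact hmode J
  | zero => simp
  | add x y _ _ hx hy =>
    rw [map_add, map_add, LinearMap.add_apply]
    exact add_mem hx hy
  | smul c x _ hx =>
    rw [map_smulₛₗ, map_smul, LinearMap.smul_apply]
    exact Submodule.smul_mem _ _ hx

end Excited

/-! ### Realizing a positive Lagrangian plane by a Gaussian -/

section Realization

variable {n : ℕ}

open Matrix in
/-- A positive Lagrangian plane is the graph of a symmetric matrix with positive definite
imaginary part. -/
theorem exists_lagr_eq (a : Submodule ℂ (Phase ℂ n)) (ha : perp a = a)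
    (hpos : ∀ Y ∈ a, Y ≠ 0 → 0 < (symp ℂ n Y (conjPhase n Y)).im) :
    ∃ A : Matrix (Fin n) (Fin n) ℂ, A.IsSymm ∧ (A.map Complex.im).PosDef ∧ lagr A = a := by
  have hrank : finrank ℂ a = n := by
    have := finrank_perp a
    rw [ha] at this
    omega
  let p : a →ₗ[ℂ] (Fin n → ℂ) := (LinearMap.snd ℂ _ _).comp a.subtype
  -- A vector with $Q=0$ has $\omega(Y,Y^*)=0$, so positivity makes $Q$ a coordinate on the plane;
  -- half-dimensionality makes it a full one.
  have hp : Function.Injective p := by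
    rw [injective_iff_map_eq_zero]
    intro Y hY
    have hY2 : (Y : Phase ℂ n).2 = 0 := hY
    by_contra h0
    have := hpos Y Y.2 fun h => h0 (Subtype.ext h)
    simp [symp_apply, conjPhase, hY2] at this
  let e := LinearEquiv.ofInjectiveOfFinrankEq p hp (by rw [hrank]; simp)
  have he : ∀ Y, e Y = (Y : Phase ℂ n).2 := fun Y => rfl
  let A : Matrix (Fin n) (Fin n) ℂ := LinearMap.toMatrix'
    (((LinearMap.fst ℂ _ _).comp a.subtype).comp e.symm.toLinearMap)
  have hA : ∀ Y : a, (Y : Phase ℂ n).1 = A *ᵥ (Y : Phase ℂ n).2 := by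
    intro Y
    rw [LinearMap.toMatrix'_mulVec, ← he Y]
    simp
  have hmem : ∀ q, (A *ᵥ q, q) ∈ a := by
    intro q
    have h2 : ((e.symm q : a) : Phase ℂ n).2 = q := e.apply_symm_apply q
    have h1 := hA (e.symm q)
    rw [h2] at h1
    rw [show (A *ᵥ q, q) = ((e.symm q : a) : Phase ℂ n) from Prod.ext h1.symm h2.symm]
    exact (e.symm q).2
  have hsymm : A.IsSymm := by
    ext j k
    have h := ha.ge (hmem (Pi.single k 1)) _ (hmem (Pi.single j 1))
    rw [symp_eq_dotProduct] at h
    simp only [mulVec_single_one, dotProduct_single, mul_one] at h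
    exact sub_eq_zero.1 (by simpa using h)
  refine ⟨A, hsymm, ?_, ?_⟩
  · refine Matrix.PosDef.of_dotProduct_mulVec_pos ?_ fun x hx => ?_
    · ext j k
      simpa using congrArg Complex.im (hsymm.apply j k)
    · have h0 : (A *ᵥ (fun j => (x j : ℂ)), fun j => (x j : ℂ)) ≠ (0 : Phase ℂ n) := fun h => by
        apply hx
        ext j
        simpa using congrFun (congrArg Prod.snd h) j
      have h1 := hpos _ (hmem fun j => (x j : ℂ)) h0
      rw [im_symp_lagr hsymm (mem_lagr.2 rfl)] at h1
      simp only [Complex.ofReal_re, Complex.ofReal_im] at h1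
      have hz : (fun _ : Fin n => (0 : ℝ)) ⬝ᵥ (A.map Complex.im) *ᵥ (fun _ : Fin n => (0 : ℝ)) = 0 :=
        zero_dotProduct _
      rw [hz] at h1
      simpa using h1
  · ext Y
    refine ⟨fun h => ?_, fun h => hA ⟨Y, h⟩⟩
    rw [show Y = (A *ᵥ Y.2, Y.2) from Prod.ext h rfl]
    exact hmem _

/-- The complex structure `(P, Q) ↦ (-Q, P)`. -/
def rotPhase (n : ℕ) : Phase ℂ n →ₗ[ℂ] Phase ℂ n :=
  (-LinearMap.snd ℂ (Fin n → ℂ) (Fin n → ℂ)).prod (LinearMap.fst ℂ _ _)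

theorem rotPhase_rotPhase (X : Phase ℂ n) : rotPhase n (rotPhase n X) = -X := by
  ext j <;> simp [rotPhase]

theorem symp_rotPhase_left (X Y : Phase ℂ n) :
    symp ℂ n (rotPhase n X) Y = -symp ℂ n X (rotPhase n Y) := by
  simp only [symp_apply, rotPhase, LinearMap.prod_apply, Function.prod, LinearMap.neg_apply,
    LinearMap.snd_apply, LinearMap.fst_apply, Pi.neg_apply, ← Finset.sum_neg_distrib]
  exact Finset.sum_congr rfl fun j _ => by ring

theorem conjPhase_rotPhase (X : Phase ℂ n) :
    conjPhase n (rotPhase n X) = rotPhase n (conjPhase n X) := by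
  ext j <;> simp [conjPhase, rotPhase]

/-- With $J$ for `rotPhase`, $\omega(X,JX^*)=\sum_j(|P_j|^2+|Q_j|^2)$, the standard Hermitian norm.
-/
theorem re_symp_rotPhase_conj_pos {X : Phase ℂ n} (hX : X ≠ 0) :
    0 < (symp ℂ n X (rotPhase n (conjPhase n X))).re := by
  have e : (symp ℂ n X (rotPhase n (conjPhase n X))).re =
      ∑ j, (Complex.normSq (X.1 j) + Complex.normSq (X.2 j)) := by
    simp [symp_apply, rotPhase, conjPhase, Complex.normSq_apply]
  rw [e]
  have h0 : ∀ j, 0 ≤ Complex.normSq (X.1 j) + Complex.normSq (X.2 j) := fun j =>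
    add_nonneg (Complex.normSq_nonneg _) (Complex.normSq_nonneg _)
  refine lt_of_le_of_ne (Finset.sum_nonneg fun j _ => h0 j) fun h => hX ?_
  have h1 := (Finset.sum_eq_zero_iff_of_nonneg fun j _ => h0 j).1 h.symm
  refine Prod.ext (funext fun j => ?_) (funext fun j => ?_)
  · exact Complex.normSq_eq_zero.1 (by
      linarith [h1 j (Finset.mem_univ j), Complex.normSq_nonneg (X.1 j),
        Complex.normSq_nonneg (X.2 j)])
  · exact Complex.normSq_eq_zero.1 (by
      linarith [h1 j (Finset.mem_univ j), Complex.normSq_nonneg (X.1 j),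
        Complex.normSq_nonneg (X.2 j)])

/-- The complexified plane contains $X^*$ along with $X$, so it pairs nondegenerately with its image
under $J$. -/
theorem eq_zero_of_symp_rotPhase {L : Submodule ℝ (Phase ℝ n)} {X : Phase ℂ n}
    (hX : X ∈ cxPlane L) (h : ∀ Y ∈ cxPlane L, symp ℂ n X (rotPhase n Y) = 0) : X = 0 := by
  by_contra h0
  have := re_symp_rotPhase_conj_pos h0
  rw [h _ (conj_mem_cxPlane hX)] at this
  exact lt_irrefl _ this

theorem perp_inf_perp (r M : Submodule ℂ (Phase ℂ n)) : perp (r ⊓ perp M) = perp r ⊔ M := by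
  rw [← perp_perp (perp r ⊔ M)]
  congr 1
  ext Z
  constructor
  · rintro ⟨h1, h2⟩ X hX
    obtain ⟨U, hU, V, hV, rfl⟩ := Submodule.mem_sup.1 hX
    rw [map_add, LinearMap.add_apply, h2 V hV, symp_swap, hU Z h1]
    simp
  · intro h
    refine ⟨?_, perp_antitone le_sup_right h⟩
    rw [← perp_perp r]
    exact perp_antitone le_sup_left h

/-- A Lagrangian plane `r ⊇ L^ℂ` that is positive modulo `L^ℂ` arises from a Gaussian. -/
theorem exists_lagr_inf_perp_sup {L : Submodule ℝ (Phase ℝ n)}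
    (hL : cxPlane L ≤ perp (cxPlane L)) {r : Submodule ℂ (Phase ℂ n)} (hr : perp r = r)
    (hLr : cxPlane L ≤ r)
    (hpos : ∀ Y ∈ r, Y ∉ cxPlane L → 0 < (symp ℂ n Y (conjPhase n Y)).im) :
    ∃ A : Matrix (Fin n) (Fin n) ℂ, A.IsSymm ∧ (A.map Complex.im).PosDef ∧
      lagr A ⊓ perp (cxPlane L) ⊔ cxPlane L = r := by
  -- With $J$ for `rotPhase`, $M=JL^{\mathbb C}$ is dual to $L^{\mathbb C}$. Then $S=r\cap
  -- M^{\perp}$ complements $L^{\mathbb C}$ in $r$, and $F=\{X-iJX\}$ is a positive isotropic plane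
  -- that takes the place of $L^{\mathbb C}$. The plane sought is $S\oplus F$.
  set M := (cxPlane L).map (rotPhase n) with hM
  set g : Phase ℂ n →ₗ[ℂ] Phase ℂ n := LinearMap.id - Complex.I • rotPhase n with hg
  have hgX : ∀ X, g X = X - Complex.I • rotPhase n X := fun X => rfl
  set S := r ⊓ perp M with hS
  set F := (cxPlane L).map g with hF
  have hrL : r ≤ perp (cxPlane L) := by
    rw [← hr]
    exact perp_antitone hLr
  have hperpS : perp S = r ⊔ M := by rw [hS, perp_inf_perp, hr]
  have hrS : r = S ⊔ cxPlane L := by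
    refine le_antisymm ?_ (sup_le inf_le_left hLr)
    rw [← perp_perp (S ⊔ cxPlane L), ← hr]
    refine perp_antitone fun Z hZ => ?_
    have h1 : Z ∈ r ⊔ M := hperpS ▸ perp_antitone le_sup_left hZ
    have h2 : Z ∈ perp (cxPlane L) := perp_antitone le_sup_right hZ
    obtain ⟨Y, hY, _, ⟨X, hX, rfl⟩, rfl⟩ := Submodule.mem_sup.1 h1
    have hX0 : X = 0 := eq_zero_of_symp_rotPhase hX fun U hU => by
      have h3 := h2 U hU
      rw [map_add, hrL hY U hU, zero_add, symp_swap, symp_rotPhase_left, neg_neg] at h3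
      exact h3
    rw [hX0, map_zero, add_zero]
    exact hY
  have hSg : ∀ Y ∈ S, ∀ X ∈ cxPlane L, ∀ c : ℂ, symp ℂ n Y (X + c • rotPhase n X) = 0 := by
    intro Y hY X hX c
    rw [map_add, map_smul, symp_swap, hrL hY.1 X hX, symp_swap,
      hY.2 _ (Submodule.mem_map_of_mem hX)]
    simp
  have hSF : ∀ Y ∈ S, ∀ X ∈ cxPlane L, symp ℂ n Y (g X) = 0 := fun Y hY X hX => by
    rw [hgX, sub_eq_add_neg, ← neg_smul]
    exact hSg Y hY X hX _
  have hconjg : ∀ X, conjPhase n (g X) =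
      conjPhase n X + Complex.I • rotPhase n (conjPhase n X) := fun X => by
    rw [hgX, map_sub, map_smulₛₗ, conjPhase_rotPhase, Complex.conj_I, neg_smul, sub_neg_eq_add]
  have hgg : ∀ X Y, symp ℂ n (g X) (g Y) = 0 := by
    intro X Y
    simp only [hgX, map_sub, LinearMap.sub_apply, map_smul, LinearMap.smul_apply, smul_eq_mul,
      symp_rotPhase_left, rotPhase_rotPhase, map_neg]
    linear_combination (symp ℂ n X Y) * Complex.I_sq
  have hgconj : ∀ X ∈ cxPlane L, symp ℂ n (g X) (conjPhase n (g X)) =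
      2 * Complex.I * symp ℂ n X (rotPhase n (conjPhase n X)) := by
    intro X hX
    rw [hconjg]
    simp only [hgX, map_sub, map_add, LinearMap.sub_apply, map_smul, LinearMap.smul_apply,
      smul_eq_mul, symp_rotPhase_left, rotPhase_rotPhase, map_neg, hL (conj_mem_cxPlane hX) X hX]
    ring
  have hiso : S ⊔ F ≤ perp (S ⊔ F) := by
    intro Z hZ Z' hZ'
    obtain ⟨Y, hY, _, ⟨X, hX, rfl⟩, rfl⟩ := Submodule.mem_sup.1 hZ
    obtain ⟨Y', hY', _, ⟨X', hX', rfl⟩, rfl⟩ := Submodule.mem_sup.1 hZ'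
    rw [map_add, map_add, LinearMap.add_apply, LinearMap.add_apply, hgg, hSF Y' hY' X hX,
      symp_swap (g X'), hSF Y hY X' hX', hr.ge hY.1 Y' hY'.1]
    simp
  have hlag : perp (S ⊔ F) = S ⊔ F := by
    refine le_antisymm (fun Z hZ => ?_) hiso
    have h1 : Z ∈ S ⊔ cxPlane L ⊔ M := by
      rw [← hrS, ← hperpS]
      exact perp_antitone le_sup_left hZ
    obtain ⟨Y, hY, _, ⟨X, hX, rfl⟩, rfl⟩ := Submodule.mem_sup.1 h1
    obtain ⟨Y, hYS, U, hU, rfl⟩ := Submodule.mem_sup.1 hY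
    -- Orthogonality to $F$ forces $U=iX$, so that $U+JX=iX-iJ(iX)$ lies in $F$.
    have hUX : U - Complex.I • X = 0 := by
      refine eq_zero_of_symp_rotPhase (sub_mem hU (Submodule.smul_mem _ _ hX)) fun V hV => ?_
      have h2 := hZ (g V) (Submodule.mem_sup_right (Submodule.mem_map_of_mem hV))
      rw [map_add, map_add, symp_swap (g V) Y, hSF Y hYS V hV, hgX] at h2
      simp only [map_sub, LinearMap.sub_apply, map_smul, LinearMap.smul_apply, smul_eq_mul,
        symp_rotPhase_left, rotPhase_rotPhase, map_neg, hL hU V hV, hL hX V hV] at h2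
      have h3 := symp_rotPhase_left V U
      have h4 := symp_rotPhase_left V X
      rw [symp_swap] at h3 h4
      simp only [map_sub, LinearMap.sub_apply, map_smul, LinearMap.smul_apply, smul_eq_mul]
      have h5 : symp ℂ n U (rotPhase n V) = symp ℂ n V (rotPhase n U) := by
        linear_combination -h3
      have h6 : symp ℂ n X (rotPhase n V) = symp ℂ n V (rotPhase n X) := by
        linear_combination -h4
      rw [h5, h6]
      linear_combination (-Complex.I) * h2 + (symp ℂ n V (rotPhase n U)) * Complex.I_sq
    rw [add_assoc]
    refine Submodule.add_mem_sup hYS ⟨Complex.I • X, Submodule.smul_mem _ _ hX, ?_⟩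
    rw [sub_eq_zero.1 hUX, hgX, map_smul, smul_smul, Complex.I_mul_I]
    module
  obtain ⟨A, hA, hP, hAlag⟩ := exists_lagr_eq (S ⊔ F) hlag fun Z hZ h0 => by
    obtain ⟨Y, hY, _, ⟨X, hX, rfl⟩, rfl⟩ := Submodule.mem_sup.1 hZ
    have h1 : symp ℂ n Y (conjPhase n (g X)) = 0 := by
      rw [hconjg]
      exact hSg Y hY _ (conj_mem_cxPlane hX) _
    have h2 : symp ℂ n (g X) (conjPhase n Y) = 0 := by
      have := symp_conjPhase (conjPhase n (g X)) Y
      rw [conjPhase_conjPhase, symp_swap (conjPhase n (g X)) Y, h1] at this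
      simpa using this
    -- The cross terms vanish. The $S$ part is positive unless $Y=0$, since $S$ meets $L^{\mathbb
    -- C}$ trivially, and the $F$ part is twice the Hermitian norm of $X$.
    rw [map_add, map_add, map_add, LinearMap.add_apply, LinearMap.add_apply, h1, h2,
      hgconj X hX, add_zero, zero_add, Complex.add_im]
    have him : (2 * Complex.I * symp ℂ n X (rotPhase n (conjPhase n X))).im =
        2 * (symp ℂ n X (rotPhase n (conjPhase n X))).re := by
      simp [Complex.mul_im]
    rw [him]
    have hY0 : Y ∈ cxPlane L → Y = 0 := fun h => eq_zero_of_symp_rotPhase h fun U hU => by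
      rw [symp_swap, hY.2 _ (Submodule.mem_map_of_mem hU), neg_zero]
    have hXnn : 0 ≤ (symp ℂ n X (rotPhase n (conjPhase n X))).re := by
      by_cases h : X = 0
      · simp [h]
      · exact (re_symp_rotPhase_conj_pos h).le
    by_cases h : Y ∈ cxPlane L
    · have hX0 : X ≠ 0 := fun hX0 => h0 (by rw [hY0 h, hX0]; simp)
      rw [hY0 h]
      simpa using re_symp_rotPhase_conj_pos hX0
    · have := hpos Y hY.1 h
      linarith
  refine ⟨A, hA, hP, ?_⟩
  rw [hAlag]
  refine le_antisymm (sup_le ?_ hLr) ?_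
  · rintro Z ⟨hZ, hZ'⟩
    obtain ⟨Y, hY, _, ⟨X, hX, rfl⟩, rfl⟩ := Submodule.mem_sup.1 hZ
    -- Intersecting with $(L^{\mathbb C})^{\perp}$ removes the auxiliary plane $F$ and leaves $S$.
    have hX0 : X = 0 := eq_zero_of_symp_rotPhase hX fun U hU => by
      have h3 := hZ' U hU
      rw [map_add, hrL hY.1 U hU, hgX, map_sub, hL hX U hU, map_smul, symp_swap,
        symp_rotPhase_left] at h3
      simpa using h3
    rw [hX0, map_zero, add_zero]
    exact hY.1
  · rw [hrS]
    refine sup_le_sup_right (le_inf le_sup_left ?_) _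
    exact inf_le_left.trans hrL

theorem IsModeFamily.im_pos {W : Type} [AddCommGroup W] [Module ℂ W] {ω : W →ₗ[ℂ] W →ₗ[ℂ] ℂ}
    {σ : W →ₛₗ[starRingEnd ℂ] W} {T : Module.End ℂ W} {d : ℕ} {β : Fin d → ℝ} {Y : Fin d → W}
    (h : IsModeFamily ω σ T β Y) {V : W} (hV : V ∈ Submodule.span ℂ (Set.range Y)) (h0 : V ≠ 0) :
    0 < (ω V (σ V)).im := by
  obtain ⟨c, rfl⟩ := (Submodule.mem_span_range_iff_exists_fun ℂ).1 hV
  have e : ω (∑ I, c I • Y I) (σ (∑ I, c I • Y I)) =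
      Complex.I * ((∑ I, Complex.normSq (c I) : ℝ) : ℂ) := by
    simp only [map_sum, LinearMap.sum_apply, map_smulₛₗ, LinearMap.smul_apply, smul_eq_mul,
      RingHom.id_apply, h.symp_conj]
    rw [Complex.ofReal_sum, Finset.mul_sum]
    refine Finset.sum_congr rfl fun I _ => ?_
    rw [Finset.sum_eq_single I (fun J _ hJ => by simp [hJ]) (by simp), if_pos rfl,
      ← Complex.mul_conj]
    ring
  rw [e]
  simp only [Complex.mul_im, Complex.I_re, Complex.I_im, Complex.ofReal_re, zero_mul, one_mul,
    zero_add]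
  refine lt_of_le_of_ne (Finset.sum_nonneg fun j _ => Complex.normSq_nonneg _) fun hz => h0 ?_
  have h1 := (Finset.sum_eq_zero_iff_of_nonneg fun j _ => Complex.normSq_nonneg _).1 hz.symm
  exact Finset.sum_eq_zero fun I hI => by rw [Complex.normSq_eq_zero.1 (h1 I hI), zero_smul]

end Realization

/-! ### Gaussian Schwartz functions -/

section GaussianFunction

/-- The real derivative of $\exp$ is $\exp$ followed by multiplication, a linear map of norm at most
one. -/
theorem norm_iteratedFDeriv_cexp_le (i : ℕ) (z : ℂ) :
    ‖iteratedFDeriv ℝ i Complex.exp z‖ ≤ ‖Complex.exp z‖ := by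
  induction i generalizing z with
  | zero => simp
  | succ i ih =>
    let T : ℂ →L[ℝ] ℂ →L[ℝ] ℂ := ContinuousLinearMap.mul ℝ ℂ
    have hf : fderiv ℝ Complex.exp = T ∘ Complex.exp := by
      ext z w
      rw [((Complex.hasDerivAt_exp z).complexToReal_fderiv).fderiv]
      simp [T]
    have hc : ContDiffAt ℝ i Complex.exp z := Complex.contDiff_exp.contDiffAt
    rw [← norm_iteratedFDeriv_fderiv, hf]
    refine (T.norm_iteratedFDeriv_comp_left hc le_rfl).trans ?_
    calc ‖T‖ * ‖iteratedFDeriv ℝ i Complex.exp z‖ ≤ 1 * ‖Complex.exp z‖ := by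
          gcongr
          · exact ContinuousLinearMap.opNorm_mul_le ℝ ℂ
          · exact ih z
      _ = _ := one_mul _

variable {n : ℕ}

theorem norm_iteratedFDeriv_cexp_comp_le {q : Conf n → ℂ} (hq : q.HasTemperateGrowth) (l : ℕ) :
    ∃ (k : ℕ) (K : ℝ), 0 ≤ K ∧ ∀ i ≤ l, ∀ x, ‖iteratedFDeriv ℝ i (fun x => Complex.exp (q x)) x‖ ≤
      K * (1 + ‖x‖) ^ k * ‖Complex.exp (q x)‖ := by
  obtain ⟨k, K, hK, hb⟩ := hq.norm_iteratedFDeriv_le_uniform l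
  refine ⟨k * l, l.factorial * (K + 1) ^ l, by positivity, fun i hi x => ?_⟩
  have hx : 1 ≤ (1 + ‖x‖) ^ k := one_le_pow₀ (by linarith [norm_nonneg x])
  -- `K + 1` instead of `K` keeps the base at least $1$, so its powers increase with the order of
  -- differentiation.
  have hD : 1 ≤ (K + 1) * (1 + ‖x‖) ^ k := by nlinarith
  have h1 := norm_iteratedFDeriv_comp_le (g := Complex.exp) (f := q) (n := i)
    (N := (⊤ : ℕ∞)) Complex.contDiff_exp hq.1 (mod_cast le_top) x
    (C := ‖Complex.exp (q x)‖) (D := (K + 1) * (1 + ‖x‖) ^ k)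
    (fun j _ => norm_iteratedFDeriv_cexp_le j _) (fun j hj hji => by
      refine (hb j (hji.trans hi) x).trans ((?_ : _ ≤ (K + 1) * (1 + ‖x‖) ^ k).trans
        (le_self_pow₀ hD (by omega)))
      gcongr
      linarith)
  refine h1.trans ?_
  calc (i.factorial : ℝ) * ‖Complex.exp (q x)‖ * ((K + 1) * (1 + ‖x‖) ^ k) ^ i
      ≤ l.factorial * ‖Complex.exp (q x)‖ * ((K + 1) * (1 + ‖x‖) ^ k) ^ l := by
        gcongr
    _ = _ := by rw [mul_pow, ← pow_mul]; ring

theorem exists_schwartz_cexp {q : Conf n → ℂ} (hq : q.HasTemperateGrowth)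
    (hb : ∀ m : ℕ, ∃ K, ∀ x, (1 + ‖x‖) ^ m * ‖Complex.exp (q x)‖ ≤ K) :
    ∃ ψ : 𝓢(Conf n, ℂ), ∀ ξ, ψ ξ = Complex.exp (q ξ) := by
  refine ⟨⟨fun x => Complex.exp (q x), Complex.contDiff_exp.comp hq.1, fun m l => ?_⟩,
    fun ξ => rfl⟩
  obtain ⟨k, K, hK, h⟩ := norm_iteratedFDeriv_cexp_comp_le hq l
  obtain ⟨K', h'⟩ := hb (m + k)
  refine ⟨K * K', fun x => ?_⟩
  calc ‖x‖ ^ m * ‖iteratedFDeriv ℝ l (fun x => Complex.exp (q x)) x‖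
      ≤ (1 + ‖x‖) ^ m * (K * (1 + ‖x‖) ^ k * ‖Complex.exp (q x)‖) := by
        gcongr
        · linarith
        · exact h l le_rfl x
    _ = K * ((1 + ‖x‖) ^ (m + k) * ‖Complex.exp (q x)‖) := by rw [pow_add]; ring
    _ ≤ K * K' := by gcongr; exact h' x

/-- Since $(1+r)^m\le e^{mr}$, completing the square in $(m+a)r-cr^2$ gives the bound. -/
theorem one_add_pow_mul_exp_le {c : ℝ} (hc : 0 < c) (a : ℝ) (m : ℕ) {r : ℝ} (hr : 0 ≤ r) :
    (1 + r) ^ m * Real.exp (a * r - c * r ^ 2) ≤ Real.exp ((m + a) ^ 2 / (4 * c)) := by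
  have h1 : (1 + r) ^ m ≤ Real.exp (m * r) := by
    rw [Real.exp_nat_mul]
    gcongr
    linarith [Real.add_one_le_exp r]
  calc _ ≤ Real.exp (m * r) * Real.exp (a * r - c * r ^ 2) := by gcongr
    _ = Real.exp (m * r + (a * r - c * r ^ 2)) := (Real.exp_add _ _).symm
    _ ≤ _ := by
      rw [Real.exp_le_exp, le_div_iff₀ (by positivity)]
      nlinarith [sq_nonneg (2 * c * r - (m + a))]

variable {A : Matrix (Fin n) (Fin n) ℂ}

/-- The exponent of a Gaussian. -/
def gaussExp (A : Matrix (Fin n) (Fin n) ℂ) (ξ : Conf n) : ℂ :=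
  Complex.I / 2 * ∑ j, ∑ k, (ξ j : ℂ) * A j k * (ξ k : ℂ)

theorem hasTemperateGrowth_coord (j : Fin n) :
    Function.HasTemperateGrowth (fun ξ : Conf n => ((ξ j : ℝ) : ℂ)) :=
  (Complex.ofRealCLM.comp (EuclideanSpace.proj j : Conf n →L[ℝ] ℝ)).hasTemperateGrowth

theorem hasTemperateGrowth_gaussExp (A : Matrix (Fin n) (Fin n) ℂ) :
    (gaussExp A).HasTemperateGrowth := by
  unfold gaussExp
  refine (Function.HasTemperateGrowth.const _).mul ?_
  refine Function.HasTemperateGrowth.sum fun j _ => Function.HasTemperateGrowth.sum fun k _ => ?_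
  exact ((hasTemperateGrowth_coord j).mul (Function.HasTemperateGrowth.const _)).mul
    (hasTemperateGrowth_coord k)

open Matrix in
theorem exists_norm_cexp_gaussExp_le (hP : (A.map Complex.im).PosDef) :
    ∃ c > 0, ∀ ξ : Conf n, ‖Complex.exp (gaussExp A ξ)‖ ≤ Real.exp (-(c * ‖ξ‖ ^ 2)) := by
  let B : Conf n →ₗ[ℝ] Conf n →ₗ[ℝ] ℝ :=
    (Matrix.toLinearMap₂' ℝ (A.map Complex.im)).compl₁₂
      (EuclideanSpace.equiv (Fin n) ℝ).toLinearMap (EuclideanSpace.equiv (Fin n) ℝ).toLinearMap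
  let B' : Conf n →L[ℝ] Conf n →L[ℝ] ℝ := LinearMap.toContinuousLinearMap
    (LinearMap.toContinuousLinearMap.toLinearMap ∘ₗ B)
  have hB : ∀ ξ : Conf n, B' ξ ξ = ∑ j, ∑ k, ξ j * (A j k).im * ξ k := fun ξ => by
    change Matrix.toLinearMap₂' ℝ (A.map Complex.im) (fun j => ξ j) (fun j => ξ j) = _
    rw [Matrix.toLinearMap₂'_apply]
    refine Finset.sum_congr rfl fun j _ => Finset.sum_congr rfl fun k _ => ?_
    simp
    ring
  obtain ⟨c, hc, h⟩ := exists_pos_mul_sq_le B' fun ξ hξ => by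
    change 0 < Matrix.toLinearMap₂' ℝ (A.map Complex.im) (fun j => ξ j) (fun j => ξ j)
    rw [Matrix.toLinearMap₂'_apply']
    have := hP.dotProduct_mulVec_pos (x := fun j => ξ j) fun h0 => hξ (by
      ext j
      exact congrFun h0 j)
    simpa using this
  refine ⟨c / 2, by positivity, fun ξ => ?_⟩
  rw [Complex.norm_exp, Real.exp_le_exp]
  -- Only $\operatorname{Im}A$ enters the modulus.
  have e : (gaussExp A ξ).re = -(1 / 2) * B' ξ ξ := by
    have h1 : (∑ j, ∑ k, (ξ j : ℂ) * A j k * (ξ k : ℂ)).im = B' ξ ξ := by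
      rw [hB]
      simp [Complex.im_sum, Complex.mul_im, Complex.mul_re]
    rw [← h1, gaussExp]
    simp [Complex.mul_re]
  rw [e]
  linarith [h ξ]

theorem exists_isGaussian (hA : A.IsSymm) (hP : (A.map Complex.im).PosDef) :
    ∃ ψ : 𝓢(Conf n, ℂ), IsGaussian A ψ := by
  obtain ⟨c, hc, h⟩ := exists_norm_cexp_gaussExp_le hP
  obtain ⟨ψ, hψ⟩ := exists_schwartz_cexp (hasTemperateGrowth_gaussExp A) fun m =>
    ⟨_, fun ξ => (mul_le_mul_of_nonneg_left (h ξ) (by positivity)).trans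
      (by simpa using one_add_pow_mul_exp_le hc 0 m (norm_nonneg ξ))⟩
  exact ⟨ψ, hA, hP, 1, one_ne_zero, fun ξ => by rw [hψ, one_mul, gaussExp]⟩

end GaussianFunction

/-! ### H-germs -/

section HGerm

variable {n : ℕ} (C : ConstraintPlane n)

/-- The preimage in phase space of a plane of the reduced phase space. -/
def germPlane (S : Submodule ℂ (Reduced (cxPlane C.plane))) : Submodule ℂ (Phase ℂ n) :=
  (S.comap ((cxPlane C.plane).submoduleOf (perp (cxPlane C.plane))).mkQ).map
    (perp (cxPlane C.plane)).subtype

variable {C} in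
theorem mem_germPlane {S : Submodule ℂ (Reduced (cxPlane C.plane))} {Y : Phase ℂ n} :
    Y ∈ germPlane C S ↔
      ∃ h : Y ∈ perp (cxPlane C.plane), Submodule.Quotient.mk ⟨Y, h⟩ ∈ S := by
  constructor
  · rintro ⟨y, hy, rfl⟩
    exact ⟨y.2, hy⟩
  · rintro ⟨h, hY⟩
    exact ⟨⟨Y, h⟩, hY, rfl⟩

theorem germPlane_injective : Function.Injective (germPlane C) := fun _ _ h =>
  Submodule.comap_injective_of_surjective (Submodule.mkQ_surjective _)
    (Submodule.map_injective_of_injective (Submodule.subtype_injective _) h)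

theorem germPlane_map (T : Submodule ℂ (perp (cxPlane C.plane))) :
    germPlane C (T.map ((cxPlane C.plane).submoduleOf (perp (cxPlane C.plane))).mkQ) =
      T.map (perp (cxPlane C.plane)).subtype ⊔ cxPlane C.plane := by
  rw [germPlane, Submodule.comap_map_mkQ, Submodule.map_sup, Submodule.submoduleOf,
    Submodule.map_comap_subtype, inf_eq_right.2 (cxPlane_isotropic C), sup_comm]

/-- Adjoining the complexified plane makes the span independent of the representatives: it is the
full preimage of the span of the classes. -/
theorem span_union_cxPlane {ι : Type} {Y : ι → Reduced (cxPlane C.plane)}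
    {y : ι → perp (cxPlane C.plane)} (hy : ∀ I, Submodule.Quotient.mk (y I) = Y I) :
    Submodule.span ℂ (Set.range (fun I => (y I : Phase ℂ n)) ∪ (cxPlane C.plane : Set _)) =
      germPlane C (Submodule.span ℂ (Set.range Y)) := by
  have e : Set.range Y =
      ((cxPlane C.plane).submoduleOf (perp (cxPlane C.plane))).mkQ '' Set.range y := by
    rw [← Set.range_comp]
    exact congrArg Set.range (funext fun I => (hy I).symm)
  rw [e, ← Submodule.map_span, germPlane_map, Submodule.map_span, ← Set.range_comp,
    Submodule.span_union, Submodule.span_eq]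
  rfl

variable {A : Matrix (Fin n) (Fin n) ℂ} {ψ : 𝓢(Conf n, ℂ)}

theorem germPlane_redLagr :
    germPlane C (redLagr C A) = lagr A ⊓ perp (cxPlane C.plane) ⊔ cxPlane C.plane := by
  rw [redLagr, germPlane_map, Submodule.map_comap_subtype, inf_comm]

theorem IsGaussian.hGerm_eq (h : IsGaussian A ψ) :
    hGerm C ψ = (germPlane C (redLagr C A) : Set (Phase ℂ n)) := by
  ext Y
  rw [SetLike.mem_coe, mem_germPlane]
  constructor
  · intro hY
    exact ⟨hY.1, (redOm_cls_eq_zero_iff C h).1 ((mem_hGerm_iff C ⟨Y, hY.1⟩).1 hY)⟩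
  · rintro ⟨hY, hm⟩
    exact (mem_hGerm_iff C ⟨Y, hY⟩).2 ((redOm_cls_eq_zero_iff C h).2 hm)

/-- Prescribing the germ of a Gaussian amounts to prescribing its annihilator plane in the reduced
space. -/
theorem IsGaussian.hGerm_eq_iff (h : IsGaussian A ψ)
    {S : Submodule ℂ (Reduced (cxPlane C.plane))} :
    hGerm C ψ = (germPlane C S : Set (Phase ℂ n)) ↔ redLagr C A = S := by
  rw [h.hGerm_eq, SetLike.coe_set_eq]
  exact (germPlane_injective C).eq_iff

/-- By the mode expansion the span of the modes equals its own skew-orthogonal complement. Its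
preimage is then Lagrangian, contains the constraint plane, and is positive modulo it by
normalization of the modes. -/
theorem exists_isGaussian_redLagr_eq {Γ : Reduced C.plane ⊗[ℝ] Reduced C.plane} {d : ℕ}
    {β : Fin d → ℝ} {Y : Fin d → Reduced (cxPlane C.plane)}
    (h : IsModeFamily (redSymp (cxPlane C.plane)) (conjRed C.plane) (cxFlow C.plane Γ) β Y)
    (hd : finrank ℂ (Reduced (cxPlane C.plane)) = 2 * d) :
    ∃ (A : Matrix (Fin n) (Fin n) ℂ) (ψ : 𝓢(Conf n, ℂ)), IsGaussian A ψ ∧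
      redLagr C A = Submodule.span ℂ (Set.range Y) := by
  set S := Submodule.span ℂ (Set.range Y)
  have hiso : ∀ X ∈ S, ∀ I, redSymp (cxPlane C.plane) X (Y I) = 0 := by
    intro X hX I
    obtain ⟨c, rfl⟩ := (Submodule.mem_span_range_iff_exists_fun ℂ).1 hX
    simp [map_sum, LinearMap.sum_apply, h.isotropic]
  have hmem : ∀ X, X ∈ S ↔ ∀ Z ∈ S, redSymp (cxPlane C.plane) Z X = 0 := by
    intro X
    constructor
    · intro hX Z hZ
      obtain ⟨c, rfl⟩ := (Submodule.mem_span_range_iff_exists_fun ℂ).1 hX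
      simp [map_sum, hiso Z hZ]
    · intro hX
      rw [h.expansion (redSymp_swap _) (redSymp_conjRed _) hd X]
      refine sum_mem fun I _ => ?_
      rw [redSymp_swap _ X (Y I), hX (Y I) (Submodule.subset_span ⟨I, rfl⟩)]
      simp only [neg_zero, mul_zero, zero_smul, sub_zero]
      exact Submodule.smul_mem _ _ (Submodule.subset_span ⟨I, rfl⟩)
  have hL : cxPlane C.plane ≤ germPlane C S := fun X hX => by
    refine mem_germPlane.2 ⟨cxPlane_isotropic C hX, ?_⟩
    have h0 : (Submodule.Quotient.mk ⟨X, cxPlane_isotropic C hX⟩ : Reduced (cxPlane C.plane)) = 0 :=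
      (Submodule.Quotient.mk_eq_zero _).2 (Submodule.mem_comap.2 hX)
    rw [h0]
    exact zero_mem _
  have hperp : perp (germPlane C S) = germPlane C S := by
    ext X
    constructor
    · intro hX
      have hX' : X ∈ perp (cxPlane C.plane) := perp_antitone hL hX
      refine mem_germPlane.2 ⟨hX', (hmem _).2 fun Z hZ => ?_⟩
      obtain ⟨z, rfl⟩ := Submodule.Quotient.mk_surjective _ Z
      exact hX z (mem_germPlane.2 ⟨z.2, hZ⟩)
    · intro hX Z hZ
      obtain ⟨hX, hX'⟩ := mem_germPlane.1 hX
      obtain ⟨hZ, hZ'⟩ := mem_germPlane.1 hZ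
      exact (hmem _).1 hX' _ hZ'
  obtain ⟨A, hA, hP, hr⟩ := exists_lagr_inf_perp_sup (cxPlane_isotropic C) hperp hL
    fun Z hZ hZ0 => by
      obtain ⟨hZ, hZ'⟩ := mem_germPlane.1 hZ
      exact h.im_pos hZ' fun h0 => hZ0 (Submodule.mem_comap.1
        ((Submodule.Quotient.mk_eq_zero (x := (⟨Z, hZ⟩ : perp (cxPlane C.plane))) _).1 h0))
  obtain ⟨ψ, hψ⟩ := exists_isGaussian hA hP
  refine ⟨A, ψ, hψ, germPlane_injective C ?_⟩
  rw [germPlane_redLagr, hr]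

end HGerm

/-! ### Continuity of the class map -/

section Continuity

variable {n : ℕ}

theorem continuous_Om (Y : Phase ℂ n) : Continuous (Om n Y) := by
  change Continuous fun f => ∑ j, (Y.1 j • posOp j f - Y.2 j • (1 / Complex.I) • partialOp j f)
  have h1 : ∀ j : Fin n, Continuous (posOp j : 𝓢(Conf n, ℂ) → 𝓢(Conf n, ℂ)) := fun j =>
    ContinuousLinearMap.continuous _
  have h2 : ∀ j : Fin n, Continuous (partialOp j : 𝓢(Conf n, ℂ) → 𝓢(Conf n, ℂ)) := fun j =>
    ContinuousLinearMap.continuous _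
  refine continuous_finsetSum _ fun j _ => ?_
  have h3 : Continuous fun f => Y.1 j • posOp j f := (h1 j).const_smul (Y.1 j)
  have h4 : Continuous fun f => (1 / Complex.I) • partialOp j f :=
    (h2 j).const_smul (1 / Complex.I)
  exact h3.sub (h4.const_smul (Y.2 j))

theorem norm_coef_le (f g : 𝓢(Conf n, ℂ)) (X : Phase ℝ n) :
    ‖coef f g X‖ ≤ (∫ ξ, ‖f ξ‖) * SchwartzMap.seminorm ℝ 0 0 g := by
  rw [← integral_mul_const]
  refine norm_integral_le_of_norm_le (integrable_norm_mul f _) (Eventually.of_forall fun ξ => ?_)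
  exact norm_mul_weyl_le f g (fun ξ => SchwartzMap.norm_le_seminorm ℝ g ξ) X ξ

/-- Uniform decay of matrix elements: the bounds tend to zero along with the functions. -/
theorem coef_decay_tendsto {ι : Type} {l : Filter ι} (m : ℕ) : ∀ f g : ι → 𝓢(Conf n, ℂ),
    Tendsto f l (𝓝 0) → Tendsto g l (𝓝 0) → ∃ K : ι → ℝ, Tendsto K l (𝓝 0) ∧
      ∀ i (X : Phase ℝ n), ‖X‖ ^ m * ‖coef (f i) (g i) X‖ ≤ K i := by
  induction m with
  | zero =>
    intro f g hf hg
    refine ⟨fun i => (∫ ξ, ‖f i ξ‖) * SchwartzMap.seminorm ℝ 0 0 (g i), ?_, fun i X => by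
      rw [pow_zero, one_mul]
      exact norm_coef_le _ _ X⟩
    have h1 : Tendsto (fun i => ∫ ξ, ‖f i ξ‖) l (𝓝 0) := by
      have hc : Continuous fun f : 𝓢(Conf n, ℂ) => ‖f.toLp 1 (volume : Measure (Conf n))‖ :=
        (SchwartzMap.continuous_toLp (p := 1)).norm
      have h := (hc.tendsto 0).comp hf
      simpa only [Function.comp_def, SchwartzMap.norm_toLp_one, zero_apply, norm_zero,
        integral_zero] using h
    have h2 : Tendsto (fun i => SchwartzMap.seminorm ℝ 0 0 (g i)) l (𝓝 0) := by
      have hc : Continuous (SchwartzMap.seminorm ℝ 0 0 : Seminorm ℝ 𝓢(Conf n, ℂ)) :=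
        (schwartz_withSeminorms ℝ (Conf n) ℂ).continuous_seminorm (0, 0)
      simpa only [Function.comp_def, map_zero] using (hc.tendsto 0).comp hg
    simpa using h1.mul h2
  | succ m ih =>
    intro f g hf hg
    have hOm : ∀ (Z : Phase ℝ n) (f : ι → 𝓢(Conf n, ℂ)), Tendsto f l (𝓝 0) →
        Tendsto (fun i => Om n (cx n Z) (f i)) l (𝓝 0) := fun Z f hf => by
      have := ((continuous_Om (cx n Z)).tendsto 0).comp hf
      rwa [map_zero] at this
    have key : ∀ Z : Phase ℝ n, ∃ K : ι → ℝ, Tendsto K l (𝓝 0) ∧ ∀ i (X : Phase ℝ n),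
        ‖X‖ ^ m * (‖symp ℝ n X Z‖ * ‖coef (f i) (g i) X‖) ≤ K i := by
      intro Z
      obtain ⟨K₁, t₁, h₁⟩ := ih _ g (hOm Z f hf) hg
      obtain ⟨K₂, t₂, h₂⟩ := ih f _ hf (hOm Z g hg)
      refine ⟨fun i => K₁ i + K₂ i, by simpa using t₁.add t₂, fun i X => ?_⟩
      have e : (symp ℝ n X Z : ℂ) * coef (f i) (g i) X =
          coef (f i) (Om n (cx n Z) (g i)) X - coef (Om n (cx n Z) (f i)) (g i) X := by
        rw [coef_Om_left]; ring
      have e' : ‖symp ℝ n X Z‖ * ‖coef (f i) (g i) X‖ ≤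
          ‖coef (f i) (Om n (cx n Z) (g i)) X‖ + ‖coef (Om n (cx n Z) (f i)) (g i) X‖ := by
        rw [← Complex.norm_real, ← norm_mul, e]
        exact norm_sub_le _ _
      calc _ ≤ ‖X‖ ^ m * (‖coef (f i) (Om n (cx n Z) (g i)) X‖ +
            ‖coef (Om n (cx n Z) (f i)) (g i) X‖) := by gcongr
        _ ≤ _ := by rw [mul_add]; linarith [h₁ i X, h₂ i X]
    choose K tK hK using key
    refine ⟨fun i => ∑ j, (K (0, Pi.single j 1) i + K (Pi.single j 1, 0) i), ?_, fun i X => ?_⟩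
    · have := tendsto_finsetSum (Finset.univ : Finset (Fin n)) fun j _ =>
        (tK (0, Pi.single j 1)).add (tK (Pi.single j 1, 0))
      simpa using this
    · calc ‖X‖ ^ (m + 1) * ‖coef (f i) (g i) X‖ = ‖X‖ ^ m * (‖X‖ * ‖coef (f i) (g i) X‖) := by ring
        _ ≤ ‖X‖ ^ m * ((∑ j, (‖X.1 j‖ + ‖X.2 j‖)) * ‖coef (f i) (g i) X‖) := by
          gcongr
          exact norm_phase_le X
        _ = ∑ j, (‖X‖ ^ m * (‖symp ℝ n X (0, Pi.single j 1)‖ * ‖coef (f i) (g i) X‖) +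
              ‖X‖ ^ m * (‖symp ℝ n X (Pi.single j 1, 0)‖ * ‖coef (f i) (g i) X‖)) := by
          rw [Finset.sum_mul, Finset.mul_sum]
          refine Finset.sum_congr rfl fun j _ => ?_
          have a : symp ℝ n X (0, Pi.single j 1) = X.1 j := by
            simp [symp_apply, Pi.single_apply]
          have b : symp ℝ n X (Pi.single j 1, 0) = - X.2 j := by
            simp [symp_apply, Pi.single_apply]
          rw [a, b, norm_neg]
          ring
        _ ≤ _ := Finset.sum_le_sum fun j _ => add_le_add (hK _ i X) (hK _ i X)

theorem one_add_norm_pow_mul_le {E F : Type*} [SeminormedAddCommGroup E] [SeminormedAddCommGroup F]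
    {r : ℕ} {K₀ K₁ : ℝ} {X : E} {u : F} (h₀ : ‖u‖ ≤ K₀) (h₁ : ‖X‖ ^ r * ‖u‖ ≤ K₁) :
    (1 + ‖X‖) ^ r * ‖u‖ ≤ 2 ^ (r - 1) * (K₀ + K₁) := by
  have := add_pow_le (zero_le_one' ℝ) (norm_nonneg X) r
  calc _ ≤ (2 ^ (r - 1) * (1 ^ r + ‖X‖ ^ r)) * ‖u‖ := by gcongr
    _ = 2 ^ (r - 1) * (‖u‖ + ‖X‖ ^ r * ‖u‖) := by ring
    _ ≤ _ := by gcongr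

variable (C : ConstraintPlane n)

/-- An exponent for which `(1 + ‖X‖)⁻ʳ` is integrable on the constraint plane. -/
def decayExp : ℕ := finrank ℝ C.plane + 1

theorem integrable_decay : Integrable (fun X : C.plane => ((1 + ‖X‖) ^ decayExp C)⁻¹) C.μ := by
  have := integrable_one_add_norm (E := C.plane) (μ := C.μ) (r := (decayExp C : ℝ))
    (by simp [decayExp])
  refine this.congr (Eventually.of_forall fun X => ?_)
  simp only
  rw [Real.rpow_neg (by positivity), Real.rpow_natCast]

theorem norm_sq_cls (f : 𝓢(Conf n, ℂ)) : ‖cls C f‖ ^ 2 = (form C f f).re := by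
  rw [← inner_cls, ← inner_self_eq_norm_sq (𝕜 := ℂ)]
  rfl

/-- Decay bounds that tend to zero together with $f_i$ dominate the integrand of $\langle
f_i,f_i\rangle$ by a fixed integrable weight. -/
theorem tendsto_cls {ι : Type} {l : Filter ι} {f : ι → 𝓢(Conf n, ℂ)} (hf : Tendsto f l (𝓝 0)) :
    Tendsto (fun i => cls C (f i)) l (𝓝 0) := by
  obtain ⟨K₀, t₀, h₀⟩ := coef_decay_tendsto 0 f f hf hf
  obtain ⟨K₁, t₁, h₁⟩ := coef_decay_tendsto (decayExp C) f f hf hf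
  set c := ∫ X : C.plane, ((1 + ‖X‖) ^ decayExp C)⁻¹ ∂C.μ
  have hle : ∀ i, ‖cls C (f i)‖ ^ 2 ≤ c * (2 ^ (decayExp C - 1) * (K₀ i + K₁ i)) := by
    intro i
    rw [norm_sq_cls]
    refine (Complex.re_le_norm _).trans ?_
    rw [form, ← integral_mul_const]
    refine norm_integral_le_of_norm_le ((integrable_decay C).mul_const _)
      (Eventually.of_forall fun X => ?_)
    rw [inv_mul_eq_div, le_div_iff₀ (by positivity), mul_comm]
    exact one_add_norm_pow_mul_le (by simpa using h₀ i X) (h₁ i X)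
  have hlim : Tendsto (fun i => c * (2 ^ (decayExp C - 1) * (K₀ i + K₁ i))) l (𝓝 0) := by
    simpa using ((t₀.add t₁).const_mul (2 ^ (decayExp C - 1) : ℝ)).const_mul c
  have hsq := squeeze_zero (fun i => sq_nonneg ‖cls C (f i)‖) hle hlim
  rw [tendsto_zero_iff_norm_tendsto_zero]
  have := (Real.continuous_sqrt.tendsto 0).comp hsq
  simpa only [Function.comp_def, Real.sqrt_sq (norm_nonneg _), Real.sqrt_zero] using this

/-- The class map as a linear map. -/
def clsLM : 𝓢(Conf n, ℂ) →ₗ[ℂ] States C where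
  toFun := cls C
  map_add' := cls_add C
  map_smul' := cls_smul C

theorem continuous_clsLM : Continuous (clsLM C) := by
  refine continuous_of_continuousAt_zero (clsLM C).toAddMonoidHom ?_
  change Tendsto (clsLM C) (𝓝 0) (𝓝 (clsLM C 0))
  rw [map_zero]
  exact tendsto_cls C tendsto_id

end Continuity

/-! ### Polynomials times a Gaussian -/

section Words

variable {n : ℕ} {A : Matrix (Fin n) (Fin n) ℂ} {ψ : 𝓢(Conf n, ℂ)}

/-- The span of the functions obtained from `ψ` by applying at most `m` operators `Ω(W)`. -/
def wordSpan (ψ : 𝓢(Conf n, ℂ)) : ℕ → Submodule ℂ 𝓢(Conf n, ℂ)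
  | 0 => Submodule.span ℂ {ψ}
  | m + 1 => wordSpan ψ m ⊔ Submodule.span ℂ {g | ∃ W, ∃ f ∈ wordSpan ψ m, Om n W f = g}

theorem Om_mem_wordSpan {m : ℕ} {f : 𝓢(Conf n, ℂ)} (hf : f ∈ wordSpan ψ m) (W : Phase ℂ n) :
    Om n W f ∈ wordSpan ψ (m + 1) :=
  Submodule.mem_sup_right (Submodule.subset_span ⟨W, f, hf, rfl⟩)

theorem wordSpan_succ_le {m : ℕ} {S : Submodule ℂ 𝓢(Conf n, ℂ)} (h : wordSpan ψ m ≤ S)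
    (h' : ∀ W, ∀ f ∈ wordSpan ψ m, Om n W f ∈ S) : wordSpan ψ (m + 1) ≤ S := by
  refine sup_le h (Submodule.span_le.2 ?_)
  rintro _ ⟨W, f, hf, rfl⟩
  exact h' W f hf

theorem pow_Om_mem_wordSpan (W : Phase ℂ n) (m : ℕ) : (Om n W ^ m) ψ ∈ wordSpan ψ m := by
  induction m with
  | zero => exact Submodule.mem_span_singleton_self ψ
  | succ m ih =>
    rw [pow_succ', Module.End.mul_apply]
    exact Om_mem_wordSpan ih W

/-- An annihilator does not lengthen a word: moved to the right it drops one letter at each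
commutator and finally kills $\psi$. -/
theorem IsGaussian.Om_lagr_mem_wordSpan (h : IsGaussian A ψ) {B : Phase ℂ n} (hB : B ∈ lagr A)
    (m : ℕ) : wordSpan ψ m ≤ (wordSpan ψ m).comap (Om n B) := by
  induction m with
  | zero =>
    refine Submodule.span_le.2 ?_
    rintro _ rfl
    change Om n B _ ∈ wordSpan _ 0
    rw [h.Om_eq_zero hB]
    exact zero_mem _
  | succ m ih =>
    refine wordSpan_succ_le (fun f hf => Om_mem_wordSpan hf B) fun W f hf => ?_
    rw [Submodule.mem_comap, Om_commutator]
    exact add_mem (Om_mem_wordSpan (ih hf) W)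
      (Submodule.smul_mem _ _ (Submodule.mem_sup_left hf))

/-- Each letter splits as $W=V^*+X+B$: $V^*$ is a combination of creation operators, $X$ maps to
null vectors, and $B$ returns to shorter words. So arbitrary $\Omega(W)$ are allowed, even those
that do not descend to classes. -/
theorem IsGaussian.wordSpan_le (C : ConstraintPlane n) (h : IsGaussian A ψ)
    {Γ : Reduced C.plane ⊗[ℝ] Reduced C.plane} {d : ℕ} {β : Fin d → ℝ}
    {Y : Fin d → Reduced (cxPlane C.plane)}
    (hY : IsModeFamily (redSymp (cxPlane C.plane)) (conjRed C.plane) (cxFlow C.plane Γ) β Y)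
    (hA : redLagr C A = Submodule.span ℂ (Set.range Y)) (m : ℕ) :
    wordSpan ψ m ≤ (excitedSpan C Y ψ).comap (clsLM C) := by
  induction m with
  | zero =>
    refine Submodule.span_le.2 ?_
    rintro _ rfl
    exact cls_mem_excitedSpan C
  | succ m ih =>
    refine wordSpan_succ_le ih fun W f hf => ?_
    obtain ⟨V, ⟨hV, hV'⟩, X, hX, B, hB, rfl⟩ := exists_decomp h.1 h.2.1 C.plane W
    rw [map_add, map_add, LinearMap.add_apply, LinearMap.add_apply]
    refine add_mem (add_mem ?_ ?_) (ih (h.Om_lagr_mem_wordSpan hB m hf))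
    · have hm : (Submodule.Quotient.mk ⟨V, hV'⟩ : Reduced (cxPlane C.plane)) ∈
          Submodule.span ℂ (Set.range Y) := hA ▸ ⟨⟨V, hV'⟩, hV, rfl⟩
      exact redOm_conj_mem_excitedSpan C hY hm (ih hf)
    · have h0 : clsLM C (Om n X f) = 0 := cls_Om_cxPlane C hX f
      rw [Submodule.mem_comap, h0]
      exact zero_mem _

end Words

/-! ### Plane waves times a Gaussian -/

section PlaneWaves

open scoped ContDiff

/-- Termwise, $r^j\le 2^{-M}(2r)^j$ for $j\ge M$: geometric smallness is bought with the faster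
exponential $e^{2r}$, which a Gaussian can afford. -/
theorem exp_sub_sum_le {r : ℝ} (hr : 0 ≤ r) (M : ℕ) :
    Real.exp r - ∑ m ∈ Finset.range M, r ^ m / m.factorial ≤ (1 / 2) ^ M * Real.exp (2 * r) := by
  have hs := Real.summable_pow_div_factorial r
  have hs2 := Real.summable_pow_div_factorial (2 * r)
  have e : ∀ x : ℝ, Real.exp x = ∑' m : ℕ, x ^ m / m.factorial := fun x => by
    rw [Real.exp_eq_exp_ℝ, NormedSpace.exp_eq_tsum_div]
  have h1 := hs.sum_add_tsum_nat_add M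
  have h2 := hs2.sum_add_tsum_nat_add M
  rw [← e] at h1 h2
  have h3 : ∑' m : ℕ, r ^ (m + M) / (m + M).factorial ≤
      ∑' m : ℕ, (1 / 2) ^ M * ((2 * r) ^ (m + M) / (m + M).factorial) := by
    refine Summable.tsum_le_tsum (fun m => ?_) ((summable_nat_add_iff M).2 hs)
      (((summable_nat_add_iff M).2 hs2).mul_left _)
    rw [← mul_div_assoc]
    gcongr
    rw [mul_pow, ← mul_assoc, pow_add 2 m M]
    have : (1 / 2 : ℝ) ^ M * (2 ^ m * 2 ^ M) = 2 ^ m := by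
      rw [mul_left_comm, ← mul_pow]
      norm_num
    rw [this]
    exact le_mul_of_one_le_left (by positivity) (one_le_pow₀ (by norm_num))
  rw [tsum_mul_left] at h3
  have h4 : 0 ≤ ∑ m ∈ Finset.range M, (2 * r) ^ m / (m.factorial : ℝ) :=
    Finset.sum_nonneg fun m _ => by positivity
  have h5 : ∑' m : ℕ, (2 * r) ^ (m + M) / ((m + M).factorial : ℝ) ≤ Real.exp (2 * r) := by linarith
  calc _ = ∑' m : ℕ, r ^ (m + M) / (m + M).factorial := by linarith
    _ ≤ _ := h3
    _ ≤ _ := by gcongr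

/-- The remainder of the exponential series of `e^{it}`. -/
def expRem (M : ℕ) (t : ℝ) : ℂ :=
  Complex.exp (Complex.I * t) - ∑ m ∈ Finset.range M, (Complex.I * t) ^ m / m.factorial

theorem norm_expRem_le (M : ℕ) (t : ℝ) : ‖expRem M t‖ ≤ (1 / 2) ^ M * Real.exp (2 * |t|) := by
  refine (Complex.norm_exp_sub_sum_le_exp_norm_sub_sum (Complex.I * t) M).trans ?_
  have : ‖Complex.I * (t : ℂ)‖ = |t| := by simp
  rw [this]
  exact exp_sub_sum_le (abs_nonneg t) M

/-- Truncated subtraction is right at $M=0$, where the remainder is the full exponential. -/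
theorem hasDerivAt_expRem (M : ℕ) (t : ℝ) :
    HasDerivAt (expRem M) (Complex.I * expRem (M - 1) t) t := by
  have hid : HasDerivAt (fun s : ℝ => Complex.I * (s : ℂ)) Complex.I t := by
    simpa using ((hasDerivAt_id t).ofReal_comp).const_mul Complex.I
  have hsum : HasDerivAt (fun s : ℝ => ∑ m ∈ Finset.range M, (Complex.I * (s : ℂ)) ^ m / m.factorial)
      (Complex.I * ∑ m ∈ Finset.range (M - 1), (Complex.I * (t : ℂ)) ^ m / m.factorial) t := by
    rcases M with _ | M
    · simpa using hasDerivAt_const t (0 : ℂ)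
    · have h1 : HasDerivAt (fun s : ℝ => ∑ m ∈ Finset.range (M + 1),
          (Complex.I * (s : ℂ)) ^ m / m.factorial)
          (∑ m ∈ Finset.range (M + 1),
            (m : ℂ) * (Complex.I * (t : ℂ)) ^ (m - 1) * Complex.I / m.factorial) t :=
        HasDerivAt.fun_sum fun m _ => (hid.pow m).div_const _
      refine h1.congr_deriv ?_
      rw [Finset.sum_range_succ', Finset.mul_sum]
      simp only [Nat.cast_zero, zero_mul, zero_div, add_zero, Nat.add_sub_cancel]
      refine Finset.sum_congr rfl fun m _ => ?_
      rw [Nat.factorial_succ]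
      push_cast
      have : (m : ℂ) + 1 ≠ 0 := by exact_mod_cast Nat.succ_ne_zero m
      have : (m.factorial : ℂ) ≠ 0 := by exact_mod_cast m.factorial_ne_zero
      field_simp
  refine (hid.cexp.sub hsum).congr_deriv ?_
  rw [expRem]
  ring

theorem iteratedDeriv_expRem (i M : ℕ) :
    iteratedDeriv i (expRem M) = fun t => Complex.I ^ i * expRem (M - i) t := by
  induction i with
  | zero => ext t; simp
  | succ i ih =>
    rw [iteratedDeriv_succ, ih]
    ext t
    rw [((hasDerivAt_expRem (M - i) t).const_mul (Complex.I ^ i)).deriv, Nat.sub_sub]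
    ring

theorem contDiff_expRem (M : ℕ) : ContDiff ℝ ∞ (expRem M) := by
  unfold expRem
  refine ContDiff.sub ?_ (ContDiff.sum fun m _ => ?_)
  · exact (contDiff_const.mul Complex.ofRealCLM.contDiff).cexp
  · exact ((contDiff_const.mul Complex.ofRealCLM.contDiff).pow m).div_const _

theorem norm_iteratedFDeriv_expRem_le {i l : ℕ} (hi : i ≤ l) (M : ℕ) (t : ℝ) :
    ‖iteratedFDeriv ℝ i (expRem M) t‖ ≤ 2 ^ l * (1 / 2) ^ M * Real.exp (2 * |t|) := by
  rw [norm_iteratedFDeriv_eq_norm_iteratedDeriv, iteratedDeriv_expRem, norm_mul, norm_pow,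
    Complex.norm_I, one_pow, one_mul]
  refine (norm_expRem_le _ _).trans ?_
  gcongr
  -- Differentiation loses up to $l$ powers of $\frac12$, which $2^l$ pays for; this is valid also
  -- when $M<i$.
  have h1 : (1 / 2 : ℝ) ^ (M - i) = 2 ^ l * (1 / 2) ^ (l + (M - i)) := by
    rw [pow_add, ← mul_assoc, ← mul_pow]
    norm_num
  rw [h1]
  gcongr ?_ * ?_
  exact pow_le_pow_of_le_one (by norm_num) (by norm_num) (by omega)

end PlaneWaves

/-! ### Convergence and product estimates in Schwartz space. -/

section SchwartzConvergence

open scoped ContDiff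

variable {n : ℕ}

theorem tendsto_schwartz_zero {ι : Type} {L : Filter ι} {f : ι → 𝓢(Conf n, ℂ)}
    (h : ∀ k l, Tendsto (fun i => SchwartzMap.seminorm ℝ k l (f i)) L (𝓝 0)) :
    Tendsto f L (𝓝 0) := by
  rw [(schwartz_withSeminorms ℝ (Conf n) ℂ).tendsto_nhds]
  intro p ε hε
  filter_upwards [(h p.1 p.2).eventually_lt_const hε] with i hi
  rw [sub_zero]
  exact hi

/-- The Leibniz rule with weight $w$: growth of the small factor $g$ is absorbed by the decay of
$f$. It serves both the exponential series and the truncations. -/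
theorem seminorm_mul_le {k l : ℕ} {g : Conf n → ℂ} (hg : ContDiff ℝ ∞ g) {f F : 𝓢(Conf n, ℂ)}
    (hF : ∀ x, F x = g x * f x) {w : Conf n → ℝ} {ε B : ℝ} (hε : 0 ≤ ε) (hB : 0 ≤ B)
    (h1 : ∀ i ≤ l, ∀ x, ‖iteratedFDeriv ℝ i g x‖ ≤ ε * w x)
    (h2 : ∀ i ≤ l, ∀ x, ‖x‖ ^ k * (w x * ‖iteratedFDeriv ℝ i f x‖) ≤ B) :
    SchwartzMap.seminorm ℝ k l F ≤ 2 ^ l * (ε * B) := by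
  refine SchwartzMap.seminorm_le_bound ℝ k l F (by positivity) fun x => ?_
  have hF' : (F : Conf n → ℂ) = fun x => g x * f x := funext hF
  rw [hF']
  have h := norm_iteratedFDeriv_mul_le (𝕜 := ℝ) hg (f.smooth ⊤) x (n := l)
    (mod_cast le_top)
  calc _ ≤ ‖x‖ ^ k * ∑ i ∈ Finset.range (l + 1), (l.choose i : ℝ) * ‖iteratedFDeriv ℝ i g x‖ *
        ‖iteratedFDeriv ℝ (l - i) f x‖ := by gcongr
    _ = ∑ i ∈ Finset.range (l + 1), (l.choose i : ℝ) * (‖iteratedFDeriv ℝ i g x‖ *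
        (‖x‖ ^ k * ‖iteratedFDeriv ℝ (l - i) f x‖)) := by
      rw [Finset.mul_sum]
      exact Finset.sum_congr rfl fun i _ => by ring
    _ ≤ ∑ i ∈ Finset.range (l + 1), (l.choose i : ℝ) * (ε * B) := by
      refine Finset.sum_le_sum fun i hi => ?_
      have hil : i ≤ l := Nat.lt_succ_iff.1 (Finset.mem_range.1 hi)
      refine mul_le_mul_of_nonneg_left ?_ (Nat.cast_nonneg _)
      calc _ ≤ (ε * w x) * (‖x‖ ^ k * ‖iteratedFDeriv ℝ (l - i) f x‖) :=
            mul_le_mul_of_nonneg_right (h1 i hil x) (by positivity)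
        _ = ε * (‖x‖ ^ k * (w x * ‖iteratedFDeriv ℝ (l - i) f x‖)) := by ring
        _ ≤ _ := mul_le_mul_of_nonneg_left (h2 _ (Nat.sub_le _ _) x) hε
    _ = 2 ^ l * (ε * B) := by
      rw [← Finset.sum_mul, ← Nat.cast_sum, Nat.sum_range_choose]
      push_cast
      ring

end SchwartzConvergence

/-! ### Plane waves as limits of polynomials times a Gaussian. -/

section PlaneWaves

open scoped ContDiff

variable {n : ℕ}

theorem hasTemperateGrowth_cexp_inner (P : Conf n) :
    Function.HasTemperateGrowth (fun ξ : Conf n => Complex.exp (Complex.I * (inner ℝ P ξ : ℝ))) := by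
  have hq : Function.HasTemperateGrowth (fun ξ : Conf n => Complex.I * ((inner ℝ P ξ : ℝ) : ℂ)) :=
    (Function.HasTemperateGrowth.const _).mul
      (Complex.ofRealCLM.comp (innerSL ℝ P)).hasTemperateGrowth
  refine ⟨Complex.contDiff_exp.comp hq.1, fun l => ?_⟩
  obtain ⟨k, K, hK, h⟩ := norm_iteratedFDeriv_cexp_comp_le hq l
  refine ⟨k, K, fun x => (h l le_rfl x).trans ?_⟩
  rw [mul_comm Complex.I, Complex.norm_exp_ofReal_mul_I, mul_one]

/-- Multiplication by the plane wave `e^{i⟨P, ξ⟩}`. -/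
def waveMul (P : Conf n) : 𝓢(Conf n, ℂ) →L[ℂ] 𝓢(Conf n, ℂ) :=
  SchwartzMap.smulLeftCLM ℂ fun ξ : Conf n => Complex.exp (Complex.I * (inner ℝ P ξ : ℝ))

theorem waveMul_apply (P : Conf n) (f : 𝓢(Conf n, ℂ)) (ξ : Conf n) :
    waveMul P f ξ = Complex.exp (Complex.I * (inner ℝ P ξ : ℝ)) * f ξ :=
  SchwartzMap.smulLeftCLM_apply_apply (hasTemperateGrowth_cexp_inner P) f ξ

theorem pow_Om_inner_apply (P : Conf n) (f : 𝓢(Conf n, ℂ)) (m : ℕ) (ξ : Conf n) :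
    (Om n (fun j => (P j : ℂ), 0) ^ m) f ξ = ((inner ℝ P ξ : ℝ) : ℂ) ^ m * f ξ := by
  induction m with
  | zero => simp
  | succ m ih =>
    rw [pow_succ', Module.End.mul_apply, Om_apply]
    simp only [Pi.zero_apply, mul_zero, zero_mul, add_zero, ih]
    have e : ((inner ℝ P ξ : ℝ) : ℂ) = ∑ j, (P j : ℂ) * (ξ j : ℂ) := by
      rw [PiLp.inner_apply]
      push_cast
      exact Finset.sum_congr rfl fun j _ => by simp [mul_comm]
    rw [pow_succ', e, mul_assoc, Finset.sum_mul]
    exact Finset.sum_congr rfl fun j _ => by ring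

variable {A : Matrix (Fin n) (Fin n) ℂ} {ψ : 𝓢(Conf n, ℂ)}

theorem IsGaussian.exists_decay (h : IsGaussian A ψ) :
    ∃ c > 0, ∀ l : ℕ, ∃ (k : ℕ) (K : ℝ), 0 ≤ K ∧ ∀ i ≤ l, ∀ x,
      ‖iteratedFDeriv ℝ i ψ x‖ ≤ K * (1 + ‖x‖) ^ k * Real.exp (-(c * ‖x‖ ^ 2)) := by
  obtain ⟨hA, hP, a, ha, hψ⟩ := h
  obtain ⟨c, hc, hle⟩ := exists_norm_cexp_gaussExp_le hP
  have hq : Function.HasTemperateGrowth (fun ξ => Complex.log a + gaussExp A ξ) :=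
    (Function.HasTemperateGrowth.const _).add (hasTemperateGrowth_gaussExp A)
  have e : (ψ : Conf n → ℂ) = fun ξ => Complex.exp (Complex.log a + gaussExp A ξ) := by
    ext ξ
    rw [Complex.exp_add, Complex.exp_log ha, hψ, gaussExp]
  refine ⟨c, hc, fun l => ?_⟩
  obtain ⟨k, K, hK, hb⟩ := norm_iteratedFDeriv_cexp_comp_le hq l
  refine ⟨k, K * ‖a‖, by positivity, fun i hi x => ?_⟩
  rw [e]
  refine (hb i hi x).trans ?_
  rw [Complex.exp_add, Complex.exp_log ha, norm_mul]
  calc _ ≤ K * (1 + ‖x‖) ^ k * (‖a‖ * Real.exp (-(c * ‖x‖ ^ 2))) := by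
        gcongr
        exact hle x
    _ = _ := by ring

theorem exists_norm_iteratedFDeriv_expRem_inner_le (P : Conf n) (l : ℕ) :
    ∃ (k : ℕ) (K : ℝ), 0 ≤ K ∧ ∀ M : ℕ, ∀ i ≤ l, ∀ x : Conf n,
      ‖iteratedFDeriv ℝ i (fun x => expRem M (inner ℝ P x)) x‖ ≤
        K * (1 / 2) ^ M * ((1 + ‖x‖) ^ k * Real.exp (2 * ‖P‖ * ‖x‖)) := by
  have hq : Function.HasTemperateGrowth (fun x : Conf n => (inner ℝ P x : ℝ)) :=
    (innerSL ℝ P).hasTemperateGrowth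
  obtain ⟨k, K, hK, hb⟩ := hq.norm_iteratedFDeriv_le_uniform l
  refine ⟨k * l, l.factorial * 2 ^ l * (K + 1) ^ l, by positivity, fun M i hi x => ?_⟩
  have hx : 1 ≤ (1 + ‖x‖) ^ k := one_le_pow₀ (by linarith [norm_nonneg x])
  have hD : 1 ≤ (K + 1) * (1 + ‖x‖) ^ k := by nlinarith
  have h1 := norm_iteratedFDeriv_comp_le (g := expRem M) (f := fun x : Conf n => (inner ℝ P x : ℝ))
    (n := i) (N := ∞) (contDiff_expRem M) hq.1 (mod_cast le_top) x
    (C := 2 ^ l * (1 / 2) ^ M * Real.exp (2 * |inner ℝ P x|)) (D := (K + 1) * (1 + ‖x‖) ^ k)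
    (fun j hj => norm_iteratedFDeriv_expRem_le (hj.trans hi) M _) (fun j hj hji => by
      refine (hb j (hji.trans hi) x).trans ((?_ : _ ≤ (K + 1) * (1 + ‖x‖) ^ k).trans
        (le_self_pow₀ hD (by omega)))
      gcongr
      linarith)
  refine h1.trans ?_
  have hip : |inner ℝ P x| ≤ ‖P‖ * ‖x‖ := abs_real_inner_le_norm P x
  calc _ ≤ (l.factorial : ℝ) * (2 ^ l * (1 / 2) ^ M * Real.exp (2 * (‖P‖ * ‖x‖))) *
        ((K + 1) * (1 + ‖x‖) ^ k) ^ l := by gcongr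
    _ = _ := by rw [mul_pow, ← pow_mul, ← mul_assoc 2]; ring

/-- The exponential series of a plane wave times a Gaussian converges in Schwartz space. -/
theorem IsGaussian.tendsto_waveMul (h : IsGaussian A ψ) (P : Conf n) :
    Tendsto (fun M => ∑ m ∈ Finset.range M,
      (Complex.I ^ m / m.factorial) • (Om n (fun j => (P j : ℂ), 0) ^ m) ψ) atTop
      (𝓝 (waveMul P ψ)) := by
  rw [← tendsto_sub_nhds_zero_iff]
  suffices hs : Tendsto (fun M => waveMul P ψ - ∑ m ∈ Finset.range M,
      (Complex.I ^ m / m.factorial) • (Om n (fun j => (P j : ℂ), 0) ^ m) ψ) atTop (𝓝 0) by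
    simpa only [neg_sub, neg_zero] using hs.neg
  refine tendsto_schwartz_zero fun k l => ?_
  obtain ⟨k₁, K₁, hK₁, h₁⟩ := exists_norm_iteratedFDeriv_expRem_inner_le P l
  obtain ⟨c, hc, hdecay⟩ := h.exists_decay
  obtain ⟨k₂, K₂, hK₂, h₂⟩ := hdecay l
  -- The constant from completing the square: polynomial weights of total degree $k+k_1+k_2$ and
  -- $e^{2\|P\|\|x\|}$ against $e^{-c\|x\|^2}$.
  set B := K₂ * Real.exp (((k + k₁ + k₂ : ℕ) + 2 * ‖P‖) ^ 2 / (4 * c))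
  have hle : ∀ M, SchwartzMap.seminorm ℝ k l (waveMul P ψ - ∑ m ∈ Finset.range M,
      (Complex.I ^ m / m.factorial) • (Om n (fun j => (P j : ℂ), 0) ^ m) ψ) ≤
      2 ^ l * (K₁ * (1 / 2) ^ M * B) := by
    intro M
    refine seminorm_mul_le (g := fun x => expRem M (inner ℝ P x)) (f := ψ)
      (w := fun x => (1 + ‖x‖) ^ k₁ * Real.exp (2 * ‖P‖ * ‖x‖))
      ((contDiff_expRem M).comp (innerSL ℝ P).contDiff) (fun x => ?_) (by positivity)
      (by positivity) (h₁ M) fun i hi x => ?_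
    · rw [sub_apply, sum_apply, waveMul_apply, expRem, sub_mul, Finset.sum_mul]
      congr 1
      refine Finset.sum_congr rfl fun m _ => ?_
      rw [smul_apply, pow_Om_inner_apply, smul_eq_mul, mul_pow]
      ring
    · calc _ ≤ (1 + ‖x‖) ^ k * ((1 + ‖x‖) ^ k₁ * Real.exp (2 * ‖P‖ * ‖x‖) *
            (K₂ * (1 + ‖x‖) ^ k₂ * Real.exp (-(c * ‖x‖ ^ 2)))) := by
            gcongr
            · linarith
            · exact h₂ i hi x
        _ = K₂ * ((1 + ‖x‖) ^ (k + k₁ + k₂) *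
            Real.exp (2 * ‖P‖ * ‖x‖ - c * ‖x‖ ^ 2)) := by
          rw [sub_eq_add_neg, Real.exp_add, pow_add, pow_add]
          ring
        _ ≤ _ := mul_le_mul_of_nonneg_left
          (one_add_pow_mul_exp_le hc _ _ (norm_nonneg x)) hK₂
  refine squeeze_zero (fun M => apply_nonneg _ _) hle ?_
  have h0 : Tendsto (fun M : ℕ => (1 / 2 : ℝ) ^ M) atTop (𝓝 0) :=
    tendsto_pow_atTop_nhds_zero_of_lt_one (by norm_num) (by norm_num)
  simpa using ((h0.const_mul K₁).mul_const B).const_mul (2 ^ l : ℝ)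

/-- The Schwartz functions whose class lies in the closed span of the excited states. -/
def excitedClosure (C : ConstraintPlane n) {d : ℕ} (Y : Fin d → Reduced (cxPlane C.plane))
    (ψ : 𝓢(Conf n, ℂ)) : Submodule ℂ 𝓢(Conf n, ℂ) :=
  (excitedSpan C Y ψ).topologicalClosure.comap (clsLM C)

theorem isClosed_excitedClosure (C : ConstraintPlane n) {d : ℕ}
    (Y : Fin d → Reduced (cxPlane C.plane)) (ψ : 𝓢(Conf n, ℂ)) :
    IsClosed (excitedClosure C Y ψ : Set 𝓢(Conf n, ℂ)) :=
  (Submodule.isClosed_topologicalClosure _).preimage (continuous_clsLM C)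

theorem IsGaussian.waveMul_mem (C : ConstraintPlane n) (h : IsGaussian A ψ)
    {Γ : Reduced C.plane ⊗[ℝ] Reduced C.plane} {d : ℕ} {β : Fin d → ℝ}
    {Y : Fin d → Reduced (cxPlane C.plane)}
    (hY : IsModeFamily (redSymp (cxPlane C.plane)) (conjRed C.plane) (cxFlow C.plane Γ) β Y)
    (hA : redLagr C A = Submodule.span ℂ (Set.range Y)) (P : Conf n) :
    waveMul P ψ ∈ excitedClosure C Y ψ := by
  refine (isClosed_excitedClosure C Y ψ).mem_of_tendsto (h.tendsto_waveMul P)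
    (Eventually.of_forall fun M => ?_)
  refine sum_mem fun m _ => Submodule.smul_mem _ _ ?_
  exact Submodule.le_topologicalClosure _ (h.wordSpan_le C hY hA m (pow_Om_mem_wordSpan _ m))

end PlaneWaves

/-! ### Superpositions of plane waves -/

section Superposition

open scoped FourierTransform

variable {n : ℕ}

/-- The phase space vector `(P, 0)`. -/
def momentum (P : Conf n) : Phase ℝ n := (fun j => P j, 0)

theorem continuous_momentum : Continuous (momentum : Conf n → Phase ℝ n) := by
  unfold momentum
  fun_prop

theorem norm_momentum_le (P : Conf n) : ‖momentum P‖ ≤ ‖P‖ := by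
  rw [Prod.norm_def]
  refine max_le ((pi_norm_le_iff_of_nonneg (norm_nonneg P)).2 fun j => ?_) (by simp [momentum])
  exact PiLp.norm_apply_le P j

theorem inner_eq_sum (P ξ : Conf n) : (inner ℝ P ξ : ℝ) = ∑ j, P j * ξ j := by
  rw [PiLp.inner_apply]
  exact Finset.sum_congr rfl fun j _ => by simp [mul_comm]

theorem weyl_waveMul (P : Conf n) (f : 𝓢(Conf n, ℂ)) (X : Phase ℝ n) (ξ : Conf n) :
    weyl X (waveMul P f) ξ =
      Complex.exp (Complex.I * (inner ℝ P (ξ - WithLp.toLp 2 X.2) : ℝ)) * weyl X f ξ := by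
  rw [weyl, waveMul_apply, weyl]
  ring

/-- A plane wave is a Weyl translation in momentum, so up to a phase it shifts the argument of the
matrix element. -/
theorem coef_waveMul_right (P : Conf n) (f g : 𝓢(Conf n, ℂ)) (X : Phase ℝ n) :
    coef g (waveMul P f) X =
      Complex.exp (-(Complex.I * ((∑ j, P j * (X.2 j / 2) : ℝ) : ℂ))) *
        coef g f (X + momentum P) := by
  rw [coef, coef, ← integral_const_mul]
  refine integral_congr_ae (Eventually.of_forall fun ξ => ?_)
  simp only [weyl_waveMul]
  have e1 : (X + momentum P).2 = X.2 := by simp [momentum]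
  have e2 : ∑ j, (X + momentum P).1 j * (ξ j - X.2 j / 2) =
      inner ℝ P (ξ - WithLp.toLp 2 X.2) + ∑ j, X.1 j * (ξ j - X.2 j / 2) +
        ∑ j, P j * (X.2 j / 2) := by
    rw [inner_eq_sum, ← Finset.sum_add_distrib, ← Finset.sum_add_distrib]
    exact Finset.sum_congr rfl fun j _ => by simp [momentum]; ring
  rw [weyl, weyl, e1, e2, Complex.ofReal_add, Complex.ofReal_add, mul_add, mul_add,
    Complex.exp_add, Complex.exp_add, Complex.exp_neg]
  have := Complex.exp_ne_zero (Complex.I * ((∑ j, P j * (X.2 j / 2) : ℝ) : ℂ))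
  generalize Complex.exp (Complex.I * ((∑ j, P j * (X.2 j / 2) : ℝ) : ℂ)) = z at *
  generalize Complex.exp (Complex.I * ((∑ j, X.1 j * (ξ j - X.2 j / 2) : ℝ) : ℂ)) = y
  field_simp

theorem coef_waveMul_waveMul (P : Conf n) (f g : 𝓢(Conf n, ℂ)) (X : Phase ℝ n) :
    coef (waveMul P g) (waveMul P f) X =
      Complex.exp (-(Complex.I * (inner ℝ P (WithLp.toLp 2 X.2) : ℝ))) * coef g f X := by
  rw [coef, coef, ← integral_const_mul]
  refine integral_congr_ae (Eventually.of_forall fun ξ => ?_)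
  simp only [weyl_waveMul]
  rw [waveMul_apply, inner_sub_right, map_mul, ← Complex.exp_conj, map_mul, Complex.conj_I,
    Complex.conj_ofReal, Complex.ofReal_sub, mul_sub, Complex.exp_sub, neg_mul, Complex.exp_neg,
    Complex.exp_neg]
  have := Complex.exp_ne_zero (Complex.I * (inner ℝ P ξ : ℝ))
  field_simp

variable (C : ConstraintPlane n)

/-- With the wave on both sides only a phase remains, so the bound is uniform in $P$. -/
theorem norm_cls_waveMul_le (f : 𝓢(Conf n, ℂ)) (P : Conf n) :
    ‖cls C (waveMul P f)‖ ≤ Real.sqrt (∫ X : C.plane, ‖coef f f (X : Phase ℝ n)‖ ∂C.μ) := by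
  refine Real.le_sqrt_of_sq_le ?_
  rw [norm_sq_cls]
  refine (Complex.re_le_norm _).trans (norm_integral_le_of_norm_le
    (integrable_coef C.plane C.μ f f).norm (Eventually.of_forall fun X => ?_))
  rw [coef_waveMul_waveMul, norm_mul, mul_comm Complex.I, ← neg_mul, ← Complex.ofReal_neg,
    Complex.norm_exp_ofReal_mul_I, one_mul]

theorem continuous_coef_waveMul (f g : 𝓢(Conf n, ℂ)) :
    Continuous fun p : C.plane × Conf n => coef g (waveMul p.2 f) (p.1 : Phase ℝ n) := by
  simp only [coef_waveMul_right]
  have h1 := continuous_coef g f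
  have h2 := continuous_momentum (n := n)
  fun_prop

/-- Peetre's inequality $1+\|X\|\le(1+\|X+P\|)(1+\|P\|)$ trades the momentum shift for polynomial
growth in $P$, which a Schwartz amplitude compensates. -/
theorem norm_coef_waveMul_le (f g : 𝓢(Conf n, ℂ)) (r : ℕ) :
    ∃ K, 0 ≤ K ∧ ∀ (P : Conf n) (X : Phase ℝ n),
      ‖coef g (waveMul P f) X‖ ≤ K * ((1 + ‖X‖) ^ r)⁻¹ * (1 + ‖P‖) ^ r := by
  obtain ⟨K₀, h₀⟩ := coef_decay 0 g f
  obtain ⟨K₁, h₁⟩ := coef_decay r g f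
  have hK : ∀ X, (1 + ‖X‖) ^ r * ‖coef g f X‖ ≤ 2 ^ (r - 1) * (K₀ + K₁) := fun X =>
    one_add_norm_pow_mul_le (by simpa using h₀ X) (h₁ X)
  refine ⟨2 ^ (r - 1) * (K₀ + K₁), le_trans (by positivity) (hK 0), fun P X => ?_⟩
  rw [coef_waveMul_right, norm_mul, mul_comm Complex.I, ← neg_mul, ← Complex.ofReal_neg,
    Complex.norm_exp_ofReal_mul_I, one_mul]
  have h2 : (1 + ‖X‖) ^ r ≤ (1 + ‖X + momentum P‖) ^ r * (1 + ‖P‖) ^ r := by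
    rw [← mul_pow]
    gcongr
    have h3 : ‖X‖ ≤ ‖X + momentum P‖ + ‖momentum P‖ := by
      have := norm_sub_le (X + momentum P) (momentum P)
      rwa [add_sub_cancel_right] at this
    nlinarith [norm_momentum_le P, norm_nonneg (X + momentum P), norm_nonneg P]
  rw [mul_right_comm, ← div_eq_mul_inv, le_div_iff₀ (by positivity), mul_comm]
  calc _ ≤ ((1 + ‖X + momentum P‖) ^ r * (1 + ‖P‖) ^ r) * ‖coef g f (X + momentum P)‖ := by gcongr
    _ = ((1 + ‖X + momentum P‖) ^ r * ‖coef g f (X + momentum P)‖) * (1 + ‖P‖) ^ r := by ring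
    _ ≤ _ := mul_le_mul_of_nonneg_right (hK _) (by positivity)

theorem integrable_one_add_pow_mul (φ : 𝓢(Conf n, ℂ)) (r : ℕ) :
    Integrable fun P : Conf n => ‖φ P‖ * (1 + ‖P‖) ^ r := by
  have h0 := φ.integrable_pow_mul volume 0
  have h1 := φ.integrable_pow_mul volume r
  refine ((h0.add h1).const_mul (2 ^ (r - 1))).mono' ?_ (Eventually.of_forall fun P => ?_)
  · have := φ.continuous
    exact Continuous.aestronglyMeasurable (by fun_prop)
  · rw [Real.norm_of_nonneg (by positivity)]
    have := add_pow_le (zero_le_one' ℝ) (norm_nonneg P) r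
    simp only [Pi.add_apply, pow_zero, one_mul]
    calc _ ≤ ‖φ P‖ * (2 ^ (r - 1) * (1 ^ r + ‖P‖ ^ r)) := by gcongr
      _ = _ := by rw [one_pow]; ring

/-- The product of two Schwartz functions. -/
def schwartzMul (u f : 𝓢(Conf n, ℂ)) : 𝓢(Conf n, ℂ) := SchwartzMap.smulLeftCLM ℂ (⇑u) f

theorem schwartzMul_apply (u f : 𝓢(Conf n, ℂ)) (ξ : Conf n) : schwartzMul u f ξ = u ξ * f ξ :=
  SchwartzMap.smulLeftCLM_apply_apply u.hasTemperateGrowth f ξ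

/-- The frequency of a plane wave in the Fourier integral. -/
def waveFreq (P : Conf n) : Conf n := (-2 * Real.pi) • P

theorem norm_waveFreq (P : Conf n) : ‖waveFreq P‖ = 2 * Real.pi * ‖P‖ := by
  rw [waveFreq, norm_smul, norm_mul, norm_neg, Real.norm_of_nonneg Real.pi_pos.le]
  simp

theorem fourier_apply (φ : 𝓢(Conf n, ℂ)) (η : Conf n) :
    (𝓕 φ) η = ∫ P, φ P * Complex.exp (Complex.I * (inner ℝ (waveFreq P) η : ℝ)) := by
  rw [SchwartzMap.fourier_coe, Real.fourier_eq']
  refine integral_congr_ae (Eventually.of_forall fun P => ?_)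
  simp only [waveFreq, inner_smul_left, smul_eq_mul]
  rw [mul_comm, mul_comm Complex.I]
  simp

theorem coef_schwartzMul_fourier (φ f g : 𝓢(Conf n, ℂ)) (X : Phase ℝ n) :
    coef g (schwartzMul (𝓕 φ) f) X = ∫ P, φ P * coef g (waveMul (waveFreq P) f) X := by
  obtain ⟨K, hK, hf⟩ := exists_bound f
  have hswap := integral_integral_swap (μ := (volume : Measure (Conf n)))
    (ν := (volume : Measure (Conf n)))
    (f := fun ξ P => φ P * (starRingEnd ℂ (g ξ) * weyl X (waveMul (waveFreq P) f) ξ)) (by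
      have hφ : Integrable (fun P => φ P) (volume : Measure (Conf n)) := φ.integrable
      have hg : Integrable (fun P => g P) (volume : Measure (Conf n)) := g.integrable
      refine ((hg.norm.mul_const K).mul_prod hφ.norm).mono' ?_ (Eventually.of_forall fun p => ?_)
      · have h1 := continuous_weyl_right f X
        have h2 := φ.continuous
        have h3 := g.continuous
        refine Continuous.aestronglyMeasurable ?_
        simp only [Function.uncurry_def, weyl_waveMul, waveFreq]
        fun_prop
      · simp only [Function.uncurry_def]
        rw [norm_mul, norm_mul, norm_weyl, Complex.norm_conj, waveMul_apply, norm_mul,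
          mul_comm Complex.I, Complex.norm_exp_ofReal_mul_I, one_mul, mul_comm]
        gcongr
        exact hf _)
  simp only [integral_const_mul] at hswap
  refine Eq.trans ?_ hswap
  rw [coef]
  refine integral_congr_ae (Eventually.of_forall fun ξ => ?_)
  simp only [weyl_waveMul]
  have e : weyl X (schwartzMul (𝓕 φ) f) ξ =
      (𝓕 φ) (ξ - WithLp.toLp 2 X.2) * weyl X f ξ := by
    rw [weyl, schwartzMul_apply, weyl]
    ring
  rw [e, fourier_apply, ← mul_assoc, mul_right_comm, ← integral_const_mul]
  refine integral_congr_ae (Eventually.of_forall fun P => ?_)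
  simp only
  ring

/-- A second exchange of integrals, now with the constraint plane; integrability is the decay in $X$
against polynomial growth in $P$. -/
theorem form_schwartzMul_fourier (φ f g : 𝓢(Conf n, ℂ)) :
    form C g (schwartzMul (𝓕 φ) f) = ∫ P, φ P * form C g (waveMul (waveFreq P) f) := by
  obtain ⟨K, hK, hb⟩ := norm_coef_waveMul_le f g (decayExp C)
  have hswap := integral_integral_swap (μ := C.μ) (ν := (volume : Measure (Conf n)))
    (f := fun (X : C.plane) P => φ P * coef g (waveMul (waveFreq P) f) (X : Phase ℝ n)) (by
      have h1 := ((integrable_decay C).const_mul K).mul_prod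
        ((integrable_one_add_pow_mul φ (decayExp C)).mul_const ((2 * Real.pi) ^ decayExp C))
      refine h1.mono' ?_ (Eventually.of_forall fun p => ?_)
      · have h2 := continuous_coef_waveMul C f g
        have h3 := φ.continuous
        refine Continuous.aestronglyMeasurable ?_
        have h4 : Continuous fun p : C.plane × Conf n => (p.1, waveFreq p.2) := by
          unfold waveFreq
          fun_prop
        exact (h3.comp continuous_snd).mul (h2.comp h4)
      · simp only [Function.uncurry_def]
        rw [norm_mul]
        calc _ ≤ ‖φ p.2‖ * (K * ((1 + ‖(p.1 : Phase ℝ n)‖) ^ decayExp C)⁻¹ *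
              (1 + ‖waveFreq p.2‖) ^ decayExp C) := by
              gcongr
              exact hb _ _
          _ ≤ ‖φ p.2‖ * (K * ((1 + ‖(p.1 : Phase ℝ n)‖) ^ decayExp C)⁻¹ *
              ((1 + ‖p.2‖) * (2 * Real.pi)) ^ decayExp C) := by
              gcongr
              rw [norm_waveFreq]
              nlinarith [Real.pi_gt_three, norm_nonneg p.2]
          _ = _ := by rw [mul_pow, Submodule.coe_norm]; ring)
  simp only [integral_const_mul] at hswap
  rw [form]
  simp only [coef_schwartzMul_fourier]
  exact hswap

/-- A vector orthogonal to all plane waves times `f` is orthogonal to `û f`. -/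
theorem inner_schwartzMul_fourier_eq_zero (f : 𝓢(Conf n, ℂ)) (h : Hilb C)
    (hw : ∀ P, inner ℂ h (cls C (waveMul P f) : Hilb C) = 0) (φ : 𝓢(Conf n, ℂ)) :
    inner ℂ h (cls C (schwartzMul (𝓕 φ) f) : Hilb C) = 0 := by
  set F := schwartzMul (𝓕 φ) f
  set N := Real.sqrt (∫ X : C.plane, ‖coef f f (X : Phase ℝ n)‖ ∂C.μ)
  set c := ‖cls C F‖ + ∫ P, ‖φ P‖ * N
  -- The integral formula holds only against classes of Schwartz functions, so $h$ is approximated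
  -- by such a class. The error is controlled because the norms of the plane waves are bounded
  -- uniformly in $P$.
  have key : ∀ ε > 0, ‖inner ℂ h (cls C F : Hilb C)‖ ≤ ε * c := by
    intro ε hε
    obtain ⟨u, hu⟩ := UniformSpace.Completion.denseRange_coe.exists_dist_lt h hε
    obtain ⟨g, rfl⟩ := cls_surjective C u
    have hsub : ∀ v : States C, inner ℂ (cls C g) v = inner ℂ h (v : Hilb C) -
        inner ℂ (h - (cls C g : Hilb C)) (v : Hilb C) := fun v => by
      rw [inner_sub_left, UniformSpace.Completion.inner_coe]
      ring
    have hd : ‖h - (cls C g : Hilb C)‖ ≤ ε := by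
      rw [← dist_eq_norm]
      exact hu.le
    have hi : ∀ v : States C, ‖inner ℂ (h - (cls C g : Hilb C)) (v : Hilb C)‖ ≤ ε * ‖v‖ := fun v => by
      refine (norm_inner_le_norm (𝕜 := ℂ) (h - (cls C g : Hilb C)) (v : Hilb C)).trans ?_
      rw [UniformSpace.Completion.norm_coe]
      gcongr
    have h1 : ‖inner ℂ (cls C g) (cls C F)‖ ≤ ε * ∫ P, ‖φ P‖ * N := by
      rw [inner_cls, form_schwartzMul_fourier, ← integral_const_mul]
      refine norm_integral_le_of_norm_le ((integrable_norm_mul φ N).const_mul ε)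
        (Eventually.of_forall fun P => ?_)
      rw [norm_mul, ← inner_cls, hsub, hw, zero_sub, norm_neg]
      calc _ ≤ ‖φ P‖ * (ε * N) := by
            gcongr
            refine (hi _).trans ?_
            gcongr
            exact norm_cls_waveMul_le C f _
        _ = _ := by ring
    have h2 : inner ℂ h (cls C F : Hilb C) = inner ℂ (cls C g) (cls C F) +
        inner ℂ (h - (cls C g : Hilb C)) (cls C F : Hilb C) := by
      rw [hsub]
      ring
    rw [h2]
    refine (norm_add_le _ _).trans ?_
    have := hi (cls C F)
    simp only [c]
    linarith
  have hc : 0 ≤ c := by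
    have : 0 ≤ ∫ P, ‖φ P‖ * N := integral_nonneg fun P => by positivity
    positivity
  have hle : ‖inner ℂ h (cls C F : Hilb C)‖ ≤ 0 := by
    refine le_of_forall_pos_le_add fun ε hε => ?_
    have := key (ε / (c + 1)) (by positivity)
    rw [zero_add]
    refine this.trans ?_
    rw [div_mul_eq_mul_div, div_le_iff₀ (by positivity)]
    nlinarith
  exact norm_le_zero_iff.1 hle

end Superposition

/-! ### Completeness of the excited states -/

section Cutoff

open scoped ContDiff

open scoped FourierTransform

variable {n : ℕ}

/-- A smooth cutoff function, equal to `1` on the unit ball. -/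
def cutoff (n : ℕ) (x : Conf n) : ℂ :=
  (((⟨1, 2, one_pos, one_lt_two⟩ : ContDiffBump (0 : Conf n)) x : ℝ) : ℂ)

theorem contDiff_cutoff : ContDiff ℝ ∞ (cutoff n) :=
  Complex.ofRealCLM.contDiff.comp (ContDiffBump.contDiff _)

theorem hasCompactSupport_cutoff : HasCompactSupport (cutoff n) :=
  (ContDiffBump.hasCompactSupport _).comp_left Complex.ofReal_zero

theorem cutoff_of_norm_le {x : Conf n} (hx : ‖x‖ ≤ 1) : cutoff n x = 1 := by
  rw [cutoff, ContDiffBump.one_of_mem_closedBall _ (by simpa using hx), Complex.ofReal_one]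

theorem exists_norm_iteratedFDeriv_one_sub_cutoff_le (l : ℕ) :
    ∃ K, 0 ≤ K ∧ ∀ i ≤ l, ∀ x, ‖iteratedFDeriv ℝ i (fun x => 1 - cutoff n x) x‖ ≤ K := by
  let χ : 𝓢(Conf n, ℂ) := hasCompactSupport_cutoff.toSchwartzMap contDiff_cutoff
  have hK : ∀ i, 0 ≤ SchwartzMap.seminorm ℝ 0 i χ := fun i => apply_nonneg _ _
  refine ⟨1 + ∑ i ∈ Finset.range (l + 1), SchwartzMap.seminorm ℝ 0 i χ,
    add_nonneg zero_le_one (Finset.sum_nonneg fun i _ => hK i), fun i hi x => ?_⟩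
  have h1 : iteratedFDeriv ℝ i (fun x => 1 - cutoff n x) x =
      iteratedFDeriv ℝ i (fun _ => (1 : ℂ)) x - iteratedFDeriv ℝ i (cutoff n) x :=
    iteratedFDeriv_sub_apply contDiff_const.contDiffAt
      (contDiff_cutoff.contDiffAt.of_le (mod_cast le_top))
  have h2 : ‖iteratedFDeriv ℝ i (fun _ : Conf n => (1 : ℂ)) x‖ ≤ 1 := by
    rcases Nat.eq_zero_or_pos i with rfl | hpos
    · simp
    · rw [iteratedFDeriv_const_of_ne hpos.ne']
      simp
  have h3 : ‖iteratedFDeriv ℝ i (cutoff n) x‖ ≤ SchwartzMap.seminorm ℝ 0 i χ :=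
    SchwartzMap.norm_iteratedFDeriv_le_seminorm ℝ χ i x
  have h4 := Finset.single_le_sum (f := fun i => SchwartzMap.seminorm ℝ 0 i χ) (fun i _ => hK i)
    (Finset.mem_range.2 (Nat.lt_succ_of_le hi))
  rw [h1]
  refine (norm_sub_le _ _).trans ?_
  linarith

theorem norm_iteratedFDeriv_comp_smul_le {g : Conf n → ℂ} (hg : ContDiff ℝ ∞ g) {c : ℝ}
    (hc : |c| ≤ 1) (i : ℕ) (x : Conf n) :
    ‖iteratedFDeriv ℝ i (fun x => g (c • x)) x‖ ≤ ‖iteratedFDeriv ℝ i g (c • x)‖ := by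
  let T : Conf n →L[ℝ] Conf n := c • ContinuousLinearMap.id ℝ (Conf n)
  have hT : ‖T‖ ≤ 1 := by
    refine ContinuousLinearMap.opNorm_le_bound _ zero_le_one fun x => ?_
    change ‖c • x‖ ≤ _
    rw [norm_smul]
    exact mul_le_mul_of_nonneg_right hc (norm_nonneg x)
  have h1 := T.iteratedFDeriv_comp_right hg x (i := i) (mod_cast le_top)
  change ‖iteratedFDeriv ℝ i (g ∘ T) x‖ ≤ ‖iteratedFDeriv ℝ i g (T x)‖
  rw [h1]
  refine (ContinuousMultilinearMap.norm_compContinuousLinearMap_le _ _).trans ?_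
  refine mul_le_of_le_one_right (norm_nonneg _) ?_
  exact Finset.prod_le_one (fun _ _ => norm_nonneg _) fun _ _ => hT

/-- The truncation of a Schwartz function to a large ball. -/
def truncate (f : 𝓢(Conf n, ℂ)) (m : ℕ) : 𝓢(Conf n, ℂ) :=
  HasCompactSupport.toSchwartzMap (f := fun x => cutoff n (((m : ℝ) + 1)⁻¹ • x) * f x)
    ((hasCompactSupport_cutoff.comp_smul (by positivity)).mul_right)
    ((contDiff_cutoff.comp (contDiff_const_smul _)).mul (f.smooth ⊤))

theorem truncate_apply (f : 𝓢(Conf n, ℂ)) (m : ℕ) (x : Conf n) :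
    truncate f m x = cutoff n (((m : ℝ) + 1)⁻¹ • x) * f x := rfl

theorem hasCompactSupport_truncate (f : 𝓢(Conf n, ℂ)) (m : ℕ) :
    HasCompactSupport (truncate f m) :=
  HasCompactSupport.mul_right (f := fun x => cutoff n (((m : ℝ) + 1)⁻¹ • x)) (f' := f)
    (hasCompactSupport_cutoff.comp_smul (by positivity))

/-- The factor $1-\chi(x/(m+1))$ vanishes for $\|x\|<m+1$, and elsewhere its derivatives are bounded
by a multiple of $(1+\|x\|)/(m+1)$; one extra power of decay of $f$ gives the rate. -/
theorem tendsto_truncate (f : 𝓢(Conf n, ℂ)) : Tendsto (truncate f) atTop (𝓝 f) := by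
  rw [← tendsto_sub_nhds_zero_iff]
  suffices hs : Tendsto (fun m => f - truncate f m) atTop (𝓝 0) by
    simpa only [neg_sub, neg_zero] using hs.neg
  refine tendsto_schwartz_zero fun k l => ?_
  obtain ⟨K, hK, hb⟩ := exists_norm_iteratedFDeriv_one_sub_cutoff_le (n := n) l
  set p : ℕ → ℝ := fun i => SchwartzMap.seminorm ℝ k i f + SchwartzMap.seminorm ℝ (k + 1) i f
  have hp : ∀ i, 0 ≤ p i := fun i => add_nonneg (apply_nonneg _ _) (apply_nonneg _ _)
  set B := ∑ i ∈ Finset.range (l + 1), p i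
  have hB : 0 ≤ B := Finset.sum_nonneg fun i _ => hp i
  have hg : ContDiff ℝ ∞ fun x => 1 - cutoff n x := contDiff_const.sub contDiff_cutoff
  have hle : ∀ m : ℕ, SchwartzMap.seminorm ℝ k l (f - truncate f m) ≤
      2 ^ l * (K * (1 / ((m : ℝ) + 1)) * B) := by
    intro m
    have hm : (0 : ℝ) < (m : ℝ) + 1 := by positivity
    have hm1 : |((m : ℝ) + 1)⁻¹| ≤ 1 := by
      rw [abs_of_pos (by positivity)]
      exact inv_le_one_of_one_le₀ (by linarith [Nat.cast_nonneg (α := ℝ) m])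
    refine seminorm_mul_le (g := fun x => 1 - cutoff n (((m : ℝ) + 1)⁻¹ • x)) (f := f)
      (w := fun x => 1 + ‖x‖) (hg.comp (contDiff_const_smul _)) (fun x => ?_) (by positivity) hB
      (fun i hi x => ?_) fun i hi x => ?_
    · rw [sub_apply, truncate_apply]
      ring
    · by_cases hx : ‖x‖ < (m : ℝ) + 1
      · have h0 : (fun x => 1 - cutoff n (((m : ℝ) + 1)⁻¹ • x)) =ᶠ[𝓝 x] fun _ => (0 : ℂ) := by
          have hopen : IsOpen {x : Conf n | ‖x‖ < (m : ℝ) + 1} :=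
            isOpen_lt continuous_norm continuous_const
          filter_upwards [hopen.mem_nhds hx] with y hy
          have hy : ‖y‖ < (m : ℝ) + 1 := hy
          rw [cutoff_of_norm_le, sub_self]
          rw [norm_smul, norm_inv, Real.norm_of_nonneg hm.le, inv_mul_le_iff₀ hm]
          linarith
        rw [(h0.iteratedFDeriv ℝ i).eq_of_nhds, iteratedFDeriv_fun_zero]
        simp only [Pi.zero_apply, norm_zero]
        positivity
      · push Not at hx
        refine (norm_iteratedFDeriv_comp_smul_le hg hm1 i x).trans ((hb i hi _).trans ?_)
        rw [mul_assoc]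
        refine le_mul_of_one_le_right hK ?_
        rw [one_div, inv_mul_eq_div, one_le_div hm]
        linarith
    · have h1 := SchwartzMap.le_seminorm ℝ k i f x
      have h2 := SchwartzMap.le_seminorm ℝ (k + 1) i f x
      have h3 := Finset.single_le_sum (f := p) (fun i _ => hp i)
        (Finset.mem_range.2 (Nat.lt_succ_of_le hi))
      refine le_trans (le_of_eq_of_le ?_ (add_le_add h1 h2)) h3
      rw [pow_succ]
      ring
  refine squeeze_zero (fun m => apply_nonneg _ _) hle ?_
  simpa using ((tendsto_one_div_add_atTop_nhds_zero_nat (𝕜 := ℝ)).const_mul K |>.mul_const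
    B).const_mul (2 ^ l : ℝ)

/-- As $\psi$ has no zeros, $f/\psi$ is smooth with compact support; $\varphi$ is its inverse
Fourier transform. -/
theorem exists_eq_schwartzMul_fourier {ψ f : 𝓢(Conf n, ℂ)} (hψ : ∀ ξ, ψ ξ ≠ 0)
    (hf : HasCompactSupport f) : ∃ φ : 𝓢(Conf n, ℂ), f = schwartzMul (𝓕 φ) ψ := by
  have hc : HasCompactSupport fun ξ => f ξ * (ψ ξ)⁻¹ := hf.mul_right
  let u : 𝓢(Conf n, ℂ) := hc.toSchwartzMap ((f.smooth ⊤).mul ((ψ.smooth ⊤).inv hψ))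
  refine ⟨𝓕⁻ u, ?_⟩
  ext ξ
  rw [FourierTransform.fourier_fourierInv_eq, schwartzMul_apply]
  change f ξ = f ξ * (ψ ξ)⁻¹ * ψ ξ
  rw [inv_mul_cancel_right₀ (hψ ξ)]

end Cutoff

/-! ### Density of the span of the excited states. -/

section Completeness

variable {n : ℕ} {A : Matrix (Fin n) (Fin n) ℂ} {ψ : 𝓢(Conf n, ℂ)}

/-- A vector orthogonal to the excited states is orthogonal to all plane waves times $\psi$, hence
to all compactly supported functions, hence by truncation and continuity of the class map to a dense
set. -/
theorem IsGaussian.topologicalClosure_excited (C : ConstraintPlane n) (h : IsGaussian A ψ)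
    {Γ : Reduced C.plane ⊗[ℝ] Reduced C.plane} {d : ℕ} {β : Fin d → ℝ}
    {Y : Fin d → Reduced (cxPlane C.plane)}
    (hY : IsModeFamily (redSymp (cxPlane C.plane)) (conjRed C.plane) (cxFlow C.plane Γ) β Y)
    (hA : redLagr C A = Submodule.span ℂ (Set.range Y)) :
    (Submodule.span ℂ (Set.range fun N : Fin d → ℕ =>
      (excited C Y ψ N : Hilb C))).topologicalClosure = ⊤ := by
  rw [Submodule.topologicalClosure_eq_top_iff, Submodule.eq_bot_iff]
  intro v hv
  let T : States C →L[ℂ] ℂ := (innerSL ℂ v).comp UniformSpace.Completion.toComplL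
  have hT : ∀ u : States C, T u = inner ℂ v (u : Hilb C) := fun u => rfl
  have hle : (excitedSpan C Y ψ).topologicalClosure ≤ LinearMap.ker T.toLinearMap := by
    refine Submodule.topologicalClosure_minimal _ (Submodule.span_le.2 ?_) T.isClosed_ker
    rintro _ ⟨N, rfl⟩
    change T _ = 0
    rw [hT]
    exact (Submodule.mem_orthogonal' _ v).1 hv _ (Submodule.subset_span ⟨N, rfl⟩)
  have hcompact : ∀ f : 𝓢(Conf n, ℂ), HasCompactSupport f → T (cls C f) = 0 := by
    intro f hf
    obtain ⟨φ, rfl⟩ := exists_eq_schwartzMul_fourier h.ne_zero hf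
    exact inner_schwartzMul_fourier_eq_zero C ψ v (fun P => hle (h.waveMul_mem C hY hA P)) φ
  have hall : ∀ f : 𝓢(Conf n, ℂ), T (cls C f) = 0 := by
    intro f
    have hc : Continuous fun f => T (clsLM C f) := T.continuous.comp (continuous_clsLM C)
    refine tendsto_nhds_unique ((hc.tendsto f).comp (tendsto_truncate f)) ?_
    refine tendsto_const_nhds.congr fun m => ?_
    exact (hcompact _ (hasCompactSupport_truncate f m)).symm
  have hzero : ∀ u : Hilb C, inner ℂ v u = 0 := by
    intro u
    induction u using UniformSpace.Completion.induction_on with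
    | hp => exact isClosed_eq (by fun_prop) continuous_const
    | ih u =>
      obtain ⟨f, rfl⟩ := cls_surjective C u
      exact hall f
  exact inner_self_eq_zero.1 (hzero v)

end Completeness

end ConstrainedQM

end

theorem lemma18 {n k : ℕ} (C : ConstrainedQM.ConstraintPlane n)
    (hk : Module.finrank ℝ C.plane = k)
    (Γ : ConstrainedQM.Reduced C.plane ⊗[ℝ] ConstrainedQM.Reduced C.plane)
    (hΓ : TensorProduct.comm ℝ _ _ Γ = Γ) :
    ((∃ (A : Matrix (Fin n) (Fin n) ℂ) (ψ : 𝓢(ConstrainedQM.Conf n, ℂ)) (lam : ℂ),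
        ConstrainedQM.IsGaussian A ψ ∧
        (ConstrainedQM.redOm2 C Γ).HasEigenvector lam (ConstrainedQM.cls C ψ)) →
      ConstrainedQM.ReducedStable C Γ) ∧
    (ConstrainedQM.ReducedStable C Γ →
      (∃ (β : Fin (n - k) → ℝ)
        (Y : Fin (n - k) → ConstrainedQM.Reduced (ConstrainedQM.cxPlane C.plane)),
        ConstrainedQM.IsNormalModes C Γ β Y) ∧
      ∀ (β : Fin (n - k) → ℝ)
        (Y : Fin (n - k) → ConstrainedQM.Reduced (ConstrainedQM.cxPlane C.plane)),
        ConstrainedQM.IsNormalModes C Γ β Y →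
        ∀ y : Fin (n - k) → ConstrainedQM.perp (ConstrainedQM.cxPlane C.plane),
        (∀ I, Submodule.Quotient.mk (y I) = Y I) →
        (∃ (A : Matrix (Fin n) (Fin n) ℂ) (ψ : 𝓢(ConstrainedQM.Conf n, ℂ)),
          ConstrainedQM.IsGaussian A ψ ∧
          ConstrainedQM.hGerm C ψ = (Submodule.span ℂ
            (Set.range (fun I => (y I : ConstrainedQM.Phase ℂ n)) ∪
              (ConstrainedQM.cxPlane C.plane : Set (ConstrainedQM.Phase ℂ n))) :
              Set (ConstrainedQM.Phase ℂ n))) ∧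
        ∀ (A : Matrix (Fin n) (Fin n) ℂ) (ψ : 𝓢(ConstrainedQM.Conf n, ℂ)),
          ConstrainedQM.IsGaussian A ψ →
          ConstrainedQM.hGerm C ψ = (Submodule.span ℂ
            (Set.range (fun I => (y I : ConstrainedQM.Phase ℂ n)) ∪
              (ConstrainedQM.cxPlane C.plane : Set (ConstrainedQM.Phase ℂ n))) :
              Set (ConstrainedQM.Phase ℂ n)) →
          (∀ N : Fin (n - k) → ℕ,
            (ConstrainedQM.redOm2 C Γ).HasEigenvector
              (∑ I, (β I : ℂ) * ((N I : ℂ) + 1 / 2)) (ConstrainedQM.excited C Y ψ N)) ∧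
          (Submodule.span ℂ (Set.range fun N : Fin (n - k) → ℕ =>
            (ConstrainedQM.excited C Y ψ N : ConstrainedQM.Hilb C))).topologicalClosure = ⊤) := by
  subst hk
  refine ⟨fun ⟨A, ψ, lam, hψ, hv⟩ => ConstrainedQM.reducedStable_of_eigenvector C hψ hΓ hv, fun hst =>
    ⟨hst.exists_isNormalModes C hΓ, fun β Y hY y hy => ?_⟩⟩
  have hm := hY.isModeFamily C
  have hd := ConstrainedQM.finrank_reduced_cxPlane C
  -- From here on the representatives play no role: the germ is the preimage of the span of the
  -- modes.
  rw [ConstrainedQM.span_union_cxPlane C hy]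
  refine ⟨?_, fun A ψ hψ hg => ?_⟩
  · obtain ⟨A, ψ, hψ, h⟩ := ConstrainedQM.exists_isGaussian_redLagr_eq C hm hd
    exact ⟨A, ψ, hψ, (hψ.hGerm_eq_iff C).2 h⟩
  · have hA := (hψ.hGerm_eq_iff C).1 hg
    refine ⟨ConstrainedQM.hasEigenvector_excited C hΓ hm hd (fun I => ?_) (hψ.cls_ne_zero C), ?_⟩
    · refine ConstrainedQM.redOm_cls_of_mem C hψ ?_
      rw [hA]
      exact Submodule.subset_span ⟨I, rfl⟩
    · exact hψ.topologicalClosure_excited C hm hA
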